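/- **Theorem 1 (Stochastic coupling).** *Setting.* Let $\ell_1,\dots,\ell_n:\mathbb R^d\to\mathbb R$, $L=\frac1n\sum_i\ell_i$, and let $\eta>0$, $1\le b\le n$. SGD is $\theta_{t+1}=\theta_t-\eta g_{B_t}(\theta_t)$ with $g_B(\theta)=\frac1b\sum_{i\in B}\nabla\ell_i(\theta)$, where $\theta_0$ is deterministic and $B_0,B_1,\dots$ are independent and uniform among the subsets of $\{1,\dots,n\}$ of size $b$; the noise is $\xi_t=g_{B_t}(\theta_t)-\nabla L(\theta_t)$. Write $H=\nabla^2L$, with eigenvalues $\lambda_1\ge\lambda_2\ge\dots\ge\lambda_d=\lambda_{\min}$, $S=\lambda_1(H)$ (sharpness), $u(\theta)$ for a unit eigenvector of $H(\theta)$ for $\lambda_1$, and $P_w^\perp$ for the orthogonal projection onto $w^\perp$. Let $\mathcal M=\{\theta: S(\theta)\le 2/\eta,\ \langle\nabla L(\theta),u(\theta)\rangle=0\}$. The constrained trajectory (projected gradient descent, PGD) is $\theta^\dagger_0=\mathrm{proj}_{\mathcal M}(\theta_0)$, $\theta^\dagger_{t+1}=\mathrm{proj}_{\mathcal M}(\theta^\dagger_t-\eta\nabla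 L(\theta^\dagger_t))$, where $\mathrm{proj}_{\mathcal M}(z)$ is a nearest point of $\mathcal M$ to $z$; it is considered up to a horizon $T\in\mathbb N$. Assume $S(\theta^\dagger_0)=2/\eta$. A subscript $t$ on $\nabla L,H,u,\nabla S$ means evaluation at $\theta^\dagger_t$, and the signs of the eigenvectors are chosen so that $\langle u_t,u_{t+1}\rangle\ge0$. Put $$\nabla S_t^\perp=P_{u_t}^\perp\nabla S_t,\quad \kappa_t=\langle\nabla S_t,u_t\rangle,\quad \alpha_t=-\langle\nabla L_t,\nabla S_t\rangle,\quad \beta_t=\|\nabla S_t^\perp\|^2,$$ $$\delta_t=\sqrt{2\alpha_t/\beta_t},\quad \epsilon_t=\eta\sqrt{\alpha_t},\quad \delta=\sup_{t\le T}\delta_t,\quad \epsilon=\sup_{t\le T}\epsilon_t.$$ Let $v_t=\theta_t-\theta^\dagger_t$. The stochastic predicted dynamics are $\hat v_0=v_0$ and, with $\hat x_t=\langle u_t,\hat v_t\rangle$, $\hat y_t=\langle\nabla S_t^\perp,\hat v_t\rangle$, $$\hat v_{t+1}=P_{u_{t+1}}^\perp\Big[(I-\eta H_t)P_{u_t}^\perp\hat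 v_t+\eta\nabla S_t^\perp\tfrac{\delta_t^2-\hat x_t^2}{2}\Big]-\Big((1+\eta\hat y_t)\hat x_t+\tfrac\eta2\kappa_t\hat x_t^2\Big)u_{t+1}-\eta\xi_t .$$ *Assumptions*, with constants $c_{\rm gap}<2$, $c_\alpha,c_\beta>0$, $C_{\rm nw},C_\xi,C_\rho$, $c_T$ and with $\rho_3>0$, $\rho_4$, for all $t\le T$: 1. (Eigengap) $\lambda_2(H_t)<c_{\rm gap}/\eta$. 2. (Regularity) There is an open set $\mathcal N$ containing the balls of radius $\frac{2-c_{\rm gap}}{4\eta\rho_3}$ around all $\theta^\dagger_t$, on which every $\ell_i$ is $C^4$, $\|\nabla^3L\|_{op}\le\rho_3$, and $\nabla^3L$ is $\rho_4$-Lipschitz in operator norm. 3. (Progressive sharpening) $\alpha_t\ge c_\alpha\|\nabla L_t\|\|\nabla S_t^\perp\|$ and $\|\nabla S_t^\perp\|\ge c_\beta\rho_3$. 4. (Non-worst-case bounds) For all $v,w\perp u_t$: $\|\nabla^3L_t(v,w)\|\le C_{\rm nw}\epsilon\rho_3\|v\|\|w\|$, $|v^\top H_tv|\le C_{\rm nw}\epsilon\|H_t\|\|v\|^2$,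 and $|\lambda_{\min}(H_t)|\le C_{\rm nw}\epsilon\|H_t\|$. 5. (Noise non-degeneracy) $\mathbb E\langle u_t,\xi_t\rangle^2>0$. 6. (Scaling) $T\le c_T/\epsilon$, $\mathbb E\|\xi_t\|^2\le C_\xi\,\epsilon\delta^2/\eta^2$, and $\rho_4\le C_\rho\,\eta\rho_3^2$. *Claim.* For all $c_{\rm gap}<2$, $c_\alpha,c_\beta>0$, $C_{\rm nw},C_\xi,C_\rho$ there are $c_T,c_0>0$ such that for every $\omega\in(0,1)$ there are $\epsilon_0>0$ and $C>0$ (depending on nothing but these constants and $\omega$) with the following property. Whenever the assumptions hold, $\epsilon\le\epsilon_0$ and $\|v_0\|^2\le c_0\delta^2$, then with probability at least $1-\omega$, for all $t\le T$ simultaneously, $$\max\{\|v_t\|,\|\hat v_t\|\}\le C\delta,\qquad \|v_t-\hat v_t\|\le C\epsilon\delta,$$ $$\Big|L(\theta_t)-L(\theta^\dagger_t)-\tfrac1\eta\hat x_t^2\Big|\le C\,\frac{\epsilon\delta^2}{\eta},\qquad \Big|S(\theta_t)-\tfrac2\eta-\hat y_t-\kappa_t\hat x_t\Big|\le C\,\frac{\epsilon^2}{\eta}.$$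 -/

import Mathlib

open MeasureTheory ProbabilityTheory

noncomputable section

namespace SGDCoupling

/-- Parameter space `ℝᵈ` with its Euclidean norm. -/
abbrev Vec (d : ℕ) := EuclideanSpace ℝ (Fin d)

/-- Linear operators on `ℝᵈ`, with the operator norm. -/
abbrev Op (d : ℕ) := Vec d →L[ℝ] Vec d

variable {d n : ℕ}

/-! ### Derivatives of the loss, eigenvalues, sharpness -/

/-- The Hessian `∇²f(θ)`, as an operator. -/
def hess (f : Vec d → ℝ) (θ : Vec d) : Op d := fderiv ℝ (gradient f) θ

/-- The third derivative `∇³f(θ)`, as the bilinear map `(v, w) ↦ ∇³f(θ)(v, w) ∈ ℝᵈ`; its norm is the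
operator norm. -/
def third (f : Vec d → ℝ) (θ : Vec d) : Vec d →L[ℝ] Op d := fderiv ℝ (hess f) θ

open Classical in
/-- The eigenvalues of a symmetric operator in decreasing order, with multiplicity:
`eig A 0 ≥ eig A 1 ≥ … ≥ eig A (d - 1)`. -/
def eig (A : Op d) (i : ℕ) : ℝ :=
  if h : (A : Vec d →ₗ[ℝ] Vec d).IsSymmetric ∧ i < d then
    h.1.eigenvalues finrank_euclideanSpace_fin ⟨i, h.2⟩
  else 0

/-- The sharpness `S(θ) = λ_max(∇²L(θ))`. -/
def sharpness (L : Vec d → ℝ) (θ : Vec d) : ℝ := eig (hess L θ) 0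

/-- `w` is a unit eigenvector of `A` for its largest eigenvalue. -/
def IsTopEigenvector (A : Op d) (w : Vec d) : Prop := ‖w‖ = 1 ∧ A w = eig A 0 • w

/-- `u(θ)` is a unit top eigenvector of the Hessian of `L` wherever that Hessian makes sense. -/
def IsTopEigenvectorField (L : Vec d → ℝ) (u : Vec d → Vec d) : Prop :=
  ∀ θ, ContDiffAt ℝ 2 L θ → IsTopEigenvector (hess L θ) (u θ)

/-- For a unit vector `w`: the orthogonal projection of `v` onto the complement of `w`. -/
def perp (w v : Vec d) : Vec d := v - inner ℝ w v • w

/-! ### Stable set and constrained trajectory -/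

/-- The stable set `{θ : S(θ) ≤ 2/η, ⟨∇L(θ), u(θ)⟩ = 0}`. -/
def stableSet (L : Vec d → ℝ) (u : Vec d → Vec d) (η : ℝ) : Set (Vec d) :=
  {θ | sharpness L θ ≤ 2 / η ∧ inner ℝ (gradient L θ) (u θ) = 0}

/-- `p` is a nearest point of `M` to `z`. -/
def IsProj (M : Set (Vec d)) (z p : Vec d) : Prop :=
  p ∈ M ∧ ∀ q ∈ M, ‖z - p‖ ≤ ‖z - q‖

/-- `θc 0, …, θc T` is projected gradient descent on the stable set, started from the
projection of `θ₀`. -/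
def IsConstrainedTrajectory (L : Vec d → ℝ) (u : Vec d → Vec d) (η : ℝ) (T : ℕ) (θ₀ : Vec d)
    (θc : ℕ → Vec d) : Prop :=
  IsProj (stableSet L u η) θ₀ (θc 0) ∧
    ∀ t < T, IsProj (stableSet L u η) (θc t - η • gradient L (θc t)) (θc (t + 1))

/-! ### Landscape quantities -/

/-- `∇S(θ)`. -/
def gradS (L : Vec d → ℝ) (θ : Vec d) : Vec d := gradient (sharpness L) θ

/-- `∇S(θ)^⊥`, the part of `∇S(θ)` orthogonal to `u(θ)`. -/
def gradSperp (L : Vec d → ℝ) (u : Vec d → Vec d) (θ : Vec d) : Vec d := perp (u θ) (gradS L θ)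

/-- `κ = ⟨∇S, u⟩`. -/
def kappa (L : Vec d → ℝ) (u : Vec d → Vec d) (θ : Vec d) : ℝ := inner ℝ (gradS L θ) (u θ)

/-- `α = -⟨∇L, ∇S⟩`. -/
def alpha (L : Vec d → ℝ) (θ : Vec d) : ℝ := -inner ℝ (gradient L θ) (gradS L θ)

/-- `β = ‖∇S^⊥‖²`. -/
def beta (L : Vec d → ℝ) (u : Vec d → Vec d) (θ : Vec d) : ℝ := ‖gradSperp L u θ‖ ^ 2

/-- `√(2α/β)` at one point. -/
def deltaAt (L : Vec d → ℝ) (u : Vec d → Vec d) (θ : Vec d) : ℝ :=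
  √(2 * alpha L θ / beta L u θ)

/-- `η√α` at one point. -/
def epsAt (L : Vec d → ℝ) (η : ℝ) (θ : Vec d) : ℝ := η * √(alpha L θ)

/-- `δ = sup_{t ≤ T} δ_t`. -/
def delta (L : Vec d → ℝ) (u : Vec d → Vec d) (T : ℕ) (θc : ℕ → Vec d) : ℝ :=
  ⨆ t : Fin (T + 1), deltaAt L u (θc t)

/-- `ε = sup_{t ≤ T} ε_t`. -/
def eps (L : Vec d → ℝ) (η : ℝ) (T : ℕ) (θc : ℕ → Vec d) : ℝ :=
  ⨆ t : Fin (T + 1), epsAt L η (θc t)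

/-! ### Stochastic gradient descent -/

/-- The empirical loss `L = (1/n) ∑ ℓ_i`. -/
def empLoss (ℓ : Fin n → Vec d → ℝ) (θ : Vec d) : ℝ := (n : ℝ)⁻¹ * ∑ i, ℓ i θ

/-- The mini-batch gradient `(1/b) ∑_{i ∈ B} ∇ℓ_i(θ)`. -/
def batchGrad (ℓ : Fin n → Vec d → ℝ) (b : ℕ) (B : Finset (Fin n)) (θ : Vec d) : Vec d :=
  (b : ℝ)⁻¹ • ∑ i ∈ B, gradient (ℓ i) θ

/-- The SGD iterates along a given sequence of batches. -/
def sgd (ℓ : Fin n → Vec d → ℝ) (η : ℝ) (b : ℕ) (θ₀ : Vec d) (B : ℕ → Finset (Fin n)) :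
    ℕ → Vec d
  | 0 => θ₀
  | t + 1 => sgd ℓ η b θ₀ B t - η • batchGrad ℓ b (B t) (sgd ℓ η b θ₀ B t)

/-- The gradient noise `ξ_t = g_{B_t}(θ_t) - ∇L(θ_t)`. -/
def noise (ℓ : Fin n → Vec d → ℝ) (η : ℝ) (b : ℕ) (θ₀ : Vec d) (B : ℕ → Finset (Fin n))
    (t : ℕ) : Vec d :=
  batchGrad ℓ b (B t) (sgd ℓ η b θ₀ B t) - gradient (empLoss ℓ) (sgd ℓ η b θ₀ B t)

/-- The random batches `B_t` are independent, each uniform among the subsets of size `b`. -/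
def IsUniformSampling {Ω : Type*} [MeasurableSpace Ω] (P : Measure Ω) (b : ℕ)
    (B : ℕ → Ω → Finset (Fin n)) : Prop :=
  (∀ t s, MeasurableSet {ω | B t ω = s}) ∧
  (∀ t s, s.card = b → P {ω | B t ω = s} = ((n.choose b : ℕ) : ENNReal)⁻¹) ∧
  iIndepFun (β := fun _ => Finset (Fin n)) (m := fun _ => ⊤) B P

/-! ### Stochastic predicted dynamics -/

/-- The deterministic part of the predicted step from time `t` (base point `p`) to time `t + 1`
(base point `q`), in terms of `x = ⟨u_t, v⟩` and `y = ⟨∇S_t^⊥, v⟩`. -/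
def predStep (L : Vec d → ℝ) (u : Vec d → Vec d) (η : ℝ) (p q v : Vec d) : Vec d :=
  let x : ℝ := inner ℝ (u p) v
  let y : ℝ := inner ℝ (gradSperp L u p) v
  perp (u q)
      ((perp (u p) v - η • hess L p (perp (u p) v)) +
        (η * ((deltaAt L u p ^ 2 - x ^ 2) / 2)) • gradSperp L u p) -
    ((1 + η * y) * x + η / 2 * kappa L u p * x ^ 2) • u q

/-- The stochastic predicted dynamics `v̂_t` driven by the noise sequence `ξ`. -/
def predicted (L : Vec d → ℝ) (u : Vec d → Vec d) (η : ℝ) (θc : ℕ → Vec d) (v₀ : Vec d)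
    (ξ : ℕ → Vec d) : ℕ → Vec d
  | 0 => v₀
  | t + 1 =>
    predStep L u η (θc t) (θc (t + 1)) (predicted L u η θc v₀ ξ t) - η • ξ t

/-! ### Assumptions -/

/-- Eigengap: `λ₂(∇²L(θc t)) < cgap / η`. -/
def Eigengap (cgap : ℝ) (L : Vec d → ℝ) (η : ℝ) (T : ℕ) (θc : ℕ → Vec d) : Prop :=
  ∀ t ≤ T, eig (hess L (θc t)) 1 < cgap / η

/-- The sample losses are `C⁴` on a neighbourhood `N` of the constrained trajectory on which `∇³L`
is bounded by `ρ₃` and `ρ₄`-Lipschitz.  The neighbourhood contains the balls of radius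
`(2 - cgap) / (4 η ρ₃)` around the trajectory. -/
def Regularity (cgap ρ₃ ρ₄ : ℝ) (ℓ : Fin n → Vec d → ℝ) (η : ℝ) (T : ℕ) (θc : ℕ → Vec d) : Prop :=
  ∃ N : Set (Vec d), IsOpen N ∧
    (∀ t ≤ T, Metric.ball (θc t) ((2 - cgap) / (4 * η * ρ₃)) ⊆ N) ∧
    (∀ i, ContDiffOn ℝ 4 (ℓ i) N) ∧
    (∀ θ ∈ N, ‖third (empLoss ℓ) θ‖ ≤ ρ₃) ∧
    (∀ θ ∈ N, ∀ θ' ∈ N, ‖third (empLoss ℓ) θ - third (empLoss ℓ) θ'‖ ≤ ρ₄ * ‖θ - θ'‖)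

/-- Progressive sharpening. -/
def ProgressiveSharpening (cα cβ ρ₃ : ℝ) (L : Vec d → ℝ) (u : Vec d → Vec d) (T : ℕ)
    (θc : ℕ → Vec d) : Prop :=
  ∀ t ≤ T, cα * (‖gradient L (θc t)‖ * ‖gradSperp L u (θc t)‖) ≤ alpha L (θc t) ∧
    cβ * ρ₃ ≤ ‖gradSperp L u (θc t)‖

/-- Non-worst-case bounds (`λ_min` is the last eigenvalue, of index `d - 1`). -/
def NonWorstCase (Cnw ρ₃ : ℝ) (L : Vec d → ℝ) (u : Vec d → Vec d) (η : ℝ) (T : ℕ)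
    (θc : ℕ → Vec d) : Prop :=
  ∀ t ≤ T,
    (∀ v w : Vec d, inner ℝ (u (θc t)) v = 0 → inner ℝ (u (θc t)) w = 0 →
      ‖third L (θc t) v w‖ ≤ Cnw * eps L η T θc * (ρ₃ * ‖v‖ * ‖w‖)) ∧
    (∀ v : Vec d, inner ℝ (u (θc t)) v = 0 →
      |inner ℝ v (hess L (θc t) v)| ≤ Cnw * eps L η T θc * (‖hess L (θc t)‖ * ‖v‖ ^ 2)) ∧
    |eig (hess L (θc t)) (d - 1)| ≤ Cnw * eps L η T θc * ‖hess L (θc t)‖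

/-- Non-degeneracy of the noise along the top eigenvector: `E[⟨u_t, ξ_t⟩²] > 0`. -/
def NoiseNondegenerate {Ω : Type*} [MeasurableSpace Ω] (P : Measure Ω) (u : Vec d → Vec d) (T : ℕ)
    (θc : ℕ → Vec d) (ξ : Ω → ℕ → Vec d) : Prop :=
  ∀ t ≤ T, 0 < ∫ ω, (inner ℝ (u (θc t)) (ξ ω t)) ^ 2 ∂P

/-- Scaling conditions: `T ≤ cT / ε`, `E‖ξ_t‖² ≤ Cξ ε δ² / η²` and `ρ₄ ≤ Cρ η ρ₃²`. -/
def Scaling {Ω : Type*} [MeasurableSpace Ω] (cT Cξ Cρ ρ₃ ρ₄ : ℝ) (P : Measure Ω) (L : Vec d → ℝ)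
    (u : Vec d → Vec d) (η : ℝ) (T : ℕ) (θc : ℕ → Vec d) (ξ : Ω → ℕ → Vec d) : Prop :=
  (T : ℝ) ≤ cT / eps L η T θc ∧
  (∀ t ≤ T, ∫ ω, ‖ξ ω t‖ ^ 2 ∂P ≤
    Cξ * (eps L η T θc * delta L u T θc ^ 2 / η ^ 2)) ∧
  ρ₄ ≤ Cρ * (η * ρ₃ ^ 2)

/-! ### Conclusion -/

/-- The four estimates at time `t`, with implied constant `C`: `θ` is the SGD iterate, `p` the
constrained iterate and `w` the predicted displacement. -/
def CoupledAt (C ε δ : ℝ) (L : Vec d → ℝ) (u : Vec d → Vec d) (η : ℝ) (θ p w : Vec d) : Prop :=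
  max ‖θ - p‖ ‖w‖ ≤ C * δ ∧
  ‖(θ - p) - w‖ ≤ C * (ε * δ) ∧
  |L θ - (L p + 1 / η * (inner ℝ (u p) w) ^ 2)| ≤ C * (ε * δ ^ 2 / η) ∧
  |sharpness L θ -
      (2 / η + inner ℝ (gradSperp L u p) w + kappa L u p * inner ℝ (u p) w)| ≤ C * (ε ^ 2 / η)

end SGDCoupling

end

/-! The natural scale is `σ = η ρ₃`. Since `‖∇S^⊥‖` lies between a multiple of `ρ₃` and `ρ₃` itself,
`ε ≤ σδ ≤ 2Cε`: a displacement of size `δ` changes `ηH` by `O(ε)`. The horizon is `T ≤ 1/ε`, so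
relative growth `O(ε)` per step costs only a constant factor, and errors `O(ε²δ)` per step add up to
`O(εδ)`.

Constrained trajectory. With a simple, well separated top eigenvalue, second-order perturbation
theory gives `∇S = ∇³L(u,u)` and a quadratic Taylor remainder for `S`. Comparing the projection with
an explicit nearby point of the stable set (`EdgePoint.exists_candidate`) shows in
`EdgePoint.pgd_step` that one step raises the defect `2 - ηS` by at most `O(ε⁴)`. The defect is
therefore `O(ε³)` up to the horizon, and the correction made by the projection is `η(α/β)∇S^⊥` up to
`O(ε²δ)` (`EdgeTrajectory.step_bounds`).

Coupling. Expanding `∇L` to third order, with this correction inserted, gives the predicted step up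
to `O(ε²δ)` as long as `‖v‖ ≤ Kδ`. The predicted step is Lipschitz there with constant `1 + O(ε)`.
Both processes are driven by the same noise, which cancels in the difference, so Gronwall yields
`O(εδ)` on every path where the predicted dynamics stay in the ball of radius `Kδ`. The loss and
sharpness estimates follow by Taylor expansion.

Confinement. With `x = ⟨u,v⟩` and `p` the part of `v` orthogonal to `u`, the energy `x² + (ηκ/2)x³ +
2‖p‖²` is almost conserved. The gain `2ηyx²` of the first part is exactly what the second part
loses, and the cubic term absorbs `ηκx³` because `x` changes sign at each step. What remains is
growth `O(ε)(energy + δ²)`, a noise term of mean zero, and a quadratic noise term of mean `O(εδ²)`.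
The stopped energy thus has expectation `O(δ²)`, with a constant independent of `K`, and the
probability of exit is `O(K⁻²)` (`exit_probability_le`). First `K` is chosen from the allowed
failure probability, then `ε₀` from `K`. -/

noncomputable section

namespace SGDCoupling

/-! ### Perturbation of a simple top eigenvalue -/

section Spectral

variable {E : Type*} [NormedAddCommGroup E] [InnerProductSpace ℝ E]

theorem abs_inner_apply_le (A : E →L[ℝ] E) (x y : E) : |inner ℝ x (A y)| ≤ ‖A‖ * ‖x‖ * ‖y‖ := by
  calc |inner ℝ x (A y)| ≤ ‖x‖ * ‖A y‖ := abs_real_inner_le_norm _ _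
    _ ≤ ‖x‖ * (‖A‖ * ‖y‖) := by gcongr; exact A.le_opNorm y
    _ = _ := by ring

theorem norm_sq_decomp {u : E} (hu : ‖u‖ = 1) (v : E) :
    ‖v‖ ^ 2 = inner ℝ u v ^ 2 + ‖v - inner ℝ u v • u‖ ^ 2 := by
  have h := norm_sub_sq_real v (inner ℝ u v • u)
  rw [inner_smul_right, norm_smul, hu, real_inner_comm u v, mul_one, Real.norm_eq_abs, sq_abs] at h
  linarith

theorem inner_perp_eq_zero {u : E} (hu : ‖u‖ = 1) (v : E) :
    inner ℝ u (v - inner ℝ u v • u) = 0 := by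
  rw [inner_sub_right, inner_smul_right, real_inner_self_eq_norm_sq, hu]
  ring

/-- Data of a simple top eigenpair `(l, u)` of `A`, the form being at most `m` on `u^⊥`. -/
structure GapAt (A : E →L[ℝ] E) (u : E) (l m : ℝ) : Prop where
  norm_u : ‖u‖ = 1
  symm : ∀ x y, inner ℝ (A x) y = inner ℝ x (A y)
  apply_u : A u = l • u
  le_perp : ∀ v, inner ℝ u v = 0 → inner ℝ v (A v) ≤ m * ‖v‖ ^ 2
  lt : m < l

/-- `w` is a unit eigenvector of `A` whose eigenvalue dominates the Rayleigh quotients. -/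
structure TopPair (A : E →L[ℝ] E) (w : E) (l : ℝ) : Prop where
  norm_w : ‖w‖ = 1
  apply_w : A w = l • w
  le : ∀ v, inner ℝ v (A v) ≤ l * ‖v‖ ^ 2

theorem TopPair.neg {A : E →L[ℝ] E} {w : E} {l : ℝ} (h : TopPair A w l) : TopPair A (-w) l :=
  ⟨by rw [norm_neg, h.norm_w], by rw [map_neg, h.apply_w, smul_neg], h.le⟩

section Perturb

variable {A₀ A : E →L[ℝ] E} {u w : E} {l m l' : ℝ}

theorem TopPair.ge (hw : TopPair A w l') (h : GapAt A₀ u l m) : l - ‖A - A₀‖ ≤ l' := by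
  have h1 := hw.le u
  have h2 := (abs_le.1 (abs_inner_apply_le (A - A₀) u u)).1
  rw [_root_.sub_apply, inner_sub_right, h.apply_u, inner_smul_right,
    real_inner_self_eq_norm_sq, h.norm_u] at h2
  rw [h.norm_u] at h1
  linarith

theorem GapAt.inner_apply_decomp (h : GapAt A₀ u l m) (v : E) :
    inner ℝ v (A₀ v) = l * inner ℝ u v ^ 2 +
      inner ℝ (v - inner ℝ u v • u) (A₀ (v - inner ℝ u v • u)) := by
  have h1 : inner ℝ v (A₀ u) = l * inner ℝ u v := by
    rw [h.apply_u, inner_smul_right, real_inner_comm]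
  have h2 : inner ℝ u (A₀ v) = l * inner ℝ u v := by
    rw [← h.symm, h.apply_u, real_inner_smul_left]
  have h3 : inner ℝ u (A₀ u) = l := by
    rw [h.apply_u, inner_smul_right, real_inner_self_eq_norm_sq, h.norm_u]; ring
  simp only [map_sub, map_smul, inner_sub_left, inner_sub_right, inner_smul_right,
    real_inner_smul_left, h1, h2, h3]
  ring

theorem GapAt.inner_apply_le (h : GapAt A₀ u l m) (v : E) :
    inner ℝ v (A₀ v) ≤ m * ‖v‖ ^ 2 + (l - m) * inner ℝ u v ^ 2 := by
  have h1 := h.le_perp _ (inner_perp_eq_zero h.norm_u v)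
  have h2 := norm_sq_decomp h.norm_u v
  rw [h.inner_apply_decomp v, h2]
  linarith

/-- A Davis–Kahan argument: pairing `A w = l' w` with the component `p` of `w` orthogonal to `u`
gives `(l' - m)‖p‖² ≤ ⟨p, (A - A₀)w⟩`, and `l' - m` is at least three quarters of the gap. -/
theorem GapAt.norm_perp_le (h : GapAt A₀ u l m) (hw : TopPair A w l')
    (hD : ‖A - A₀‖ ≤ (l - m) / 4) :
    3 / 4 * (l - m) * ‖w - inner ℝ u w • u‖ ≤ ‖A - A₀‖ := by
  have hl := hw.ge h
  have hlt := h.lt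
  set a := inner ℝ u w with ha
  set p := w - a • u with hp
  have hup : inner ℝ u p = 0 := inner_perp_eq_zero h.norm_u w
  have hwd : w = a • u + p := by rw [hp]; abel
  have h1 : inner ℝ p (A w) = l' * ‖p‖ ^ 2 := by
    rw [hw.apply_w, inner_smul_right]
    congr 1
    calc inner ℝ p w = inner ℝ p (a • u + p) := by rw [← hwd]
      _ = _ := by
        rw [inner_add_right, inner_smul_right, real_inner_comm, hup, real_inner_self_eq_norm_sq]
        ring
  have h2 : inner ℝ p (A₀ w) = inner ℝ p (A₀ p) := by
    calc inner ℝ p (A₀ w) = inner ℝ p (A₀ (a • u + p)) := by rw [← hwd]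
      _ = _ := by
        rw [map_add, map_smul, inner_add_right, inner_smul_right, h.apply_u, inner_smul_right,
          real_inner_comm, hup]
        ring
  have h3 := h.le_perp p hup
  have h4 := (abs_le.1 (abs_inner_apply_le (A - A₀) p w)).2
  rw [_root_.sub_apply, inner_sub_right, h1, h2, hw.norm_w] at h4
  rcases (norm_nonneg p).eq_or_lt with h0 | h0
  · rw [← h0]; simp
  · have : (l' - m) * ‖p‖ ≤ ‖A - A₀‖ := by
      refine le_of_mul_le_mul_right ?_ h0
      nlinarith
    nlinarith

/-- First-order perturbation theory with an explicit remainder. The Rayleigh quotient of `A` at the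
old eigenvector is a lower bound for `l'`; the error is quadratic because `w` leaves the line of `u`
only by `O(‖A - A₀‖ / (l - m))`, and this deviation is multiplied by `A - A₀` again. -/
theorem GapAt.eigenvalue_sub_le (h : GapAt A₀ u l m) (hw : TopPair A w l')
    (hD : ‖A - A₀‖ ≤ (l - m) / 4) :
    |l' - inner ℝ u (A u)| ≤ 8 * ‖A - A₀‖ ^ 2 / (l - m) := by
  have hlt := h.lt
  have hp0 := h.norm_perp_le hw hD
  have hn := norm_sq_decomp h.norm_u w
  have hlow := hw.le u
  rw [h.norm_u] at hlow
  have hl1 : l' = inner ℝ w (A w) := by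
    rw [hw.apply_w, inner_smul_right, real_inner_self_eq_norm_sq, hw.norm_w]; ring
  have hd := h.inner_apply_decomp w
  have hle := h.le_perp _ (inner_perp_eq_zero h.norm_u w)
  rw [hw.norm_w] at hn
  obtain ⟨a, ha⟩ : ∃ a, a = inner ℝ u w := ⟨_, rfl⟩
  rw [← ha] at hp0 hn hd hle
  obtain ⟨p, hp⟩ : ∃ p, p = w - a • u := ⟨_, rfl⟩
  rw [← hp] at hp0 hn hd hle
  have hD0 : 0 ≤ ‖A - A₀‖ := norm_nonneg _
  have hwd : w = a • u + p := by rw [hp]; abel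
  have e1 : inner ℝ w (A w) = inner ℝ w (A₀ w) + inner ℝ w ((A - A₀) w) := by
    rw [_root_.sub_apply, inner_sub_right]; ring
  have e2 : inner ℝ u (A u) = l + inner ℝ u ((A - A₀) u) := by
    rw [_root_.sub_apply, inner_sub_right, h.apply_u, inner_smul_right,
      real_inner_self_eq_norm_sq, h.norm_u]; ring
  have e3 : inner ℝ w ((A - A₀) w) = a ^ 2 * inner ℝ u ((A - A₀) u) +
      a * (inner ℝ u ((A - A₀) p) + inner ℝ p ((A - A₀) u)) + inner ℝ p ((A - A₀) p) := by
    rw [hwd]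
    generalize A - A₀ = Δ
    simp only [map_add, map_smul, inner_add_left, inner_add_right, inner_smul_right,
      real_inner_smul_left]
    ring
  have b1 := abs_le.1 (abs_inner_apply_le (A - A₀) u u)
  have b2 := abs_inner_apply_le (A - A₀) u p
  have b3 := abs_inner_apply_le (A - A₀) p u
  have b4 := (abs_le.1 (abs_inner_apply_le (A - A₀) p p)).2
  rw [h.norm_u] at b1 b2 b3
  generalize ‖A - A₀‖ = D at *
  have hp1 : ‖p‖ ≤ 1 := by nlinarith [norm_nonneg p, sq_nonneg a]
  have ha1 : |a| ≤ 1 := by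
    rw [← sq_le_one_iff_abs_le_one]; nlinarith [sq_nonneg ‖p‖]
  have b5 : a * (inner ℝ u ((A - A₀) p) + inner ℝ p ((A - A₀) u)) ≤ 2 * (D * ‖p‖) := by
    refine (le_abs_self _).trans ?_
    rw [abs_mul]
    have : |inner ℝ u ((A - A₀) p) + inner ℝ p ((A - A₀) u)| ≤ 2 * (D * ‖p‖) := by
      refine (abs_add_le _ _).trans ?_
      linarith
    calc _ ≤ 1 * (2 * (D * ‖p‖)) := by gcongr
      _ = _ := by ring
  have b6 : D * ‖p‖ * ‖p‖ ≤ D * ‖p‖ := by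
    have := mul_nonneg hD0 (norm_nonneg p)
    nlinarith
  have b7 : a ^ 2 * inner ℝ u ((A - A₀) u) ≤ inner ℝ u ((A - A₀) u) + D * ‖p‖ * ‖p‖ := by
    have : a ^ 2 = 1 - ‖p‖ ^ 2 := by linarith
    rw [this]; nlinarith [sq_nonneg ‖p‖]
  have b8 : inner ℝ w (A₀ w) ≤ l := by
    rw [hd]
    have : l = l * a ^ 2 + l * ‖p‖ ^ 2 := by rw [← mul_add, ← hn]; ring
    nlinarith [sq_nonneg ‖p‖]
  rw [abs_of_nonneg (by linarith), le_div_iff₀ (by linarith)]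
  have b9 : l' - inner ℝ u (A u) ≤ 4 * (D * ‖p‖) := by
    rw [hl1, e1, e2, e3]; nlinarith
  have b10 : D * ((l - m) * ‖p‖) ≤ D * (2 * D) := by
    apply mul_le_mul_of_nonneg_left _ hD0
    nlinarith
  nlinarith

theorem GapAt.norm_sub_le (h : GapAt A₀ u l m) (hw : TopPair A w l')
    (hD : ‖A - A₀‖ ≤ (l - m) / 4) (hs : 0 ≤ inner ℝ u w) :
    ‖w - u‖ ≤ 2 * ‖A - A₀‖ / (l - m) := by
  have hlt := h.lt
  have hp0 := h.norm_perp_le hw hD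
  have hn := norm_sq_decomp h.norm_u w
  have h1 := norm_sub_sq_real w u
  rw [hw.norm_w] at hn
  rw [hw.norm_w, h.norm_u, real_inner_comm] at h1
  rw [le_div_iff₀ (by linarith)]
  set a := inner ℝ u w with ha
  set p := w - a • u with hp
  have ha1 : a ≤ 1 := by nlinarith [sq_nonneg ‖p‖]
  -- As `0 ≤ a ≤ 1`, `‖w - u‖² = 2(1 - a) ≤ 2(1 - a²) = 2‖p‖²`. The factor `3/2` times the `4/3` of
  -- `GapAt.norm_perp_le` gives the `2` in the claim.
  have h2 : ‖w - u‖ ^ 2 ≤ (3 / 2 * ‖p‖) ^ 2 := by nlinarith [sq_nonneg ‖p‖]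
  have h3 : ‖w - u‖ ≤ 3 / 2 * ‖p‖ := by
    apply le_of_sq_le_sq h2 (by positivity)
  nlinarith

/-- Allows the perturbation estimates to be restarted at a nearby operator. On `w^⊥` the form of
`A₀` exceeds `m` by at most a quarter of the gap, since `‖w - u‖ ≤ 1/2`; replacing `A₀` by `A` costs
another quarter, and `l'` is at most a quarter below `l`. -/
theorem GapAt.persist (h : GapAt A₀ u l m) (hw : TopPair A w l')
    (hsymm : ∀ x y, inner ℝ (A x) y = inner ℝ x (A y))
    (hD : ‖A - A₀‖ ≤ (l - m) / 4) (hs : 0 ≤ inner ℝ u w) :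
    GapAt A w l' (l' - (l - m) / 4) := by
  have hlt := h.lt
  refine ⟨hw.norm_w, hsymm, hw.apply_w, fun v hv => ?_, by linarith⟩
  have h1 := h.norm_sub_le hw hD hs
  have h2 := h.inner_apply_le v
  have h3 := (abs_le.1 (abs_inner_apply_le (A - A₀) v v)).2
  have hl := hw.ge h
  rw [_root_.sub_apply, inner_sub_right] at h3
  have h4 : |inner ℝ u v| ≤ ‖w - u‖ * ‖v‖ := by
    have : inner ℝ u v = - inner ℝ (w - u) v := by rw [inner_sub_left, hv]; ring
    rw [this, abs_neg]
    exact abs_real_inner_le_norm _ _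
  have h5 : ‖w - u‖ ≤ 1 / 2 := by
    refine h1.trans ?_
    rw [div_le_iff₀ (by linarith)]; linarith
  have h6 : inner ℝ u v ^ 2 ≤ 1 / 4 * ‖v‖ ^ 2 := by
    rw [← sq_abs]
    calc |inner ℝ u v| ^ 2 ≤ (1 / 2 * ‖v‖) ^ 2 := by
          gcongr
          exact h4.trans (by gcongr)
      _ = _ := by ring
  have h7 : ‖A - A₀‖ * ‖v‖ * ‖v‖ ≤ (l - m) / 4 * ‖v‖ ^ 2 := by
    rw [mul_assoc, ← sq]; gcongr
  have h8 : (l - (l - m) / 4) * ‖v‖ ^ 2 ≤ l' * ‖v‖ ^ 2 := by gcongr; linarith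
  nlinarith

end Perturb

/-- A symmetric operator preserving `u^⊥` is bounded there by the bound of its quadratic form. -/
theorem norm_apply_le_of_form_le {A : E →L[ℝ] E} {u : E} {b : ℝ} (hb : 0 ≤ b)
    (hsymm : ∀ x y, inner ℝ (A x) y = inner ℝ x (A y))
    (hinv : ∀ v, inner ℝ u v = 0 → inner ℝ u (A v) = 0)
    (hform : ∀ v, inner ℝ u v = 0 → |inner ℝ v (A v)| ≤ b * ‖v‖ ^ 2)
    (p : E) (hp : inner ℝ u p = 0) : ‖A p‖ ≤ b * ‖p‖ := by
  rcases (norm_nonneg (A p)).eq_or_lt with h0 | h0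
  · rw [← h0]; positivity
  -- Polarization: `c` makes `c • A p` as long as `p`. The difference of the form at `c • A p ± p`
  -- is `4c‖A p‖²`, and the parallelogram law bounds it by `4b‖p‖²`.
  set c := ‖p‖ / ‖A p‖ with hc
  have hcA : c * ‖A p‖ = ‖p‖ := by rw [hc]; field_simp
  have hx : inner ℝ u (c • A p) = 0 := by rw [inner_smul_right, hinv p hp, mul_zero]
  have h1 := (abs_le.1 (hform (c • A p + p) (by rw [inner_add_right, hx, hp, add_zero]))).2
  have h2 := (abs_le.1 (hform (c • A p - p) (by rw [inner_sub_right, hx, hp, sub_zero]))).1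
  have h3 := parallelogram_law_with_norm ℝ (c • A p) p
  have hcn : ‖c • A p‖ = ‖p‖ := by
    rw [norm_smul, Real.norm_of_nonneg (by positivity), hcA]
  have h4 : inner ℝ p (A (A p)) = ‖A p‖ ^ 2 := by
    rw [← hsymm, real_inner_self_eq_norm_sq]
  have h5 : inner ℝ (A p) (A p) = ‖A p‖ ^ 2 := real_inner_self_eq_norm_sq _
  simp only [map_add, map_sub, map_smul, inner_add_left, inner_add_right, inner_sub_left,
    inner_sub_right, inner_smul_right, real_inner_smul_left, h4, h5] at h1 h2
  rw [hcn] at h3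
  have h6 : 4 * (c * ‖A p‖ ^ 2) ≤ 4 * (b * ‖p‖ ^ 2) := by nlinarith
  have h7 : ‖p‖ * ‖A p‖ ≤ ‖p‖ * (b * ‖p‖) := by
    have : c * ‖A p‖ ^ 2 = ‖p‖ * ‖A p‖ := by rw [sq, ← mul_assoc, hcA]
    nlinarith
  rcases (norm_nonneg p).eq_or_lt with h8 | h8
  · have : p = 0 := norm_eq_zero.1 h8.symm
    simp [this]
  · exact le_of_mul_le_mul_left h7 h8

end Spectral

theorem eig_zero_ge {d : ℕ} (A : Op d) (hA : ∀ x y, inner ℝ (A x) y = inner ℝ x (A y)) (v : Vec d) :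
    inner ℝ v (A v) ≤ eig A 0 * ‖v‖ ^ 2 := by
  have hs : (A : Vec d →ₗ[ℝ] Vec d).IsSymmetric := fun x y => hA x y
  rcases Nat.eq_zero_or_pos d with h0 | h0
  · subst h0
    have : v = 0 := Subsingleton.elim _ _
    simp [this]
  set bs := hs.eigenvectorBasis finrank_euclideanSpace_fin
  have he : eig A 0 = hs.eigenvalues finrank_euclideanSpace_fin ⟨0, h0⟩ := by
    unfold eig; rw [dif_pos ⟨hs, h0⟩]
  rw [he, ← bs.repr.norm_map v, EuclideanSpace.norm_sq_eq, Finset.mul_sum,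
    ← bs.repr.inner_map_map, PiLp.inner_apply]
  apply Finset.sum_le_sum
  intro i _
  have h1 : bs.repr (A v) i = hs.eigenvalues finrank_euclideanSpace_fin i * bs.repr v i := by
    have := hs.eigenvectorBasis_apply_self_apply finrank_euclideanSpace_fin v i
    simpa using this
  rw [h1]
  have h2 : hs.eigenvalues finrank_euclideanSpace_fin i ≤
      hs.eigenvalues finrank_euclideanSpace_fin ⟨0, h0⟩ :=
    hs.eigenvalues_antitone finrank_euclideanSpace_fin (Fin.mk_le_of_le_val (Nat.zero_le _))
  simp only [RCLike.inner_apply, conj_trivial, Real.norm_eq_abs, sq_abs]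
  nlinarith [mul_le_mul_of_nonneg_right h2 (sq_nonneg (bs.repr v i))]

theorem IsTopEigenvector.topPair {d : ℕ} {A : Op d} {w : Vec d} (h : IsTopEigenvector A w)
    (hA : ∀ x y, inner ℝ (A x) y = inner ℝ x (A y)) : TopPair A w (eig A 0) :=
  ⟨h.1, h.2, eig_zero_ge A hA⟩

/-! ### Taylor estimates for the loss and its derivatives -/

section Calculus

variable {d : ℕ}

/-- `L` is `C⁴` on the open set `N`, with `∇³L` bounded by `ρ₃` and `ρ₄`-Lipschitz there. -/
structure RegularOn (L : Vec d → ℝ) (N : Set (Vec d)) (ρ₃ ρ₄ : ℝ) : Prop where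
  isOpen : IsOpen N
  contDiffOn : ContDiffOn ℝ 4 L N
  norm_third_le : ∀ θ ∈ N, ‖third L θ‖ ≤ ρ₃
  lip : ∀ θ ∈ N, ∀ θ' ∈ N, ‖third L θ - third L θ'‖ ≤ ρ₄ * ‖θ - θ'‖

theorem closedBall_norm_subset {N : Set (Vec d)} {θ : Vec d} {R : ℝ} (hball : Metric.ball θ R ⊆ N)
    {v : Vec d} (hv : ‖v‖ < R) : Metric.closedBall θ ‖v‖ ⊆ N :=
  (Metric.closedBall_subset_ball hv).trans hball

namespace RegularOn

variable {L : Vec d → ℝ} {N : Set (Vec d)} {ρ₃ ρ₄ : ℝ} (h : RegularOn L N ρ₃ ρ₄)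
include h

theorem contDiffAt {θ : Vec d} (hθ : θ ∈ N) : ContDiffAt ℝ 4 L θ :=
  h.contDiffOn.contDiffAt (h.isOpen.mem_nhds hθ)

theorem contDiffAt_gradient {θ : Vec d} (hθ : θ ∈ N) : ContDiffAt ℝ 3 (gradient L) θ := by
  have h1 : ContDiffAt ℝ 3 (fderiv ℝ L) θ := (h.contDiffAt hθ).fderiv_right (by norm_num)
  exact (InnerProductSpace.toDual ℝ (Vec d)).symm.contDiff.contDiffAt.comp θ h1

theorem contDiffAt_hess {θ : Vec d} (hθ : θ ∈ N) : ContDiffAt ℝ 2 (hess L) θ :=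
  (h.contDiffAt_gradient hθ).fderiv_right (by norm_num)

theorem hasGradientAt {θ : Vec d} (hθ : θ ∈ N) : HasGradientAt L (gradient L θ) θ :=
  ((h.contDiffAt hθ).differentiableAt (by norm_num)).hasGradientAt

theorem hasFDerivAt_gradient {θ : Vec d} (hθ : θ ∈ N) :
    HasFDerivAt (gradient L) (hess L θ) θ :=
  ((h.contDiffAt_gradient hθ).differentiableAt (by norm_num)).hasFDerivAt

theorem hasFDerivAt_hess {θ : Vec d} (hθ : θ ∈ N) :
    HasFDerivAt (hess L) (third L θ) θ :=
  ((h.contDiffAt_hess hθ).differentiableAt (by norm_num)).hasFDerivAt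

theorem hess_symm {θ : Vec d} (hθ : θ ∈ N) (v w : Vec d) :
    inner ℝ (hess L θ v) w = inner ℝ v (hess L θ w) := by
  have h0 : IsSymmSndFDerivAt ℝ L θ :=
    (h.contDiffAt hθ).isSymmSndFDerivAt (by norm_num [minSmoothness])
  -- Pairing with a fixed vector turns the derivative of the gradient into the second Fréchet
  -- derivative, whose symmetry is known for smooth functions.
  have key : ∀ a b : Vec d, inner ℝ (hess L θ a) b = fderiv ℝ (fderiv ℝ L) θ a b := by
    intro a b
    have h1 := (h.hasFDerivAt_gradient hθ).inner ℝ (hasFDerivAt_const b θ)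
    have h2 : HasFDerivAt (fderiv ℝ L) (fderiv ℝ (fderiv ℝ L) θ) θ :=
      (((h.contDiffAt hθ).fderiv_right (m := 3) (by norm_num)).differentiableAt
        (by norm_num)).hasFDerivAt
    have h3 := h2.clm_apply (hasFDerivAt_const b θ)
    have h4 : (fun x => fderiv ℝ L x b) = fun x => inner ℝ (gradient L x) b := by
      funext x; rw [inner_gradient_left]
    rw [h4] at h3
    have h5 := congrArg (fun f : Vec d →L[ℝ] ℝ => f a) (h1.unique h3)
    simpa [fderivInnerCLM_apply] using h5
  rw [key v w, h0 v w, ← key w v, real_inner_comm]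

theorem third_comm {θ : Vec d} (hθ : θ ∈ N) (v w : Vec d) :
    third L θ v w = third L θ w v :=
  ((h.contDiffAt_gradient hθ).isSymmSndFDerivAt (by norm_num)) v w

/-- Obtained by differentiating in the direction `v` the symmetry of the Hessian, which holds on the
whole open set `N`. -/
theorem third_symm {θ : Vec d} (hθ : θ ∈ N) (v x y : Vec d) :
    inner ℝ (third L θ v x) y = inner ℝ x (third L θ v y) := by
  have h1 := h.hasFDerivAt_hess hθ
  have hx : HasFDerivAt (fun z => hess L z x) ((third L θ).flip x) θ := by
    simpa using h1.clm_apply (hasFDerivAt_const x θ)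
  have hy : HasFDerivAt (fun z => hess L z y) ((third L θ).flip y) θ := by
    simpa using h1.clm_apply (hasFDerivAt_const y θ)
  have e1 := hx.inner ℝ (hasFDerivAt_const y θ)
  have e2 := (hasFDerivAt_const x θ).inner ℝ hy
  have e3 : (fun z => inner ℝ (hess L z x) y) =ᶠ[nhds θ] fun z => inner ℝ x (hess L z y) := by
    filter_upwards [h.isOpen.mem_nhds hθ] with z hz using h.hess_symm hz x y
  have e4 := (e1.congr_of_eventuallyEq e3.symm).unique e2
  have e5 := congrArg (fun f : Vec d →L[ℝ] ℝ => f v) e4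
  simpa [fderivInnerCLM_apply] using e5

variable {θ : Vec d} {R : ℝ} (hball : Metric.ball θ R ⊆ N)
include hball

theorem norm_hess_sub_le {x y : Vec d} (hx : x ∈ Metric.ball θ R) (hy : y ∈ Metric.ball θ R) :
    ‖hess L y - hess L x‖ ≤ ρ₃ * ‖y - x‖ :=
  Convex.norm_image_sub_le_of_norm_hasFDerivWithin_le
    (fun _ hz => (h.hasFDerivAt_hess (hball hz)).hasFDerivWithinAt)
    (fun _ hz => h.norm_third_le _ (hball hz)) (convex_ball θ R) hx hy

/-- As in the next three estimates, the mean value inequality is applied to the function minus its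
Taylor polynomial; the derivative of that difference is a remainder of one order less, already
bounded. No integration takes place, hence no factorials in the constants. -/
theorem norm_hess_taylor_le (hρ₄ : 0 ≤ ρ₄) {v : Vec d} (hv : ‖v‖ < R) :
    ‖hess L (θ + v) - hess L θ - third L θ v‖ ≤ ρ₄ * ‖v‖ ^ 2 := by
  have hN := closedBall_norm_subset hball hv
  have hθ : θ ∈ N := hball (Metric.mem_ball_self ((norm_nonneg v).trans_lt hv))
  have hd : ∀ x ∈ Metric.closedBall θ ‖v‖, HasFDerivWithinAt (fun x => hess L x - third L θ x)
      (third L x - third L θ) (Metric.closedBall θ ‖v‖) x := fun x hx =>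
    ((h.hasFDerivAt_hess (hN hx)).sub (third L θ).hasFDerivAt).hasFDerivWithinAt
  have := Convex.norm_image_sub_le_of_norm_hasFDerivWithin_le hd (C := ρ₄ * ‖v‖)
    (fun x hx => (h.lip x (hN hx) θ hθ).trans
      (mul_le_mul_of_nonneg_left (mem_closedBall_iff_norm.1 hx) hρ₄))
    (convex_closedBall θ ‖v‖) (Metric.mem_closedBall_self (norm_nonneg v))
    (show θ + v ∈ Metric.closedBall θ ‖v‖ by simp)
  calc _ = ‖hess L (θ + v) - third L θ (θ + v) - (hess L θ - third L θ θ)‖ := by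
        rw [map_add]; congr 1; abel
    _ ≤ _ := this
    _ = _ := by rw [add_sub_cancel_left]; ring

theorem norm_gradient_taylor_le {v : Vec d} (hv : ‖v‖ < R) :
    ‖gradient L (θ + v) - gradient L θ - hess L θ v‖ ≤ ρ₃ * ‖v‖ ^ 2 := by
  have hN := closedBall_norm_subset hball hv
  have hb := Metric.closedBall_subset_ball (x := θ) hv
  have hθ : θ ∈ N := hball (Metric.mem_ball_self ((norm_nonneg v).trans_lt hv))
  have hρ : 0 ≤ ρ₃ := (norm_nonneg (third L θ)).trans (h.norm_third_le θ hθ)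
  have hd : ∀ x ∈ Metric.closedBall θ ‖v‖, HasFDerivWithinAt (fun x => gradient L x - hess L θ x)
      (hess L x - hess L θ) (Metric.closedBall θ ‖v‖) x := fun x hx =>
    ((h.hasFDerivAt_gradient (hN hx)).sub (hess L θ).hasFDerivAt).hasFDerivWithinAt
  have := Convex.norm_image_sub_le_of_norm_hasFDerivWithin_le hd (C := ρ₃ * ‖v‖)
    (fun x hx => (h.norm_hess_sub_le hball
        (Metric.mem_ball_self ((norm_nonneg v).trans_lt hv)) (hb hx)).trans
      (mul_le_mul_of_nonneg_left (mem_closedBall_iff_norm.1 hx) hρ))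
    (convex_closedBall θ ‖v‖) (Metric.mem_closedBall_self (norm_nonneg v))
    (show θ + v ∈ Metric.closedBall θ ‖v‖ by simp)
  calc _ = ‖gradient L (θ + v) - hess L θ (θ + v) - (gradient L θ - hess L θ θ)‖ := by
        rw [map_add]; congr 1; abel
    _ ≤ _ := this
    _ = _ := by rw [add_sub_cancel_left]; ring

theorem norm_gradient_taylor_two_le (hρ₄ : 0 ≤ ρ₄) {v : Vec d} (hv : ‖v‖ < R) :
    ‖gradient L (θ + v) - gradient L θ - hess L θ v - (1 / 2 : ℝ) • third L θ v v‖ ≤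
      ρ₄ * ‖v‖ ^ 3 := by
  have hN := closedBall_norm_subset hball hv
  have hθ : θ ∈ N := hball (Metric.mem_ball_self ((norm_nonneg v).trans_lt hv))
  have hd : ∀ x ∈ Metric.closedBall θ ‖v‖, HasFDerivWithinAt
      (fun x => gradient L x - hess L θ (x - θ) - (1 / 2 : ℝ) • third L θ (x - θ) (x - θ))
      (hess L x - hess L θ - third L θ (x - θ)) (Metric.closedBall θ ‖v‖) x := by
    intro x hx
    have e0 : HasFDerivAt (fun x : Vec d => x - θ) (ContinuousLinearMap.id ℝ (Vec d)) x :=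
      (hasFDerivAt_id x).sub_const θ
    have e1 := (hess L θ).hasFDerivAt.comp x e0
    have e2 := ((third L θ).hasFDerivAt.comp x e0).clm_apply e0
    have e3 := (((h.hasFDerivAt_gradient (hN hx)).sub e1).sub
      (e2.const_smul (1 / 2 : ℝ))).hasFDerivWithinAt (s := Metric.closedBall θ ‖v‖)
    refine HasFDerivWithinAt.congr_fderiv e3 ?_
    ext1 z
    simp only [Function.comp, _root_.sub_apply, ContinuousLinearMap.comp_apply,
      _root_.smul_apply, _root_.add_apply, ContinuousLinearMap.flip_apply,
      ContinuousLinearMap.id_apply]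
    -- The derivative of the quadratic term consists of two pieces; symmetry of `∇³L` makes them
    -- equal, which uses up the factor `1 / 2`.
    rw [h.third_comm hθ z (x - θ), ← two_smul ℝ (third L θ (x - θ) z), smul_smul]
    norm_num
  have := Convex.norm_image_sub_le_of_norm_hasFDerivWithin_le hd (C := ρ₄ * ‖v‖ ^ 2)
    (fun x hx => by
      have hx' : ‖x - θ‖ ≤ ‖v‖ := mem_closedBall_iff_norm.1 hx
      have := h.norm_hess_taylor_le hball hρ₄ (hx'.trans_lt hv)
      rw [add_sub_cancel] at this
      exact this.trans (by gcongr))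
    (convex_closedBall θ ‖v‖) (Metric.mem_closedBall_self (norm_nonneg v))
    (show θ + v ∈ Metric.closedBall θ ‖v‖ by simp)
  simp only [add_sub_cancel_left, sub_self, map_zero, smul_zero, sub_zero] at this
  calc _ = ‖gradient L (θ + v) - hess L θ v - (1 / 2 : ℝ) • third L θ v v - gradient L θ‖ := by
        congr 1; abel
    _ ≤ _ := this
    _ = _ := by ring

theorem abs_taylor_le {v : Vec d} (hv : ‖v‖ < R) :
    |L (θ + v) - L θ - inner ℝ (gradient L θ) v - 1 / 2 * inner ℝ v (hess L θ v)| ≤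
      ρ₃ * ‖v‖ ^ 3 := by
  have hN := closedBall_norm_subset hball hv
  have hθ : θ ∈ N := hball (Metric.mem_ball_self ((norm_nonneg v).trans_lt hv))
  have hρ : 0 ≤ ρ₃ := (norm_nonneg (third L θ)).trans (h.norm_third_le θ hθ)
  have hd : ∀ x ∈ Metric.closedBall θ ‖v‖, HasFDerivWithinAt
      (fun x => L x - inner ℝ (gradient L θ) (x - θ) -
        (1 / 2 : ℝ) * inner ℝ (x - θ) (hess L θ (x - θ)))
      (InnerProductSpace.toDual ℝ (Vec d)
        (gradient L x - gradient L θ - hess L θ (x - θ))) (Metric.closedBall θ ‖v‖) x := by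
    intro x hx
    have e0 : HasFDerivAt (fun x : Vec d => x - θ) (ContinuousLinearMap.id ℝ (Vec d)) x :=
      (hasFDerivAt_id x).sub_const θ
    have e1 := (hess L θ).hasFDerivAt.comp x e0
    have e2 := (hasFDerivAt_const (gradient L θ) x).inner ℝ e0
    have e3 := (e0.inner ℝ e1).const_mul (1 / 2 : ℝ)
    have e4 := (((h.hasGradientAt (hN hx)).hasFDerivAt.sub e2).sub e3).hasFDerivWithinAt
      (s := Metric.closedBall θ ‖v‖)
    refine HasFDerivWithinAt.congr_fderiv e4 ?_
    ext1 z
    simp only [Function.comp, _root_.sub_apply, ContinuousLinearMap.comp_apply,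
      _root_.smul_apply, ContinuousLinearMap.prod_apply, fderivInnerCLM_apply,
      ContinuousLinearMap.id_apply, _root_.zero_apply, inner_zero_left,
      InnerProductSpace.toDual_apply_apply, inner_sub_left, smul_eq_mul, map_sub]
    have := h.hess_symm hθ x z
    have h2 := h.hess_symm hθ θ z
    simp only [inner_sub_right]
    rw [real_inner_comm (hess L θ x) z, real_inner_comm (hess L θ θ) z]
    linarith
  have := Convex.norm_image_sub_le_of_norm_hasFDerivWithin_le hd (C := ρ₃ * ‖v‖ ^ 2)
    (fun x hx => by
      have hx' : ‖x - θ‖ ≤ ‖v‖ := mem_closedBall_iff_norm.1 hx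
      have := h.norm_gradient_taylor_le hball (hx'.trans_lt hv)
      rw [add_sub_cancel] at this
      rw [LinearIsometryEquiv.norm_map]
      exact this.trans (by gcongr))
    (convex_closedBall θ ‖v‖) (Metric.mem_closedBall_self (norm_nonneg v))
    (show θ + v ∈ Metric.closedBall θ ‖v‖ by simp)
  simp only [add_sub_cancel_left, sub_self, map_zero, inner_zero_right, mul_zero, sub_zero] at this
  calc _ = ‖L (θ + v) - inner ℝ (gradient L θ) v - 1 / 2 * inner ℝ v (hess L θ v) - L θ‖ := by
        rw [Real.norm_eq_abs]; congr 1; ring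
    _ ≤ _ := this
    _ = _ := by ring

end RegularOn

theorem IsTopEigenvectorField.topPair {L : Vec d → ℝ} {u : Vec d → Vec d} {N : Set (Vec d)}
    {ρ₃ ρ₄ : ℝ} (hu : IsTopEigenvectorField L u) (h : RegularOn L N ρ₃ ρ₄) {θ : Vec d}
    (hθ : θ ∈ N) : TopPair (hess L θ) (u θ) (sharpness L θ) :=
  (hu θ ((h.contDiffAt hθ).of_le (by norm_num))).topPair (h.hess_symm hθ)

/-! ### Differentiability of the sharpness -/

section Sharpness

variable {L : Vec d → ℝ} {u : Vec d → Vec d} {N : Set (Vec d)} {ρ₃ ρ₄ R m : ℝ} {θ : Vec d}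

/-- The eigenvector field `u` is an arbitrary selection, so it is not differentiated. The sharpness
at `θ + v` is compared with the Rayleigh quotient of its Hessian at the fixed vector `u θ`, at a
quadratic cost, and that quotient is expanded in `v`. -/
theorem sharpness_taylor (h : RegularOn L N ρ₃ ρ₄) (hu : IsTopEigenvectorField L u)
    (hball : Metric.ball θ R ⊆ N) (hρ₄ : 0 ≤ ρ₄)
    (hg : GapAt (hess L θ) (u θ) (sharpness L θ) m) {v : Vec d} (hv : ‖v‖ < R)
    (hvg : ρ₃ * ‖v‖ ≤ (sharpness L θ - m) / 4) :
    |sharpness L (θ + v) - sharpness L θ - inner ℝ (third L θ (u θ) (u θ)) v| ≤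
      (8 * ρ₃ ^ 2 / (sharpness L θ - m) + ρ₄) * ‖v‖ ^ 2 := by
  have hR : 0 < R := (norm_nonneg v).trans_lt hv
  have hθ : θ ∈ N := hball (Metric.mem_ball_self hR)
  have hρ : 0 ≤ ρ₃ := (norm_nonneg (third L θ)).trans (h.norm_third_le θ hθ)
  have hmem : θ + v ∈ Metric.ball θ R := by simpa using hv
  have hD := h.norm_hess_sub_le hball (Metric.mem_ball_self hR) hmem
  rw [add_sub_cancel_left] at hD
  have h1 := hg.eigenvalue_sub_le (hu.topPair h (hball hmem)) (hD.trans hvg)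
  have h2 := h.norm_hess_taylor_le hball hρ₄ hv
  have h3 := abs_inner_apply_le (hess L (θ + v) - hess L θ - third L θ v) (u θ) (u θ)
  have hgap : 0 < sharpness L θ - m := by linarith [hg.lt]
  have h4 : inner ℝ (u θ) ((hess L (θ + v) - hess L θ - third L θ v) (u θ)) =
      inner ℝ (u θ) (hess L (θ + v) (u θ)) - sharpness L θ -
        inner ℝ (third L θ (u θ) (u θ)) v := by
    simp only [_root_.sub_apply, inner_sub_right, hg.apply_u, inner_smul_right,
      real_inner_self_eq_norm_sq, hg.norm_u]
    rw [h.third_comm hθ v (u θ), h.third_symm hθ (u θ) (u θ) v]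
    ring
  rw [h4, hg.norm_u] at h3
  have h5 : 8 * ‖hess L (θ + v) - hess L θ‖ ^ 2 / (sharpness L θ - m) ≤
      8 * ρ₃ ^ 2 / (sharpness L θ - m) * ‖v‖ ^ 2 := by
    rw [div_mul_eq_mul_div, mul_assoc, ← mul_pow]
    gcongr
  have h6 := abs_add_le (sharpness L (θ + v) - inner ℝ (u θ) (hess L (θ + v) (u θ)))
    (inner ℝ (u θ) (hess L (θ + v) (u θ)) - sharpness L θ - inner ℝ (third L θ (u θ) (u θ)) v)
  calc _ = |(sharpness L (θ + v) - inner ℝ (u θ) (hess L (θ + v) (u θ))) +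
        (inner ℝ (u θ) (hess L (θ + v) (u θ)) - sharpness L θ -
          inner ℝ (third L θ (u θ) (u θ)) v)| := by congr 1; ring
    _ ≤ _ := h6.trans (by linarith)

/-- The quadratic remainder of `sharpness_taylor` proves differentiability and identifies the
gradient at once. -/
theorem gradS_eq (h : RegularOn L N ρ₃ ρ₄) (hu : IsTopEigenvectorField L u)
    (hball : Metric.ball θ R ⊆ N) (hR : 0 < R) (hρ₄ : 0 ≤ ρ₄)
    (hg : GapAt (hess L θ) (u θ) (sharpness L θ) m) :
    gradS L θ = third L θ (u θ) (u θ) := by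
  have hθ : θ ∈ N := hball (Metric.mem_ball_self hR)
  have hρ : 0 ≤ ρ₃ := (norm_nonneg (third L θ)).trans (h.norm_third_le θ hθ)
  have hgap : 0 < sharpness L θ - m := by linarith [hg.lt]
  apply HasGradientAt.gradient
  rw [hasGradientAt_iff_isLittleO_nhds_zero]
  refine Asymptotics.IsBigO.trans_isLittleO (g := fun v : Vec d => ‖v‖ ^ 2) ?_ ?_
  · refine Asymptotics.IsBigO.of_bound (8 * ρ₃ ^ 2 / (sharpness L θ - m) + ρ₄) ?_
    have e1 : ∀ᶠ v : Vec d in nhds 0, ‖v‖ < R := by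
      have := Metric.ball_mem_nhds (0 : Vec d) hR
      filter_upwards [this] with v hv
      simpa using hv
    have e2 : ∀ᶠ v : Vec d in nhds 0, ρ₃ * ‖v‖ < (sharpness L θ - m) / 4 := by
      have : Filter.Tendsto (fun v : Vec d => ρ₃ * ‖v‖) (nhds 0) (nhds (ρ₃ * ‖(0 : Vec d)‖)) :=
        (continuous_const.mul continuous_norm).tendsto 0
      apply this.eventually_lt_const
      simpa using hgap
    filter_upwards [e1, e2] with v h1 h2
    rw [Real.norm_eq_abs, Real.norm_of_nonneg (by positivity)]
    exact sharpness_taylor h hu hball hρ₄ hg h1 h2.le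
  · exact Asymptotics.isLittleO_norm_pow_id one_lt_two

end Sharpness

end Calculus

/-! ### Geometry near a point at the edge of stability -/

section Local

variable {d : ℕ}

/-- Local information at a point `θ` of the stable set whose sharpness `(2 - s) / η` is close to
`2 / η` and whose Hessian has a form bounded by `b ‖∇²L‖` on `u(θ)^⊥`. -/
structure EdgePoint (L : Vec d → ℝ) (u : Vec d → Vec d) (N : Set (Vec d)) (η ρ C b s : ℝ)
    (θ : Vec d) : Prop where
  reg : RegularOn L N ρ (C * (η * ρ ^ 2))
  top : IsTopEigenvectorField L u
  η_pos : 0 < η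
  ρ_pos : 0 < ρ
  C_ge : 8 ≤ C
  ball : ∀ v, C * (η * ρ * ‖v‖) < 1 → θ + v ∈ N
  stat : inner ℝ (gradient L θ) (u θ) = 0
  sharp : η * sharpness L θ = 2 - s
  s_nonneg : 0 ≤ s
  s_le : s ≤ 1 / 4
  b_nonneg : 0 ≤ b
  b_le : b ≤ 1 / 8
  form : ∀ v, inner ℝ (u θ) v = 0 → |inner ℝ v (hess L θ v)| ≤ b * (‖hess L θ‖ * ‖v‖ ^ 2)

/-- The top eigenvector at `q`, with the sign that makes it point along `u₀`. -/
def signedTop (u : Vec d → Vec d) (u₀ q : Vec d) : Vec d :=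
  open Classical in if 0 ≤ inner ℝ u₀ (u q) then u q else -u q

theorem signedTop_eq_or (u : Vec d → Vec d) (u₀ q : Vec d) :
    signedTop u u₀ q = u q ∨ signedTop u u₀ q = -u q := by
  unfold signedTop; split_ifs <;> simp

theorem inner_signedTop_nonneg (u : Vec d → Vec d) (u₀ q : Vec d) :
    0 ≤ inner ℝ u₀ (signedTop u u₀ q) := by
  unfold signedTop
  split_ifs with h
  · exact h
  · rw [inner_neg_right]; linarith

theorem inner_signedTop_eq_zero_iff (u : Vec d → Vec d) (u₀ q z : Vec d) :
    inner ℝ z (signedTop u u₀ q) = 0 ↔ inner ℝ z (u q) = 0 := by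
  rcases signedTop_eq_or u u₀ q with h | h <;> rw [h]
  rw [inner_neg_right, neg_eq_zero]

namespace EdgePoint

variable {L : Vec d → ℝ} {u : Vec d → Vec d} {N : Set (Vec d)} {η ρ C b s : ℝ} {θ : Vec d}
  (h : EdgePoint L u N η ρ C b s θ)
include h

theorem σ_pos : 0 < η * ρ := mul_pos h.η_pos h.ρ_pos

theorem C_pos : 0 < C := by linarith [h.C_ge]

theorem mem_ball_iff {v : Vec d} : ‖v‖ < 1 / (C * (η * ρ)) ↔ C * (η * ρ * ‖v‖) < 1 := by
  rw [lt_div_iff₀ (mul_pos h.C_pos h.σ_pos)]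
  constructor <;> intro h1 <;> linarith

theorem ball_subset : Metric.ball θ (1 / (C * (η * ρ))) ⊆ N := by
  intro q hq
  have := h.ball (q - θ) (h.mem_ball_iff.1 (mem_ball_iff_norm.1 hq))
  rwa [add_sub_cancel] at this

theorem radius_pos : 0 < 1 / (C * (η * ρ)) := by have := h.C_pos; have := h.σ_pos; positivity

theorem mem : θ ∈ N := h.ball_subset (Metric.mem_ball_self h.radius_pos)

theorem topPair : TopPair (hess L θ) (u θ) (sharpness L θ) := h.top.topPair h.reg h.mem

theorem norm_u : ‖u θ‖ = 1 := h.topPair.norm_w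

theorem ρ₄_nonneg : 0 ≤ C * (η * ρ ^ 2) := by
  have := h.C_pos; have := h.η_pos; have := h.ρ_pos; positivity

theorem inner_u_hess (v : Vec d) :
    inner ℝ (u θ) (hess L θ v) = sharpness L θ * inner ℝ (u θ) v := by
  rw [← h.reg.hess_symm h.mem, h.topPair.apply_w, real_inner_smul_left]

theorem norm_hess_apply_le' {p : Vec d} (hp : inner ℝ (u θ) p = 0) :
    ‖hess L θ p‖ ≤ b * ‖hess L θ‖ * ‖p‖ := by
  refine norm_apply_le_of_form_le (u := u θ) (mul_nonneg h.b_nonneg (norm_nonneg (hess L θ)))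
    (h.reg.hess_symm h.mem) (fun v hv => ?_) (fun v hv => ?_) p hp
  · rw [h.inner_u_hess, hv, mul_zero]
  · exact (h.form v hv).trans (by rw [mul_assoc])

/-- The bound on `u^⊥` is relative to `‖H‖` itself, so the splitting along `u` only gives `‖H‖ ≤ max
S (b‖H‖)`. Since `b < 1`, the second alternative forces `H = 0`. -/
theorem norm_hess_le : η * ‖hess L θ‖ ≤ 2 := by
  have hη := h.η_pos
  have hS : 0 < sharpness L θ := by
    have := h.sharp; have := h.s_le
    by_contra hc
    nlinarith
  set D := ‖hess L θ‖ with hD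
  have hb := h.b_le
  have hb0 := h.b_nonneg
  have hD0 : 0 ≤ D := norm_nonneg (hess L θ)
  have key : D ≤ max (sharpness L θ) (b * D) := by
    refine ContinuousLinearMap.opNorm_le_bound _ (le_max_of_le_left hS.le) fun v => ?_
    set M := max (sharpness L θ) (b * D) with hM
    have hM0 : 0 ≤ M := le_max_of_le_left hS.le
    have hx := inner_perp_eq_zero h.norm_u v
    have h1 := norm_sq_decomp h.norm_u v
    have h2 := norm_sq_decomp h.norm_u (hess L θ v)
    have h3 : hess L θ v - inner ℝ (u θ) (hess L θ v) • u θ =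
        hess L θ (v - inner ℝ (u θ) v • u θ) := by
      rw [h.inner_u_hess, map_sub, map_smul, h.topPair.apply_w, smul_smul, mul_comm]
    have h4 := h.norm_hess_apply_le' hx
    rw [h3, h.inner_u_hess] at h2
    have h5 : ‖hess L θ (v - inner ℝ (u θ) v • u θ)‖ ≤ M * ‖v - inner ℝ (u θ) v • u θ‖ :=
      h4.trans (mul_le_mul_of_nonneg_right (le_max_right _ _) (norm_nonneg _))
    apply le_of_sq_le_sq _ (by positivity)
    rw [h2, mul_pow, mul_pow, h1, mul_add, ← mul_pow M ‖_‖]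
    gcongr
    exact le_max_left _ _
  rcases le_max_iff.1 key with h1 | h1
  · calc η * D ≤ η * sharpness L θ := by gcongr
      _ ≤ 2 := by rw [h.sharp]; linarith [h.s_nonneg]
  · have : D = 0 := by nlinarith
    rw [this]; norm_num

theorem norm_hess_perp_le {p : Vec d} (hp : inner ℝ (u θ) p = 0) :
    η * ‖hess L θ p‖ ≤ 2 * b * ‖p‖ := by
  have h1 := h.norm_hess_apply_le' hp
  have h2 := h.norm_hess_le
  calc η * ‖hess L θ p‖ ≤ η * (b * ‖hess L θ‖ * ‖p‖) :=
        mul_le_mul_of_nonneg_left h1 h.η_pos.le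
    _ = (η * ‖hess L θ‖) * (b * ‖p‖) := by ring
    _ ≤ 2 * (b * ‖p‖) := by gcongr; exact mul_nonneg h.b_nonneg (norm_nonneg _)
    _ = _ := by ring

theorem gap_ge : 1 ≤ η * (sharpness L θ - 1 / (2 * η)) := by
  have hη := h.η_pos
  rw [mul_sub, h.sharp]
  have : η * (1 / (2 * η)) = 1 / 2 := by field_simp
  linarith [h.s_le]

/-- On `u^⊥` the form is at most `b‖H‖ ≤ 1/(4η)`, while `S ≥ 7/(4η)`; the threshold `1/(2η)` lies
between them and leaves a gap of at least `1/η`. -/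
theorem gapAt : GapAt (hess L θ) (u θ) (sharpness L θ) (1 / (2 * η)) := by
  have hη := h.η_pos
  refine ⟨h.norm_u, h.reg.hess_symm h.mem, h.topPair.apply_w, fun v hv => ?_, ?_⟩
  · have h1 := (le_abs_self _).trans (h.form v hv)
    refine h1.trans ?_
    rw [← mul_assoc]
    gcongr
    rw [le_div_iff₀ (by positivity)]
    have h2 := h.norm_hess_le
    have h3 := h.b_le
    have h4 := h.b_nonneg
    have h5 : 0 ≤ η * ‖hess L θ‖ := by positivity
    nlinarith
  · have := h.gap_ge
    by_contra hc
    push Not at hc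
    nlinarith

theorem gradS_eq : gradS L θ = third L θ (u θ) (u θ) :=
  SGDCoupling.gradS_eq h.reg h.top h.ball_subset h.radius_pos h.ρ₄_nonneg h.gapAt

theorem norm_third_apply_le (v w : Vec d) : η * ‖third L θ v w‖ ≤ η * ρ * ‖v‖ * ‖w‖ := by
  have h1 := ((third L θ v).le_opNorm w).trans
    (mul_le_mul_of_nonneg_right ((third L θ).le_opNorm v) (norm_nonneg w))
  have h2 := h.reg.norm_third_le θ h.mem
  have hη := h.η_pos
  calc η * ‖third L θ v w‖ ≤ η * (‖third L θ‖ * ‖v‖ * ‖w‖) := by gcongr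
    _ ≤ η * (ρ * ‖v‖ * ‖w‖) := by gcongr
    _ = _ := by ring

theorem norm_gradS_le : η * ‖gradS L θ‖ ≤ η * ρ := by
  have := h.norm_third_apply_le (u θ) (u θ)
  rwa [← h.gradS_eq, h.norm_u, mul_one, mul_one] at this

theorem abs_kappa_le : η * |kappa L u θ| ≤ η * ρ := by
  refine le_trans ?_ h.norm_gradS_le
  have := abs_real_inner_le_norm (gradS L θ) (u θ)
  rw [h.norm_u, mul_one] at this
  exact mul_le_mul_of_nonneg_left this h.η_pos.le

theorem inner_gradSperp : inner ℝ (u θ) (gradSperp L u θ) = 0 :=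
  inner_perp_eq_zero h.norm_u _

theorem norm_gradSperp_le : η * ‖gradSperp L u θ‖ ≤ η * ρ := by
  refine le_trans ?_ h.norm_gradS_le
  apply mul_le_mul_of_nonneg_left _ h.η_pos.le
  have := norm_sq_decomp h.norm_u (gradS L θ)
  apply le_of_sq_le_sq _ (norm_nonneg _)
  rw [this]
  have := sq_nonneg (inner ℝ (u θ) (gradS L θ))
  unfold gradSperp perp
  linarith

theorem hess_sub_le {v : Vec d} (hv : C * (η * ρ * ‖v‖) < 1) :
    η * ‖hess L (θ + v) - hess L θ‖ ≤ η * ρ * ‖v‖ := by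
  have hmem : θ + v ∈ Metric.ball θ (1 / (C * (η * ρ))) := by
    simpa using h.mem_ball_iff.2 hv
  have := h.reg.norm_hess_sub_le h.ball_subset (Metric.mem_ball_self h.radius_pos) hmem
  rw [add_sub_cancel_left] at this
  rw [mul_assoc]
  exact mul_le_mul_of_nonneg_left this h.η_pos.le

theorem small {v : Vec d} (hv : C * (η * ρ * ‖v‖) < 1) : η * ρ * ‖v‖ ≤ 1 / 8 := by
  have h1 := h.σ_pos
  have h2 : 0 ≤ η * ρ * ‖v‖ := by positivity
  nlinarith [h.C_ge]

theorem sharpness_taylor {v : Vec d} (hv : C * (η * ρ * ‖v‖) < 1) :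
    |η * sharpness L (θ + v) - (2 - s) - η * inner ℝ (gradS L θ) v| ≤
      2 * C * (η * ρ * ‖v‖) ^ 2 := by
  have hη := h.η_pos
  have hρ := h.ρ_pos
  have hg := h.gap_ge
  have hs := h.small hv
  have hgap : 0 < sharpness L θ - 1 / (2 * η) := by linarith [h.gapAt.lt]
  have h1 := SGDCoupling.sharpness_taylor h.reg h.top h.ball_subset h.ρ₄_nonneg h.gapAt
    (h.mem_ball_iff.2 hv) (by
      apply le_of_mul_le_mul_left _ hη
      linarith)
  rw [← h.gradS_eq] at h1
  rw [← h.sharp, ← mul_sub, ← mul_sub, abs_mul, abs_of_pos hη]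
  have h2 : 8 * ρ ^ 2 / (sharpness L θ - 1 / (2 * η)) ≤ 8 * (η * ρ ^ 2) := by
    rw [div_le_iff₀ hgap]
    have : 0 ≤ ρ ^ 2 := sq_nonneg _
    nlinarith
  calc _ ≤ η * ((8 * (η * ρ ^ 2) + C * (η * ρ ^ 2)) * ‖v‖ ^ 2) := by
        gcongr; exact h1.trans (by gcongr)
    _ = (8 + C) * (η * ρ * ‖v‖) ^ 2 := by ring
    _ ≤ _ := by gcongr; linarith [h.C_ge]

theorem mem_of_small {v : Vec d} (hv : C * (η * ρ * ‖v‖) < 1) : θ + v ∈ N := h.ball v hv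

theorem topPair_signed {v u₀ : Vec d} (hv : C * (η * ρ * ‖v‖) < 1) :
    TopPair (hess L (θ + v)) (signedTop u u₀ (θ + v)) (sharpness L (θ + v)) := by
  have := h.top.topPair h.reg (h.mem_of_small hv)
  rcases signedTop_eq_or u u₀ (θ + v) with e | e <;> rw [e]
  · exact this
  · exact this.neg

theorem hess_sub_le_gap {v : Vec d} (hv : C * (η * ρ * ‖v‖) < 1) :
    ‖hess L (θ + v) - hess L θ‖ ≤ (sharpness L θ - 1 / (2 * η)) / 4 := by
  have h1 := h.hess_sub_le hv
  have h2 := h.small hv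
  have h3 := h.gap_ge
  apply le_of_mul_le_mul_left _ h.η_pos
  linarith

theorem norm_sub_le_of_topPair {v w : Vec d} (hv : C * (η * ρ * ‖v‖) < 1)
    (hw : TopPair (hess L (θ + v)) w (sharpness L (θ + v))) (hs : 0 ≤ inner ℝ (u θ) w) :
    ‖w - u θ‖ ≤ 2 * (η * ρ * ‖v‖) := by
  have h1 := h.gapAt.norm_sub_le hw (h.hess_sub_le_gap hv) hs
  have h2 := h.hess_sub_le hv
  have h3 := h.gap_ge
  have hgap : 0 < sharpness L θ - 1 / (2 * η) := by linarith [h.gapAt.lt]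
  refine h1.trans ?_
  rw [div_le_iff₀ hgap]
  have h4 : 0 ≤ ‖hess L (θ + v) - hess L θ‖ := norm_nonneg (hess L (θ + v) - hess L θ)
  calc 2 * ‖hess L (θ + v) - hess L θ‖
      ≤ 2 * ‖hess L (θ + v) - hess L θ‖ * (η * (sharpness L θ - 1 / (2 * η))) := by nlinarith
    _ = 2 * (η * ‖hess L (θ + v) - hess L θ‖) * (sharpness L θ - 1 / (2 * η)) := by ring
    _ ≤ _ := by gcongr

theorem norm_signedTop_sub_le {v : Vec d} (hv : C * (η * ρ * ‖v‖) < 1) :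
    ‖signedTop u (u θ) (θ + v) - u θ‖ ≤ 2 * (η * ρ * ‖v‖) :=
  h.norm_sub_le_of_topPair hv (h.topPair_signed hv) (inner_signedTop_nonneg _ _ _)

/-- The stationarity constraint linearized at a point where it holds: `∇L` changes by `H v`, whose
component along `u` is `S⟨u, v⟩`, and rotating the eigenvector costs a second-order term. It serves
twice: to find points of the stable set, and to bound the `u`-component of a move between two of its
points. -/
theorem inner_gradient_signedTop {v : Vec d} (hv : C * (η * ρ * ‖v‖) < 1) :
    |η * inner ℝ (gradient L (θ + v)) (signedTop u (u θ) (θ + v)) - (2 - s) * inner ℝ (u θ) v| ≤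
      7 * (η * ρ) * (‖v‖ + η * ‖gradient L θ‖) ^ 2 := by
  have hη := h.η_pos
  have hσ := h.σ_pos
  have h1 := h.reg.norm_gradient_taylor_le h.ball_subset (h.mem_ball_iff.2 hv)
  have h2 := h.norm_signedTop_sub_le hv
  have h3 := h.norm_hess_le
  have hs := h.small hv
  set w := signedTop u (u θ) (θ + v)
  set gq := gradient L (θ + v)
  set g := gradient L θ with hg
  have hHv : η * ‖hess L θ v‖ ≤ 2 * ‖v‖ := by
    calc η * ‖hess L θ v‖ ≤ η * (‖hess L θ‖ * ‖v‖) := by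
          gcongr; exact (hess L θ).le_opNorm v
      _ = (η * ‖hess L θ‖) * ‖v‖ := by ring
      _ ≤ _ := by gcongr
  have h4 : η * ‖gq‖ ≤ η * ‖g‖ + 3 * ‖v‖ := by
    have e : gq = (gq - g - hess L θ v) + g + hess L θ v := by abel
    have e2 : ‖gq‖ ≤ ρ * ‖v‖ ^ 2 + ‖g‖ + ‖hess L θ v‖ := by
      rw [e]
      refine (norm_add₃_le).trans ?_
      gcongr
    have e3 : η * (ρ * ‖v‖ ^ 2) ≤ ‖v‖ := by
      calc η * (ρ * ‖v‖ ^ 2) = (η * ρ * ‖v‖) * ‖v‖ := by ring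
        _ ≤ 1 * ‖v‖ := by gcongr; linarith
        _ = _ := one_mul _
    nlinarith
  have h5 : inner ℝ (hess L θ v) (u θ) = sharpness L θ * inner ℝ (u θ) v := by
    rw [real_inner_comm, h.inner_u_hess]
  have e1 : η * inner ℝ gq w - (2 - s) * inner ℝ (u θ) v =
      η * inner ℝ (gq - g - hess L θ v) (u θ) + η * inner ℝ gq (w - u θ) := by
    rw [← h.sharp]
    simp only [inner_sub_left, inner_sub_right, h5, hg, h.stat]
    ring
  have e2 : |inner ℝ (gq - g - hess L θ v) (u θ)| ≤ ρ * ‖v‖ ^ 2 := by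
    refine (abs_real_inner_le_norm _ _).trans ?_
    rwa [h.norm_u, mul_one]
  have e3 : |inner ℝ gq (w - u θ)| ≤ ‖gq‖ * (2 * (η * ρ * ‖v‖)) :=
    (abs_real_inner_le_norm _ _).trans (by gcongr)
  rw [e1]
  have hv0 := norm_nonneg v
  have hg0 : 0 ≤ η * ‖g‖ := by positivity
  calc _ ≤ η * (ρ * ‖v‖ ^ 2) + η * (‖gq‖ * (2 * (η * ρ * ‖v‖))) := by
        refine (abs_add_le _ _).trans ?_
        rw [abs_mul, abs_mul, abs_of_pos hη]
        gcongr
    _ = η * ρ * (‖v‖ ^ 2 + (η * ‖gq‖) * (2 * ‖v‖)) := by ring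
    _ ≤ η * ρ * (‖v‖ ^ 2 + (η * ‖g‖ + 3 * ‖v‖) * (2 * ‖v‖)) := by gcongr
    _ ≤ η * ρ * (7 * (‖v‖ + η * ‖g‖) ^ 2) := by
        gcongr
        nlinarith [mul_nonneg hv0 hg0, sq_nonneg (η * ‖g‖)]
    _ = _ := by ring

/-- Needed for the intermediate value theorem. With the sign fixed by `u θ`, and the gap persisting
at every `q` of the ball, the perturbation bound based at `q` gives a local Lipschitz estimate. -/
theorem continuousOn_signedTop :
    ContinuousOn (signedTop u (u θ)) (Metric.ball θ (1 / (C * (η * ρ)))) := by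
  have hη := h.η_pos
  have hσ := h.σ_pos
  intro q hq
  apply ContinuousAt.continuousWithinAt
  have small : ∀ {z}, z ∈ Metric.ball θ (1 / (C * (η * ρ))) → C * (η * ρ * ‖z - θ‖) < 1 :=
    fun hz => h.mem_ball_iff.1 (mem_ball_iff_norm.1 hz)
  have near : ∀ {z}, z ∈ Metric.ball θ (1 / (C * (η * ρ))) →
      ‖signedTop u (u θ) z - u θ‖ ≤ 1 / 4 := by
    intro z hz
    have h1 := h.norm_signedTop_sub_le (small hz)
    have h2 := h.small (small hz)
    rw [add_sub_cancel] at h1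
    linarith
  have tp : ∀ {z}, z ∈ Metric.ball θ (1 / (C * (η * ρ))) →
      TopPair (hess L z) (signedTop u (u θ) z) (sharpness L z) := by
    intro z hz
    have h1 := h.topPair_signed (u₀ := u θ) (small hz)
    rwa [add_sub_cancel] at h1
  have gq : GapAt (hess L q) (signedTop u (u θ) q) (sharpness L q)
      (sharpness L q - (sharpness L θ - 1 / (2 * η)) / 4) := by
    have h1 := h.hess_sub_le_gap (small hq)
    rw [add_sub_cancel] at h1
    exact h.gapAt.persist (tp hq) (h.reg.hess_symm (h.ball_subset hq)) h1
      (inner_signedTop_nonneg _ _ _)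
  set γ := (sharpness L θ - 1 / (2 * η)) / 4 with hγ
  have hγ0 : 0 < γ := by have := h.gapAt.lt; rw [hγ]; linarith
  have hρ := h.ρ_pos
  rw [ContinuousAt, tendsto_iff_norm_sub_tendsto_zero]
  have hlim : Filter.Tendsto (fun z => 2 * (ρ * ‖z - q‖) / γ) (nhds q) (nhds 0) := by
    have : Continuous fun z : Vec d => 2 * (ρ * ‖z - q‖) / γ := by fun_prop
    have := this.tendsto q
    simpa using this
  have hlim2 : Filter.Tendsto (fun z => ρ * ‖z - q‖) (nhds q) (nhds 0) := by
    have : Continuous fun z : Vec d => ρ * ‖z - q‖ := by fun_prop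
    have := this.tendsto q
    simpa using this
  refine squeeze_zero' (Filter.Eventually.of_forall fun _ => norm_nonneg _) ?_ hlim
  filter_upwards [Metric.isOpen_ball.mem_nhds hq,
    hlim2.eventually_lt_const (show 0 < γ / 4 by linarith)] with z hz hz2
  have hD := h.reg.norm_hess_sub_le h.ball_subset hq hz
  have e : sharpness L q - (sharpness L q - γ) = γ := by ring
  -- Both vectors are within `1/4` of `u θ`, hence within `1/2` of each other, so the signs cannot
  -- disagree.
  have hin : 0 ≤ inner ℝ (signedTop u (u θ) q) (signedTop u (u θ) z) := by
    have n1 := near hq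
    have n2 := near hz
    have n3 := norm_sub_sq_real (signedTop u (u θ) q) (signedTop u (u θ) z)
    rw [(tp hq).norm_w, (tp hz).norm_w] at n3
    have n4 : ‖signedTop u (u θ) q - signedTop u (u θ) z‖ ≤ 1 / 2 := by
      calc _ = ‖(signedTop u (u θ) q - u θ) - (signedTop u (u θ) z - u θ)‖ := by
            congr 1; abel
        _ ≤ _ := (norm_sub_le _ _).trans (by linarith)
    nlinarith [norm_nonneg (signedTop u (u θ) q - signedTop u (u θ) z)]
  have := gq.norm_sub_le (tp hz) (by rw [e]; exact hD.trans hz2.le) hin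
  rw [e] at this
  exact this.trans (by gcongr)

end EdgePoint

end Local

/-! ### One step of projected gradient descent -/

section ProjectedStep

variable {d : ℕ}

theorem mem_stableSet_iff {L : Vec d → ℝ} {u : Vec d → Vec d} {η : ℝ} (hη : 0 < η) {q : Vec d} :
    q ∈ stableSet L u η ↔ η * sharpness L q ≤ 2 ∧ inner ℝ (gradient L q) (u q) = 0 := by
  unfold stableSet
  rw [Set.mem_ofPred_eq, le_div_iff₀ hη, mul_comm]

theorem inner_gradS_eq (L : Vec d → ℝ) (u : Vec d → Vec d) (θ v : Vec d) :
    inner ℝ (gradS L θ) v =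
      inner ℝ (gradSperp L u θ) v + kappa L u θ * inner ℝ (u θ) v := by
  rw [gradSperp, perp, kappa, inner_sub_left, real_inner_smul_left, real_inner_comm (u θ)]; ring

namespace EdgePoint

variable {L : Vec d → ℝ} {u : Vec d → Vec d} {N : Set (Vec d)} {η ρ C b s : ℝ} {θ : Vec d}
  (h : EdgePoint L u N η ρ C b s θ)
include h

theorem alpha_eq : alpha L θ = -inner ℝ (gradSperp L u θ) (gradient L θ) := by
  rw [alpha, real_inner_comm, inner_gradS_eq L u, real_inner_comm (gradient L θ) (u θ), h.stat]
  ring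

theorem inner_gradSperp_u : inner ℝ (gradSperp L u θ) (u θ) = 0 := by
  rw [real_inner_comm, h.inner_gradSperp]

/-- A point of the stable set close to `θ - η∇L(θ) - c ∇S^⊥(θ)`. -/
theorem exists_candidate {a m c : ℝ} (ha : a = η * ‖gradient L θ‖)
    (hsmall : 100 * C ^ 2 * (η * ρ * a) ≤ 1)
    (hc : c * (η * ‖gradSperp L u θ‖ ^ 2) = m) (hca : ‖c • gradSperp L u θ‖ ≤ 2 * a)
    (hm : η ^ 2 * alpha L θ - s + 82 * C * (η * ρ * a) ^ 2 ≤ m) :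
    ∃ p ∈ stableSet L u η,
      ‖θ - η • gradient L θ - p‖ ≤ ‖c • gradSperp L u θ‖ + 50 * C * (η * ρ) * a ^ 2 := by
  have hη := h.η_pos
  have hσ := h.σ_pos
  have hC := h.C_ge
  have ha0 : 0 ≤ a := by rw [ha]; positivity
  set σ := η * ρ with hσdef
  set g := gradient L θ with hg
  set sp := gradSperp L u θ with hsp
  have hσa : 0 ≤ σ * a := by positivity
  have hCσa : C * (σ * a) ≤ 1 / 800 := by nlinarith
  -- The largest shift along `u` that may be needed to restore stationarity. At `τ = ±τm` the linear
  -- term `(2 - s)τ` dominates the error `7σ(4a + a)² = 175σa²`, so the constraint function changes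
  -- sign between them.
  obtain ⟨τm, hτm⟩ : ∃ τm, τm = 50 * C * σ * a ^ 2 := ⟨_, rfl⟩
  have hτ0 : 0 ≤ τm := by rw [hτm]; positivity
  have hτa : τm ≤ a := by
    calc τm = (50 * (C * (σ * a))) * a := by rw [hτm]; ring
      _ ≤ 1 * a := by gcongr; linarith
      _ = a := one_mul a
  set vp := -(η • g) - c • sp with hvp
  have hu := h.norm_u
  have hgn : ‖η • g‖ = a := by rw [norm_smul, Real.norm_of_nonneg hη.le, ha]
  have hvpn : ‖vp‖ ≤ 3 * a := by
    refine (norm_sub_le _ _).trans ?_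
    rw [norm_neg, hgn]; linarith
  have huvp : inner ℝ (u θ) vp = 0 := by
    rw [hvp, inner_sub_right, inner_neg_right, inner_smul_right, inner_smul_right,
      real_inner_comm g, h.stat, h.inner_gradSperp]
    ring
  have hvn : ∀ τ ∈ Set.Icc (-τm) τm, ‖vp + τ • u θ‖ ≤ 4 * a := by
    intro τ hτ
    refine (norm_add_le _ _).trans ?_
    rw [norm_smul, hu, mul_one, Real.norm_eq_abs]
    have := abs_le.2 hτ
    linarith
  have hvs : ∀ τ ∈ Set.Icc (-τm) τm, C * (σ * ‖vp + τ • u θ‖) < 1 := by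
    intro τ hτ
    calc C * (σ * ‖vp + τ • u θ‖) ≤ C * (σ * (4 * a)) := by gcongr; exact hvn τ hτ
      _ < 1 := by linarith
  have huτ : ∀ τ : ℝ, inner ℝ (u θ) (vp + τ • u θ) = τ := by
    intro τ
    rw [inner_add_right, huvp, inner_smul_right, real_inner_self_eq_norm_sq, hu]; ring
  set G : ℝ → ℝ := fun τ => η * inner ℝ (gradient L (θ + (vp + τ • u θ)))
    (signedTop u (u θ) (θ + (vp + τ • u θ))) with hG
  have hGb : ∀ τ ∈ Set.Icc (-τm) τm, |G τ - (2 - s) * τ| ≤ 175 * σ * a ^ 2 := by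
    intro τ hτ
    have := h.inner_gradient_signedTop (hvs τ hτ)
    rw [huτ, ← ha] at this
    refine this.trans ?_
    calc 7 * (η * ρ) * (‖vp + τ • u θ‖ + a) ^ 2 ≤ 7 * (η * ρ) * (4 * a + a) ^ 2 := by
          gcongr; exact hvn τ hτ
      _ = _ := by ring
  have hGc : ContinuousOn G (Set.Icc (-τm) τm) := by
    have hline : Continuous fun τ : ℝ => θ + (vp + τ • u θ) := by fun_prop
    have hmaps : Set.MapsTo (fun τ : ℝ => θ + (vp + τ • u θ)) (Set.Icc (-τm) τm)
        (Metric.ball θ (1 / (C * (η * ρ)))) := by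
      intro τ hτ
      rw [mem_ball_iff_norm, add_sub_cancel_left]
      exact h.mem_ball_iff.2 (hvs τ hτ)
    have c1 : ContinuousOn (gradient L) (Metric.ball θ (1 / (C * (η * ρ)))) := fun q hq =>
      (h.reg.contDiffAt_gradient (h.ball_subset hq)).continuousAt.continuousWithinAt
    exact continuousOn_const.mul (ContinuousOn.inner (𝕜 := ℝ) (c1.comp hline.continuousOn hmaps)
      (h.continuousOn_signedTop.comp hline.continuousOn hmaps))
  have hs0 := h.s_nonneg
  have hs1 := h.s_le
  have h175 : 175 * σ * a ^ 2 ≤ (2 - s) * τm := by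
    have : 0 ≤ σ * a ^ 2 := by positivity
    rw [hτm]
    nlinarith [mul_nonneg this (sub_nonneg.2 hC), mul_nonneg (mul_nonneg this h.C_pos.le)
      (sub_nonneg.2 hs1)]
  have hlo : G (-τm) ≤ 0 := by
    have := (abs_le.1 (hGb (-τm) ⟨le_rfl, by linarith⟩)).2
    linarith
  have hhi : 0 ≤ G τm := by
    have := (abs_le.1 (hGb τm ⟨by linarith, le_rfl⟩)).1
    linarith
  obtain ⟨τ, hτ, hτG⟩ := intermediate_value_Icc (show -τm ≤ τm by linarith) hGc ⟨hlo, hhi⟩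
  have hτabs : |τ| ≤ τm := abs_le.2 hτ
  refine ⟨θ + (vp + τ • u θ), (mem_stableSet_iff hη).2 ⟨?_, ?_⟩, ?_⟩
  -- The margin in `hm` pays for the Taylor remainder `2C(4σa)² = 32C(σa)²` and for the drift `ηκτ`,
  -- at most `50C(σa)²`; together `82C(σa)²`.
  · have h1 := (abs_le.1 (h.sharpness_taylor (hvs τ hτ))).2
    have h2 : (η * ρ * ‖vp + τ • u θ‖) ^ 2 ≤ 16 * (σ * a) ^ 2 := by
      calc (η * ρ * ‖vp + τ • u θ‖) ^ 2 ≤ (η * ρ * (4 * a)) ^ 2 := by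
            gcongr; exact hvn τ hτ
        _ = _ := by rw [← hσdef]; ring
    have h3 : η * inner ℝ (gradS L θ) (vp + τ • u θ) =
        η ^ 2 * alpha L θ - m + η * (kappa L u θ * τ) := by
      rw [inner_gradS_eq L u, huτ, inner_add_right, inner_smul_right, h.inner_gradSperp_u, hvp,
        inner_sub_right, inner_neg_right, inner_smul_right, inner_smul_right,
        real_inner_self_eq_norm_sq, h.alpha_eq, ← hc]
      ring
    have h4 : η * (kappa L u θ * τ) ≤ σ * τm := by
      calc η * (kappa L u θ * τ) ≤ η * (|kappa L u θ| * |τ|) := by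
            rw [← abs_mul]; gcongr; exact le_abs_self _
        _ = (η * |kappa L u θ|) * |τ| := by ring
        _ ≤ σ * τm := by gcongr; exact h.abs_kappa_le
    have h5 : σ * τm = 50 * C * (σ * a) ^ 2 := by rw [hτm]; ring
    have h6 : 2 * C * (η * ρ * ‖vp + τ • u θ‖) ^ 2 ≤ 2 * C * (16 * (σ * a) ^ 2) := by
      have := h.C_pos
      gcongr
    nlinarith
  · rw [← inner_signedTop_eq_zero_iff u (u θ)]
    exact (mul_eq_zero.1 hτG).resolve_left hη.ne'
  · have e : θ - η • g - (θ + (vp + τ • u θ)) = c • sp - τ • u θ := by rw [hvp]; abel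
    rw [e]
    refine (norm_sub_le _ _).trans ?_
    rw [norm_smul τ, hu, mul_one, Real.norm_eq_abs, ← hτm]
    gcongr

set_option maxHeartbeats 1000000 in
/-- One step of projected gradient descent from `θ` to `θ'`: the correction
`r = θ - η∇L(θ) - θ'` and the sharpness after the step. -/
theorem pgd_step {θ' r : Vec d} {a : ℝ} (ha : a = η * ‖gradient L θ‖)
    (hr : r = θ - η • gradient L θ - θ')
    (hperp : ρ ≤ C * ‖gradSperp L u θ‖) (hα : 0 ≤ alpha L θ)
    (hsmall : 100 * C ^ 2 * (η * ρ * a) ≤ 1)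
    (hproj : IsProj (stableSet L u η) (θ - η • gradient L θ) θ') :
    ‖θ' - θ‖ ≤ 2 * a ∧
    η * ‖gradSperp L u θ‖ * ‖r‖ ≤ max (η ^ 2 * alpha L θ - s) 0 + 150 * C * (η * ρ * a) ^ 2 ∧
    η ^ 2 * alpha L θ - s - 150 * C * (η * ρ * a) ^ 2 ≤ η * inner ℝ (gradSperp L u θ) r ∧
    η * sharpness L θ' ≤ 2 ∧
    2 - η * sharpness L θ' ≤ s + 150 * C * (η * ρ * a) ^ 2 := by
  have hη := h.η_pos
  have hρ := h.ρ_pos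
  have hσ := h.σ_pos
  have hC := h.C_ge
  have hC0 := h.C_pos
  have ha0 : 0 ≤ a := by rw [ha]; positivity
  have hs0 := h.s_nonneg
  have hs1 := h.s_le
  obtain ⟨A, hA⟩ : ∃ A, A = η ^ 2 * alpha L θ := ⟨_, rfl⟩
  have hA0 : 0 ≤ A := by rw [hA]; positivity
  rw [← hA]
  have hspσ := h.norm_gradSperp_le
  have halpha := h.alpha_eq
  set sp := gradSperp L u θ with hsp
  set g := gradient L θ with hg
  obtain ⟨σ, hσdef⟩ : ∃ σ, σ = η * ρ := ⟨_, rfl⟩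
  have hspos : 0 < ‖sp‖ := by
    by_contra hcon
    have : ‖sp‖ = 0 := le_antisymm (not_lt.1 hcon) (norm_nonneg _)
    rw [this, mul_zero] at hperp
    linarith
  have hσsp : σ ≤ C * (η * ‖sp‖) := by
    rw [hσdef]
    calc η * ρ ≤ η * (C * ‖sp‖) := by gcongr
      _ = _ := by ring
  rw [← hσdef] at hσ hsmall hspσ ⊢
  have hσa : 0 ≤ σ * a := by positivity
  have hCσa : C * (σ * a) ≤ 1 / 800 := by nlinarith
  have hAa : A ≤ η * ‖sp‖ * a := by
    have h1 := abs_real_inner_le_norm sp g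
    have h2 := neg_le_abs (inner ℝ sp g)
    rw [hA, halpha, ha]
    calc η ^ 2 * -inner ℝ sp g ≤ η ^ 2 * (‖sp‖ * ‖g‖) := by gcongr; linarith
      _ = _ := by ring
  -- The decrease of `ηS` to be achieved by moving along `-∇S^⊥`: the linear excess over the
  -- threshold, if any, plus the margin required by `exists_candidate`. The multiple `c` below
  -- realizes it to first order.
  obtain ⟨m, hm⟩ : ∃ m, m = max (A - s) 0 + 82 * C * (σ * a) ^ 2 := ⟨_, rfl⟩
  have hmax : max (A - s) 0 ≤ A := max_le (by linarith) hA0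
  have hm0 : 0 ≤ m := by rw [hm]; positivity
  have hm2 : m ≤ 2 * a * (η * ‖sp‖) := by
    have : 82 * C * (σ * a) ^ 2 ≤ η * ‖sp‖ * a := by
      calc 82 * C * (σ * a) ^ 2 = 82 * C * (σ * a) * a * σ := by ring
        _ ≤ 82 * C * (σ * a) * a * (C * (η * ‖sp‖)) := by gcongr
        _ = (82 * C ^ 2 * (σ * a)) * (η * ‖sp‖ * a) := by ring
        _ ≤ 1 * (η * ‖sp‖ * a) := by gcongr; nlinarith
        _ = _ := one_mul _
    rw [hm]; linarith
  have hηs : 0 < η * ‖sp‖ := by positivity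
  obtain ⟨c, hc⟩ : ∃ c, c = m / (η * ‖sp‖ ^ 2) := ⟨_, rfl⟩
  have hc0 : 0 ≤ c := by rw [hc]; positivity
  have hcm : c * (η * ‖sp‖ ^ 2) = m := by rw [hc]; field_simp
  have hcn : ‖c • sp‖ = c * ‖sp‖ := by rw [norm_smul, Real.norm_of_nonneg hc0]
  have hcm2 : ‖c • sp‖ * (η * ‖sp‖) = m := by rw [hcn, ← hcm]; ring
  have hca : ‖c • sp‖ ≤ 2 * a := by
    refine le_of_mul_le_mul_right ?_ hηs
    rw [hcm2]; exact hm2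
  obtain ⟨p, hp, hpn⟩ := h.exists_candidate ha (by rw [← hσdef]; exact hsmall) hcm hca (by
    rw [← hσdef, ← hA, hm]; linarith [le_max_left (A - s) 0])
  -- The projection is at least as close as the candidate. This bounds `r` above; feasibility of
  -- `θ'` will bound its component along `∇S^⊥` below.
  have hrn : ‖r‖ ≤ ‖c • sp‖ + 50 * C * σ * a ^ 2 := by
    rw [hr, hσdef]; exact (hproj.2 p hp).trans hpn
  have hrs : η * ‖sp‖ * ‖r‖ ≤ max (A - s) 0 + 132 * C * (σ * a) ^ 2 := by
    calc η * ‖sp‖ * ‖r‖ ≤ η * ‖sp‖ * (‖c • sp‖ + 50 * C * σ * a ^ 2) := by gcongr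
      _ = ‖c • sp‖ * (η * ‖sp‖) + (η * ‖sp‖) * (50 * C * σ * a ^ 2) := by ring
      _ ≤ m + σ * (50 * C * σ * a ^ 2) := by rw [hcm2]; gcongr
      _ = _ := by rw [hm]; ring
  have hθM : θ ∈ stableSet L u η :=
    (mem_stableSet_iff hη).2 ⟨by rw [h.sharp]; linarith, h.stat⟩
  have hgn : ‖η • g‖ = a := by rw [norm_smul, Real.norm_of_nonneg hη.le, ha]
  have hΔn : ‖θ' - θ‖ ≤ 2 * a := by
    have h1 := hproj.2 θ hθM
    have h2 : ‖θ - η • g - θ‖ = a := by rw [sub_sub_cancel_left, norm_neg, hgn]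
    calc ‖θ' - θ‖ = ‖(θ - η • g - θ) - (θ - η • g - θ')‖ := by congr 1; abel
      _ ≤ _ := (norm_sub_le _ _).trans (by linarith)
  obtain ⟨v, hv⟩ : ∃ v, v = θ' - θ := ⟨_, rfl⟩
  have hθ' : θ' = θ + v := by rw [hv]; abel
  rw [← hv] at hΔn
  have hvs : C * (η * ρ * ‖v‖) < 1 := by
    rw [← hσdef]
    calc C * (σ * ‖v‖) ≤ C * (σ * (2 * a)) := by gcongr
      _ < 1 := by linarith
  obtain ⟨hM1, hM2⟩ := (mem_stableSet_iff hη).1 hproj.1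
  -- Stationarity holds at both ends of the step, so its linearization leaves only the error `7σ(2a
  -- + a)² = 63σa²`.
  have hux : |inner ℝ (u θ) v| ≤ 63 * σ * a ^ 2 := by
    have h1 := h.inner_gradient_signedTop hvs
    rw [← hθ', (inner_signedTop_eq_zero_iff u (u θ) θ' _).2 hM2, mul_zero, zero_sub, abs_neg,
      abs_mul, ← ha, ← hσdef, abs_of_pos (show 0 < 2 - s by linarith)] at h1
    have h2 : 7 * σ * (‖v‖ + a) ^ 2 ≤ 63 * σ * a ^ 2 := by
      calc 7 * σ * (‖v‖ + a) ^ 2 ≤ 7 * σ * (2 * a + a) ^ 2 := by gcongr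
        _ = _ := by ring
    nlinarith [abs_nonneg (inner ℝ (u θ) v)]
  have hκ : |η * (kappa L u θ * inner ℝ (u θ) v)| ≤ 8 * C * (σ * a) ^ 2 := by
    rw [abs_mul, abs_mul, abs_of_pos hη]
    calc η * (|kappa L u θ| * |inner ℝ (u θ) v|) = η * |kappa L u θ| * |inner ℝ (u θ) v| := by ring
      _ ≤ σ * (63 * σ * a ^ 2) := by
        gcongr
        rw [hσdef]; exact h.abs_kappa_le
      _ = 63 * (σ * a) ^ 2 := by ring
      _ ≤ _ := by gcongr; linarith
  have hS := h.sharpness_taylor hvs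
  rw [inner_gradS_eq L u, ← hθ', ← hσdef, mul_add] at hS
  have hS2 : 2 * C * (σ * ‖v‖) ^ 2 ≤ 8 * C * (σ * a) ^ 2 := by
    calc 2 * C * (σ * ‖v‖) ^ 2 ≤ 2 * C * (σ * (2 * a)) ^ 2 := by gcongr
      _ = _ := by ring
  have hv2 : v = -(η • g) - r := by rw [hv, hr]; abel
  have hin : η * inner ℝ sp v = A - η * inner ℝ sp r := by
    rw [hv2, inner_sub_right, inner_neg_right, inner_smul_right, hA, halpha]; ring
  rw [← hsp, hin] at hS
  obtain ⟨hSl, hSr⟩ := abs_le.1 hS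
  obtain ⟨hκl, hκr⟩ := abs_le.1 hκ
  have hCS : η * inner ℝ sp r ≤ η * ‖sp‖ * ‖r‖ := by
    rw [mul_assoc]
    exact mul_le_mul_of_nonneg_left (real_inner_le_norm _ _) hη.le
  have hq : 0 ≤ C * (σ * a) ^ 2 := by positivity
  -- The largest total is `132 + 8 + 8`, in units of `C(σa)²`: the bound on `r`, the `κ` term and
  -- the Taylor remainder of `S`.
  refine ⟨hv ▸ hΔn, by linarith, by linarith, hM1, ?_⟩
  have hmax2 : max (A - s) 0 ≤ A := hmax
  linarith

end EdgePoint

end ProjectedStep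

/-! ### The constrained trajectory up to the horizon -/

section Trajectory

variable {d : ℕ}

/-- Projected gradient descent on the stable set, with the landscape bounds along it expressed
through one constant `C` and the small parameter `ε`. -/
structure EdgeTrajectory (L : Vec d → ℝ) (u : Vec d → Vec d) (N : Set (Vec d)) (η ρ C ε : ℝ)
    (T : ℕ) (θc : ℕ → Vec d) : Prop where
  reg : RegularOn L N ρ (C * (η * ρ ^ 2))
  top : IsTopEigenvectorField L u
  η_pos : 0 < η
  ρ_pos : 0 < ρ
  C_ge : 8 ≤ C
  ε_nonneg : 0 ≤ ε
  ε_small : 1000 * C ^ 3 * ε ≤ 1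
  T_le : ε * T ≤ 1
  ball : ∀ t ≤ T, ∀ v, C * (η * ρ * ‖v‖) < 1 → θc t + v ∈ N
  stat : ∀ t ≤ T, inner ℝ (gradient L (θc t)) (u (θc t)) = 0
  sharp_zero : η * sharpness L (θc 0) = 2
  proj : ∀ t < T, IsProj (stableSet L u η) (θc t - η • gradient L (θc t)) (θc (t + 1))
  sign : ∀ t < T, 0 ≤ inner ℝ (u (θc t)) (u (θc (t + 1)))
  perp_ge : ∀ t ≤ T, ρ ≤ C * ‖gradSperp L u (θc t)‖
  alpha_nonneg : ∀ t ≤ T, 0 ≤ alpha L (θc t)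
  alpha_le : ∀ t ≤ T, η ^ 2 * alpha L (θc t) ≤ ε ^ 2
  grad_le : ∀ t ≤ T, η * ρ * (η * ‖gradient L (θc t)‖) ≤ C * ε ^ 2
  form : ∀ t ≤ T, ∀ v, inner ℝ (u (θc t)) v = 0 →
    |inner ℝ v (hess L (θc t) v)| ≤ C * ε * (‖hess L (θc t)‖ * ‖v‖ ^ 2)
  third_perp : ∀ t ≤ T, ∀ v w, inner ℝ (u (θc t)) v = 0 → inner ℝ (u (θc t)) w = 0 →
    ‖third L (θc t) v w‖ ≤ C * ε * (ρ * ‖v‖ * ‖w‖)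

/-- A vector that is hardly longer than its component along `∇S^⊥` requires must be close to a
multiple of `∇S^⊥`. In the application `R = η‖∇S^⊥‖‖r‖`, `I = η⟨∇S^⊥, r⟩` and `A = η²α`, so that the
left side is the squared, rescaled distance from `r` to `η(α/β)∇S^⊥`. -/
theorem correction_sq_le {A s Q R I : ℝ} (hA : 0 ≤ A) (hs : 0 ≤ s) (hQ : 0 ≤ Q) (hR : 0 ≤ R)
    (h1 : R ≤ max (A - s) 0 + Q) (h2 : A - s - Q ≤ I) :
    R ^ 2 - 2 * A * I + A ^ 2 ≤ 2 * s ^ 2 + 4 * A * Q + Q ^ 2 := by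
  have h3 : R ^ 2 ≤ (max (A - s) 0 + Q) ^ 2 := by gcongr
  have h4 : A * (A - s - Q) ≤ A * I := by gcongr
  rcases le_total 0 (A - s) with h | h
  · rw [max_eq_left h] at h3
    nlinarith [mul_nonneg hs hQ, sq_nonneg s]
  · rw [max_eq_right h] at h3
    nlinarith [mul_nonneg hA hQ, sq_nonneg (A - s)]

namespace EdgeTrajectory

variable {L : Vec d → ℝ} {u : Vec d → Vec d} {N : Set (Vec d)} {η ρ C ε : ℝ} {T : ℕ}
  {θc : ℕ → Vec d} (h : EdgeTrajectory L u N η ρ C ε T θc)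
include h

theorem ε_le_one : 8 * (C * ε) ≤ 1 ∧ ε ≤ 1 := by
  have h1 := h.ε_small
  have h2 := h.ε_nonneg
  have h3 := h.C_ge
  have h4 : 8 * (C * ε) ≤ 1000 * C ^ 3 * ε := by
    have : 8 * C ≤ 1000 * C ^ 3 := by nlinarith [sq_nonneg C]
    nlinarith
  exact ⟨h4.trans h1, by nlinarith⟩

theorem pow_T_le {t : ℕ} (ht : t ≤ T) : t * ε ^ 4 ≤ ε ^ 3 := by
  have h1 : ε * t ≤ 1 :=
    le_trans (mul_le_mul_of_nonneg_left (by exact_mod_cast ht) h.ε_nonneg) h.T_le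
  have h2 := h.ε_nonneg
  calc t * ε ^ 4 = (ε * t) * ε ^ 3 := by ring
    _ ≤ 1 * ε ^ 3 := by gcongr
    _ = _ := one_mul _

theorem step_small {t : ℕ} (ht : t ≤ T) :
    100 * C ^ 2 * (η * ρ * (η * ‖gradient L (θc t)‖)) ≤ 1 := by
  have h1 := h.ε_small
  have h2 := h.ε_nonneg
  have h3 := h.C_ge
  have h4 := h.ε_le_one.2
  have hC : 0 < C := by linarith
  calc 100 * C ^ 2 * (η * ρ * (η * ‖gradient L (θc t)‖)) ≤ 100 * C ^ 2 * (C * ε ^ 2) := by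
        gcongr 100 * C ^ 2 * ?_; exact h.grad_le t ht
    _ = (1000 * C ^ 3 * ε) * ε * (1 / 10) := by ring
    _ ≤ 1 * 1 * (1 / 10) := by gcongr
    _ ≤ 1 := by norm_num

theorem grad_sq_le {t : ℕ} (ht : t ≤ T) :
    150 * C * (η * ρ * (η * ‖gradient L (θc t)‖)) ^ 2 ≤ 150 * C ^ 3 * ε ^ 4 := by
  have hC : 0 < C := by linarith [h.C_ge]
  have := h.η_pos
  have := h.ρ_pos
  calc _ ≤ 150 * C * (C * ε ^ 2) ^ 2 := by gcongr 150 * C * ?_ ^ 2; exact h.grad_le t ht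
    _ = _ := by ring

theorem edgePoint_of {t : ℕ} (ht : t ≤ T) {s : ℝ} (hs0 : 0 ≤ s) (hs1 : s ≤ 150 * C ^ 3 * ε ^ 3)
    (hsharp : η * sharpness L (θc t) = 2 - s) :
    EdgePoint L u N η ρ C (C * ε) s (θc t) where
  reg := h.reg
  top := h.top
  η_pos := h.η_pos
  ρ_pos := h.ρ_pos
  C_ge := h.C_ge
  ball := h.ball t ht
  stat := h.stat t ht
  sharp := hsharp
  s_nonneg := hs0
  s_le := by
    have h1 := h.ε_small
    have h2 := h.ε_nonneg
    have h4 := h.ε_le_one.2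
    calc s ≤ 150 * C ^ 3 * ε ^ 3 := hs1
      _ = (1000 * C ^ 3 * ε) * (ε * ε) * (3 / 20) := by ring
      _ ≤ 1 * (1 * 1) * (3 / 20) := by gcongr
      _ ≤ _ := by norm_num
  b_nonneg := mul_nonneg (by linarith [h.C_ge]) h.ε_nonneg
  b_le := by linarith [h.ε_le_one.1]
  form := h.form t ht

/-- Each step adds at most `150C³ε⁴` to the defect, and there are at most `1/ε` steps. An induction
is needed because the one-step estimate itself assumes a small defect. -/
theorem exists_edgePoint (t : ℕ) (ht : t ≤ T) :
    ∃ s, s ≤ 150 * C ^ 3 * ε ^ 3 ∧ EdgePoint L u N η ρ C (C * ε) s (θc t) := by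
  suffices ∃ s, 0 ≤ s ∧ s ≤ 150 * C ^ 3 * (t * ε ^ 4) ∧ η * sharpness L (θc t) = 2 - s by
    obtain ⟨s, h0, h1, h2⟩ := this
    have hC : 0 < C := by linarith [h.C_ge]
    have h3 : s ≤ 150 * C ^ 3 * ε ^ 3 := h1.trans (by gcongr; exact h.pow_T_le ht)
    exact ⟨s, h3, h.edgePoint_of ht h0 h3 h2⟩
  induction t with
  | zero => exact ⟨0, le_rfl, by simp, by rw [h.sharp_zero]; ring⟩
  | succ t ih =>
    have ht' : t ≤ T := by omega
    obtain ⟨s, h0, h1, h2⟩ := ih ht'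
    have hC : 0 < C := by linarith [h.C_ge]
    have h3 : s ≤ 150 * C ^ 3 * ε ^ 3 := h1.trans (by gcongr; exact h.pow_T_le ht')
    have hp := h.edgePoint_of ht' h0 h3 h2
    obtain ⟨-, -, -, h4, h5⟩ := hp.pgd_step rfl rfl (h.perp_ge t ht') (h.alpha_nonneg t ht')
      (h.step_small ht') (h.proj t (by omega))
    refine ⟨2 - η * sharpness L (θc (t + 1)), by linarith, ?_, by ring⟩
    have h6 := h.grad_sq_le ht'
    push_cast
    linarith

theorem step_bounds {t : ℕ} (ht : t < T) :
    η * ρ * ‖θc (t + 1) - θc t‖ ≤ 2 * C * ε ^ 2 ∧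
    η * ρ * ‖(θc t - η • gradient L (θc t) - θc (t + 1)) -
      (η * (alpha L (θc t) / beta L u (θc t))) • gradSperp L u (θc t)‖ ≤
        450 * C ^ 4 * ε ^ 3 := by
  obtain ⟨s, hs, hp⟩ := h.exists_edgePoint t ht.le
  obtain ⟨r, hr⟩ : ∃ r, r = θc t - η • gradient L (θc t) - θc (t + 1) := ⟨_, rfl⟩
  obtain ⟨h1, h2, h3, -, -⟩ := hp.pgd_step rfl hr (h.perp_ge t ht.le) (h.alpha_nonneg t ht.le)
      (h.step_small ht.le) (h.proj t ht)
  rw [← hr]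
  have hη := h.η_pos
  have hρ := h.ρ_pos
  have hC := h.C_ge
  have hC0 : 0 < C := by linarith
  have hε := h.ε_nonneg
  constructor
  · calc _ ≤ η * ρ * (2 * (η * ‖gradient L (θc t)‖)) := by gcongr
      _ = 2 * (η * ρ * (η * ‖gradient L (θc t)‖)) := by ring
      _ ≤ 2 * (C * ε ^ 2) := by gcongr 2 * ?_; exact h.grad_le t ht.le
      _ = _ := by ring
  have hQ := h.grad_sq_le ht.le
  have hA0 := h.alpha_nonneg t ht.le
  have hA1 := h.alpha_le t ht.le
  have hperp := h.perp_ge t ht.le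
  have hβ : beta L u (θc t) = ‖gradSperp L u (θc t)‖ ^ 2 := rfl
  rw [hβ]
  generalize gradSperp L u (θc t) = sp at *
  generalize alpha L (θc t) = al at *
  have hsp : 0 < ‖sp‖ := by
    by_contra hcon
    have : ‖sp‖ = 0 := le_antisymm (not_lt.1 hcon) (norm_nonneg _)
    rw [this, mul_zero] at hperp
    linarith
  have key : (η * ‖sp‖ * ‖r - (η * (al / ‖sp‖ ^ 2)) • sp‖) ^ 2 =
      (η * ‖sp‖ * ‖r‖) ^ 2 - 2 * (η ^ 2 * al) * (η * inner ℝ sp r) + (η ^ 2 * al) ^ 2 := by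
    rw [mul_pow, norm_sub_sq_real, inner_smul_right, norm_smul, real_inner_comm,
      Real.norm_of_nonneg (by positivity)]
    field_simp
  have hA0' : 0 ≤ η ^ 2 * al := by positivity
  have hb := correction_sq_le hA0' hp.s_nonneg (by positivity) (by positivity) h2 h3
  rw [← key] at hb
  obtain ⟨K, hK⟩ : ∃ K, K = 150 * C ^ 3 := ⟨_, rfl⟩
  rw [← hK] at hQ hs
  have hK1 : 1 ≤ K := by
    rw [hK]
    have : 1 ≤ C ^ 3 := one_le_pow₀ (by linarith)
    linarith
  have hQ0 : 0 ≤ 150 * C * (η * ρ * (η * ‖gradient L (θc t)‖)) ^ 2 := by positivity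
  generalize 150 * C * (η * ρ * (η * ‖gradient L (θc t)‖)) ^ 2 = Q at *
  have hs0 := hp.s_nonneg
  -- With `s = O(ε³)`, `A ≤ ε²` and `Q = O(ε⁴)`, both `s²` and `AQ` are `O(ε⁶)`; the square root
  -- gives `ε³`.
  have hfin : η * ‖sp‖ * ‖r - (η * (al / ‖sp‖ ^ 2)) • sp‖ ≤ 3 * K * ε ^ 3 := by
    apply le_of_sq_le_sq _ (by positivity)
    have hε1 := h.ε_le_one.2
    calc _ ≤ 2 * s ^ 2 + 4 * (η ^ 2 * al) * Q + Q ^ 2 := hb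
      _ ≤ 2 * (K * ε ^ 3) ^ 2 + 4 * ε ^ 2 * (K * ε ^ 4) + (K * ε ^ 4) ^ 2 := by gcongr
      _ = (2 * K ^ 2 + 4 * K * 1 + K ^ 2 * (ε * ε)) * (ε ^ 3) ^ 2 := by ring
      _ ≤ (2 * K ^ 2 + 4 * K * K + K ^ 2 * (1 * 1)) * (ε ^ 3) ^ 2 := by gcongr
      _ ≤ (3 * K * ε ^ 3) ^ 2 := by nlinarith [sq_nonneg (K * ε ^ 3)]
  calc η * ρ * ‖r - (η * (al / ‖sp‖ ^ 2)) • sp‖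
      ≤ η * (C * ‖sp‖) * ‖r - (η * (al / ‖sp‖ ^ 2)) • sp‖ := by gcongr
    _ = C * (η * ‖sp‖ * ‖r - (η * (al / ‖sp‖ ^ 2)) • sp‖) := by ring
    _ ≤ C * (3 * K * ε ^ 3) := by gcongr
    _ = _ := by rw [hK]; ring

theorem next_small {t : ℕ} (ht : t < T) : C * (η * ρ * ‖θc (t + 1) - θc t‖) < 1 := by
  have h1 := (h.step_bounds ht).1
  have hC := h.C_ge
  have hC0 : 0 < C := by linarith
  have h2 := h.ε_le_one
  have h3 := h.ε_nonneg
  have h4 : C * ε ≤ 1 / 8 := by linarith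
  calc C * (η * ρ * ‖θc (t + 1) - θc t‖) ≤ C * (2 * C * ε ^ 2) := by gcongr
    _ = 2 * ((C * ε) * (C * ε)) := by ring
    _ ≤ 2 * (1 / 8 * (1 / 8)) := by gcongr
    _ < 1 := by norm_num

theorem norm_u_sub_le {t : ℕ} (ht : t < T) :
    ‖u (θc (t + 1)) - u (θc t)‖ ≤ 4 * C * ε ^ 2 := by
  obtain ⟨s, -, hp⟩ := h.exists_edgePoint t ht.le
  obtain ⟨s', -, hp'⟩ := h.exists_edgePoint (t + 1) ht
  have h1 := (h.step_bounds ht).1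
  have h2 := hp.norm_sub_le_of_topPair (v := θc (t + 1) - θc t) (w := u (θc (t + 1)))
    (h.next_small ht) (by rw [add_sub_cancel]; exact hp'.topPair) (h.sign t ht)
  linarith

/-- `κ = ⟨∇³L(u, u), u⟩` is trilinear in `u`, so its change telescopes into the change of `∇³L`,
which is Lipschitz, and three changes of `u`; all are `O(ε²)` in units of `σ`. -/
theorem abs_kappa_sub_le {t : ℕ} (ht : t < T) :
    η * |kappa L u (θc (t + 1)) - kappa L u (θc t)| ≤ η * ρ * (20 * C ^ 2 * ε ^ 2) := by
  obtain ⟨s, -, hp⟩ := h.exists_edgePoint t ht.le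
  obtain ⟨s', -, hp'⟩ := h.exists_edgePoint (t + 1) ht
  have hη := h.η_pos
  have hρ := h.ρ_pos
  have hC := h.C_ge
  have hC0 : 0 < C := by linarith
  have h1 := (h.step_bounds ht).1
  have h2 := h.norm_u_sub_le ht
  have h3 := h.reg.lip _ hp'.mem _ hp.mem
  rw [kappa, kappa, hp.gradS_eq, hp'.gradS_eq]
  have hu := hp.norm_u
  have hu' := hp'.norm_u
  have hb := hp.norm_third_apply_le
  generalize u (θc (t + 1)) = w at *
  generalize u (θc t) = z at *
  generalize third L (θc t) = Q at *
  generalize third L (θc (t + 1)) = Q' at *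
  have e : inner ℝ (Q' w w) w - inner ℝ (Q z z) z = inner ℝ ((Q' - Q) w w) w +
      inner ℝ (Q (w - z) w) w + inner ℝ (Q z (w - z)) w + inner ℝ (Q z z) (w - z) := by
    simp only [_root_.sub_apply, map_sub, inner_sub_left, inner_sub_right]
    ring
  have f1 : |inner ℝ ((Q' - Q) w w) w| ≤ ‖Q' - Q‖ := by
    refine (abs_real_inner_le_norm _ _).trans ?_
    rw [hu', mul_one]
    refine (((Q' - Q) w).le_opNorm w).trans ?_
    rw [hu', mul_one]
    refine ((Q' - Q).le_opNorm w).trans ?_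
    rw [hu', mul_one]
  have f2 : ∀ x y c : Vec d, ‖c‖ * ‖x‖ * ‖y‖ ≤ ‖w - z‖ →
      η * |inner ℝ (Q x y) c| ≤ η * ρ * ‖w - z‖ := by
    intro x y c hx
    calc η * |inner ℝ (Q x y) c| ≤ η * (‖Q x y‖ * ‖c‖) := by
          gcongr; exact abs_real_inner_le_norm _ _
      _ = (η * ‖Q x y‖) * ‖c‖ := by ring
      _ ≤ (η * ρ * ‖x‖ * ‖y‖) * ‖c‖ := by gcongr ?_ * ‖c‖; exact hb x y
      _ = η * ρ * (‖c‖ * ‖x‖ * ‖y‖) := by ring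
      _ ≤ _ := by gcongr
  have g1 := f2 (w - z) w w (by rw [hu']; linarith)
  have g2 := f2 z (w - z) w (by rw [hu', hu]; linarith)
  have g3 := f2 z z (w - z) (by rw [hu]; linarith)
  have g0 : η * |inner ℝ ((Q' - Q) w w) w| ≤ η * ρ * (C * (2 * C * ε ^ 2)) := by
    calc η * |inner ℝ ((Q' - Q) w w) w| ≤ η * (C * (η * ρ ^ 2) * ‖θc (t + 1) - θc t‖) := by
          gcongr; exact f1.trans h3
      _ = η * ρ * (C * (η * ρ * ‖θc (t + 1) - θc t‖)) := by ring
      _ ≤ _ := by gcongr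
  have g4 : η * ρ * ‖w - z‖ ≤ η * ρ * (4 * C * ε ^ 2) := by gcongr
  rw [e]
  calc _ ≤ η * (|inner ℝ ((Q' - Q) w w) w| + |inner ℝ (Q (w - z) w) w| +
        |inner ℝ (Q z (w - z)) w| + |inner ℝ (Q z z) (w - z)|) := by
        gcongr
        refine (abs_add_le _ _).trans ?_
        gcongr
        exact abs_add_three _ _ _
    _ ≤ η * ρ * (C * (2 * C * ε ^ 2)) + 3 * (η * ρ * (4 * C * ε ^ 2)) := by linarith
    _ = η * ρ * ((2 * C * C + 12 * C) * ε ^ 2) := by ring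
    _ ≤ _ := by
      gcongr
      nlinarith

end EdgeTrajectory

end Trajectory

/-! ### The predicted step: Lipschitz bound and energy -/

section PredictedStep

variable {E : Type*} [NormedAddCommGroup E] [InnerProductSpace ℝ E]

theorem norm_perp_le {u : E} (hu : ‖u‖ = 1) (v : E) : ‖v - inner ℝ u v • u‖ ≤ ‖v‖ := by
  have := norm_sq_decomp hu v
  apply le_of_sq_le_sq _ (norm_nonneg v)
  nlinarith [sq_nonneg (inner ℝ u v)]

theorem abs_inner_unit_le {u : E} (hu : ‖u‖ = 1) (v : E) : |inner ℝ u v| ≤ ‖v‖ := by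
  have := abs_real_inner_le_norm u v
  rwa [hu, one_mul] at this

/-- The part of the predicted step that is projected onto the complement of the new eigenvector. -/
def perpUpdate (u s : E) (A : E →L[ℝ] E) (D : ℝ) (v : E) : E :=
  ((v - inner ℝ u v • u) - A (v - inner ℝ u v • u)) + ((D ^ 2 - inner ℝ u v ^ 2) / 2) • s

/-- Minus the new coordinate along the new eigenvector in the predicted step. -/
def flipUpdate (u s : E) (κ : ℝ) (v : E) : ℝ :=
  (1 + inner ℝ s v) * inner ℝ u v + κ / 2 * inner ℝ u v ^ 2

/-- The predicted step, with the step size absorbed into `A`, `s` and `κ`. -/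
def modelStep (u u' s : E) (A : E →L[ℝ] E) (κ D : ℝ) (v : E) : E :=
  (perpUpdate u s A D v - inner ℝ u' (perpUpdate u s A D v) • u') - flipUpdate u s κ v • u'

/-- The energy of a displacement; it grows by at most a factor `1 + O(ε)` in a predicted step. -/
def energy (u : E) (κ : ℝ) (v : E) : ℝ :=
  inner ℝ u v ^ 2 + κ / 2 * inner ℝ u v ^ 3 + 2 * ‖v - inner ℝ u v • u‖ ^ 2

theorem half_norm_sq_le_energy {u v : E} {κ σ : ℝ} (hu : ‖u‖ = 1) (hκ : |κ| ≤ σ)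
    (hv : σ * ‖v‖ ≤ 1) :
    1 / 2 * ‖v‖ ^ 2 ≤ energy u κ v := by
  have h1 := norm_sq_decomp hu v
  have h2 := abs_inner_unit_le hu v
  have h3 : |κ / 2 * inner ℝ u v| ≤ 1 / 2 := by
    rw [abs_mul, abs_div, abs_two]
    have : |κ| * |inner ℝ u v| ≤ σ * ‖v‖ := by
      gcongr
      exact (abs_nonneg κ).trans hκ
    linarith
  have h4 := (abs_le.1 h3).1
  have e : energy u κ v = (1 + κ / 2 * inner ℝ u v) * inner ℝ u v ^ 2 +
      2 * ‖v - inner ℝ u v • u‖ ^ 2 := by unfold energy; ring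
  rw [e, h1]
  nlinarith [sq_nonneg (inner ℝ u v), sq_nonneg ‖v - inner ℝ u v • u‖]

theorem energy_le {u v : E} {κ σ : ℝ} (hu : ‖u‖ = 1) (hκ : |κ| ≤ σ)
    (hv : σ * ‖v‖ ≤ 1) : energy u κ v ≤ 3 * ‖v‖ ^ 2 := by
  have h1 := norm_sq_decomp hu v
  have h2 := abs_inner_unit_le hu v
  have h3 : |κ / 2 * inner ℝ u v| ≤ 1 / 2 := by
    rw [abs_mul, abs_div, abs_two]
    have : |κ| * |inner ℝ u v| ≤ σ * ‖v‖ := by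
      gcongr
      exact (abs_nonneg κ).trans hκ
    linarith
  have h4 := (abs_le.1 h3).2
  have e : energy u κ v = (1 + κ / 2 * inner ℝ u v) * inner ℝ u v ^ 2 +
      2 * ‖v - inner ℝ u v • u‖ ^ 2 := by unfold energy; ring
  rw [e, h1]
  nlinarith [sq_nonneg (inner ℝ u v), sq_nonneg ‖v - inner ℝ u v • u‖]

/-- All that the analysis of one predicted step uses: the old and new frames `u`, `u'`, which differ
by `O(ε²)`, the cubic terms bounded by `σ`, and the decisive relation `σδ ≤ Mε`, by which each cubic
interaction at displacement `δ` is a relative perturbation of order `ε`. -/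
structure StepBounds (u u' s : E) (A : E →L[ℝ] E) (κ κ' D σ δ ε M : ℝ) : Prop where
  norm_u : ‖u‖ = 1
  norm_u' : ‖u'‖ = 1
  norm_sub : ‖u' - u‖ ≤ M * ε ^ 2
  inner_s : inner ℝ u s = 0
  norm_s : ‖s‖ ≤ σ
  abs_κ : |κ| ≤ σ
  abs_κ' : |κ'| ≤ σ
  abs_κ_sub : |κ' - κ| ≤ σ * (M * ε ^ 2)
  inner_A : ∀ p, inner ℝ u p = 0 → inner ℝ u (A p) = 0
  norm_A : ∀ p, inner ℝ u p = 0 → ‖A p‖ ≤ M * ε * ‖p‖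
  D_nonneg : 0 ≤ D
  D_le : D ≤ δ
  σδ_le : σ * δ ≤ M * ε
  ε_nonneg : 0 ≤ ε
  M_ge : 1 ≤ M

namespace StepBounds

variable {u u' s : E} {A : E →L[ℝ] E} {κ κ' D σ δ ε M K : ℝ}
  (h : StepBounds u u' s A κ κ' D σ δ ε M)
include h

theorem σ_nonneg : 0 ≤ σ := (norm_nonneg s).trans h.norm_s

theorem δ_nonneg : 0 ≤ δ := h.D_nonneg.trans h.D_le

theorem Mε_nonneg : 0 ≤ M * ε := mul_nonneg (by linarith [h.M_ge]) h.ε_nonneg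

theorem abs_inner_s_le (v : E) : |inner ℝ s v| ≤ σ * ‖v‖ :=
  (abs_real_inner_le_norm s v).trans (mul_le_mul_of_nonneg_right h.norm_s (norm_nonneg v))

theorem σ_mul_le (hK : 1 ≤ K) : σ * (K * δ) ≤ K * (M * ε) := by
  calc σ * (K * δ) = K * (σ * δ) := by ring
    _ ≤ _ := by gcongr K * ?_; exact h.σδ_le

theorem norm_linear_part_le (v : E) :
    ‖(v - inner ℝ u v • u) - A (v - inner ℝ u v • u)‖ ≤ (1 + M * ε) * ‖v - inner ℝ u v • u‖ := by
  refine (norm_sub_le _ _).trans ?_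
  have := h.norm_A _ (inner_perp_eq_zero h.norm_u v)
  linarith

/-- The linear part sends `x` to `-x` along `u'` and the rest into `u'^⊥`; by Pythagoras its norm is
at most `1 + Mε`. The quadratic terms have Lipschitz constant of order `σKδ ≤ KMε` on the ball: one
such unit from the `∇S^⊥` direction and three from the flip. -/
theorem modelStep_lipschitz (hK : 1 ≤ K) {v w : E} (hv : ‖v‖ ≤ K * δ) (hw : ‖w‖ ≤ K * δ) :
    ‖modelStep u u' s A κ D v - modelStep u u' s A κ D w‖ ≤
      (1 + 5 * K * M * ε) * ‖v - w‖ := by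
  have hδ := h.δ_nonneg
  have hσ := h.σ_nonneg
  have hMε := h.Mε_nonneg
  have hσK := h.σ_mul_le hK
  have hu' := h.norm_u'
  obtain ⟨z, hz⟩ : ∃ z, z = v - w := ⟨_, rfl⟩
  rw [← hz]
  obtain ⟨g, hg⟩ : ∃ g, g = (z - inner ℝ u z • u) - A (z - inner ℝ u z • u) := ⟨_, rfl⟩
  obtain ⟨a, ha⟩ : ∃ a, a = (inner ℝ u v ^ 2 - inner ℝ u w ^ 2) / 2 := ⟨_, rfl⟩
  obtain ⟨f, hf⟩ : ∃ f, f = inner ℝ s v * inner ℝ u v - inner ℝ s w * inner ℝ u w := ⟨_, rfl⟩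
  have e : modelStep u u' s A κ D v - modelStep u u' s A κ D w =
      ((g - inner ℝ u' g • u') - inner ℝ u z • u') -
        a • (s - inner ℝ u' s • u') - (f + κ * a) • u' := by
    have e1 : perpUpdate u s A D v - perpUpdate u s A D w = g - a • s := by
      rw [hg, ha, hz]
      simp only [perpUpdate, inner_sub_right, map_sub, map_smul, sub_smul]
      module
    have e2 : flipUpdate u s κ v - flipUpdate u s κ w = inner ℝ u z + f + κ * a := by
      rw [hf, ha, hz]
      simp only [flipUpdate, inner_sub_right]
      ring
    have e3 : perpUpdate u s A D v = g - a • s + perpUpdate u s A D w := by rw [← e1]; abel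
    have e4 : flipUpdate u s κ v = inner ℝ u z + f + κ * a + flipUpdate u s κ w := by
      rw [← e2]; ring
    unfold modelStep
    rw [e3, e4]
    simp only [inner_add_right, inner_sub_right, inner_smul_right]
    module
  have hX : ‖(g - inner ℝ u' g • u') - inner ℝ u z • u'‖ ≤ (1 + M * ε) * ‖z‖ := by
    apply le_of_sq_le_sq _ (by positivity)
    have h1 := norm_sub_sq_real (g - inner ℝ u' g • u') (inner ℝ u z • u')
    rw [inner_smul_right, real_inner_comm u' (_ - _), inner_perp_eq_zero hu', norm_smul, hu',
      mul_one,
      Real.norm_eq_abs, sq_abs] at h1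
    have h2 := (norm_perp_le hu' g).trans (hg ▸ h.norm_linear_part_le z)
    have h3 : ‖g - inner ℝ u' g • u'‖ ^ 2 ≤ ((1 + M * ε) * ‖z - inner ℝ u z • u‖) ^ 2 := by
      gcongr
    have h4 := norm_sq_decomp h.norm_u z
    rw [h1, mul_pow, h4]
    rw [mul_pow] at h3
    have h5 : 1 ≤ (1 + M * ε) ^ 2 := one_le_pow₀ (by linarith)
    nlinarith [sq_nonneg (inner ℝ u z)]
  have hxv := (abs_inner_unit_le h.norm_u v).trans hv
  have hxw := (abs_inner_unit_le h.norm_u w).trans hw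
  have hxz := abs_inner_unit_le h.norm_u z
  have hsz := h.abs_inner_s_le z
  have hsv : |inner ℝ s v| ≤ σ * (K * δ) := (h.abs_inner_s_le v).trans (by gcongr)
  have hza : ‖z‖ * (σ * (K * δ)) ≤ ‖z‖ * (K * (M * ε)) := by gcongr
  have haσ : σ * |a| ≤ K * (M * ε) * ‖z‖ := by
    have e1 : a = inner ℝ u z * ((inner ℝ u v + inner ℝ u w) / 2) := by
      rw [ha, hz, inner_sub_right]; ring
    have e2 : |(inner ℝ u v + inner ℝ u w) / 2| ≤ K * δ := by
      rw [abs_div, abs_two]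
      linarith [abs_add_le (inner ℝ u v) (inner ℝ u w)]
    rw [e1, abs_mul]
    calc σ * (|inner ℝ u z| * |(inner ℝ u v + inner ℝ u w) / 2|) ≤ σ * (‖z‖ * (K * δ)) := by
          gcongr
      _ ≤ _ := by linarith
  have hfa : |f| ≤ 2 * (K * (M * ε) * ‖z‖) := by
    have e1 : f = inner ℝ s v * inner ℝ u z + inner ℝ s z * inner ℝ u w := by
      rw [hf, hz, inner_sub_right, inner_sub_right]; ring
    rw [e1]
    refine (abs_add_le _ _).trans ?_
    rw [abs_mul, abs_mul]
    calc _ ≤ (σ * (K * δ)) * ‖z‖ + (σ * ‖z‖) * (K * δ) := by gcongr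
      _ ≤ _ := by linarith
  have hκa : |κ * a| ≤ K * (M * ε) * ‖z‖ := by
    rw [abs_mul]
    exact (mul_le_mul_of_nonneg_right h.abs_κ (abs_nonneg a)).trans haσ
  have hsa : ‖a • (s - inner ℝ u' s • u')‖ ≤ K * (M * ε) * ‖z‖ := by
    rw [norm_smul, Real.norm_eq_abs]
    calc |a| * ‖s - inner ℝ u' s • u'‖ ≤ |a| * σ := by
          gcongr; exact (norm_perp_le hu' s).trans h.norm_s
      _ ≤ _ := by linarith
  have hfu : ‖(f + κ * a) • u'‖ ≤ 3 * (K * (M * ε) * ‖z‖) := by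
    rw [norm_smul, hu', mul_one, Real.norm_eq_abs]
    linarith [abs_add_le f (κ * a)]
  rw [e]
  have t1 := norm_sub_le (((g - inner ℝ u' g • u') - inner ℝ u z • u') -
        a • (s - inner ℝ u' s • u')) ((f + κ * a) • u')
  have t2 := norm_sub_le ((g - inner ℝ u' g • u') - inner ℝ u z • u')
        (a • (s - inner ℝ u' s • u'))
  have hlast : M * ε * ‖z‖ ≤ K * (M * ε) * ‖z‖ := by
    have := mul_nonneg hMε (norm_nonneg z)
    nlinarith
  nlinarith

theorem abs_sq_sub_le (hK : 1 ≤ K) {v : E} (hv : ‖v‖ ≤ K * δ) :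
    |D ^ 2 - inner ℝ u v ^ 2| ≤ (K * δ) ^ 2 := by
  have h1 := (abs_inner_unit_le h.norm_u v).trans hv
  have hδ := h.δ_nonneg
  have h2 : inner ℝ u v ^ 2 ≤ (K * δ) ^ 2 := by rw [← sq_abs]; gcongr
  have h3 : D ^ 2 ≤ (K * δ) ^ 2 := by
    have := h.D_nonneg
    gcongr
    calc D ≤ 1 * δ := by rw [one_mul]; exact h.D_le
      _ ≤ _ := by gcongr
  rw [abs_le]
  constructor <;> linarith [sq_nonneg D, sq_nonneg (inner ℝ u v)]

theorem norm_perpUpdate_le (hK : 1 ≤ K) {v : E} (hv : ‖v‖ ≤ K * δ) :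
    ‖perpUpdate u s A D v‖ ≤ (1 + 2 * K * M * ε) * (K * δ) := by
  have hδ := h.δ_nonneg
  have hMε := h.Mε_nonneg
  have h1 := (h.norm_linear_part_le v).trans
    (mul_le_mul_of_nonneg_left ((norm_perp_le h.norm_u v).trans hv) (by linarith))
  have h2 : ‖((D ^ 2 - inner ℝ u v ^ 2) / 2) • s‖ ≤ K * (M * ε) * (K * δ) := by
    rw [norm_smul, Real.norm_eq_abs, abs_div, abs_two]
    calc |D ^ 2 - inner ℝ u v ^ 2| / 2 * ‖s‖ ≤ (K * δ) ^ 2 * σ := by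
          gcongr
          · linarith [h.abs_sq_sub_le hK hv, abs_nonneg (D ^ 2 - inner ℝ u v ^ 2)]
          · exact h.norm_s
      _ = (σ * (K * δ)) * (K * δ) := by ring
      _ ≤ _ := by gcongr ?_ * (K * δ); exact h.σ_mul_le hK
  refine (norm_add_le _ _).trans ((add_le_add h1 h2).trans ?_)
  have : M * ε * (K * δ) ≤ K * (M * ε) * (K * δ) := by
    have : 0 ≤ M * ε * (K * δ) := by positivity
    nlinarith
  nlinarith

theorem abs_flipUpdate_sub_le (hK : 1 ≤ K) {v : E} (hv : ‖v‖ ≤ K * δ) :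
    |flipUpdate u s κ v - inner ℝ u v| ≤ 2 * K * M * ε * |inner ℝ u v| := by
  have hδ := h.δ_nonneg
  have hσ := h.σ_nonneg
  have h1 : |inner ℝ s v| ≤ K * (M * ε) :=
    ((h.abs_inner_s_le v).trans (by gcongr)).trans (h.σ_mul_le hK)
  have h2 : |κ / 2 * inner ℝ u v| ≤ K * (M * ε) := by
    rw [abs_mul, abs_div, abs_two]
    calc |κ| / 2 * |inner ℝ u v| ≤ σ * (K * δ) := by
          gcongr
          · linarith [h.abs_κ, abs_nonneg κ]
          · exact (abs_inner_unit_le h.norm_u v).trans hv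
      _ ≤ _ := h.σ_mul_le hK
  have e : flipUpdate u s κ v - inner ℝ u v =
      (inner ℝ s v + κ / 2 * inner ℝ u v) * inner ℝ u v := by
    unfold flipUpdate; ring
  rw [e, abs_mul]
  gcongr
  linarith [abs_add_le (inner ℝ s v) (κ / 2 * inner ℝ u v)]

theorem abs_flipUpdate_le (hK : 1 ≤ K) {v : E} (hv : ‖v‖ ≤ K * δ) :
    |flipUpdate u s κ v| ≤ (1 + 2 * K * M * ε) * (K * δ) := by
  have h1 := h.abs_flipUpdate_sub_le hK hv
  have h2 := (abs_inner_unit_le h.norm_u v).trans hv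
  have hMε := h.Mε_nonneg
  have h3 : flipUpdate u s κ v = (flipUpdate u s κ v - inner ℝ u v) + inner ℝ u v := by ring
  have h4 := abs_add_le (flipUpdate u s κ v - inner ℝ u v) (inner ℝ u v)
  rw [← h3] at h4
  calc |flipUpdate u s κ v| ≤ (1 + 2 * K * M * ε) * |inner ℝ u v| := by linarith
    _ ≤ _ := by
      gcongr
      have : 0 ≤ 2 * K * (M * ε) := by positivity
      linarith

/-- Replacing the new frame by the old one changes the predicted step by `O(ε² δ)`. -/
theorem norm_modelStep_sub_le (hK : 1 ≤ K) {v : E} (hv : ‖v‖ ≤ K * δ) (hε : ε ≤ 1) :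
    ‖(perpUpdate u s A D v - flipUpdate u s κ v • u) - modelStep u u' s A κ D v‖ ≤
      6 * K ^ 2 * M ^ 2 * (ε ^ 2 * δ) := by
  have hδ := h.δ_nonneg
  have hM := h.M_ge
  have hε0 := h.ε_nonneg
  have h1 := h.norm_perpUpdate_le hK hv
  have h2 := h.abs_flipUpdate_le hK hv
  have h3 := h.norm_sub
  set q := perpUpdate u s A D v
  set c := flipUpdate u s κ v
  -- As `q` is orthogonal to the old `u`, its component along `u'` is `⟨u' - u, q⟩`, already of the
  -- size of the frame change.
  have huq : inner ℝ u q = 0 := by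
    have e1 := inner_perp_eq_zero h.norm_u v
    have e2 := h.inner_A _ e1
    simp only [q, perpUpdate]
    rw [inner_add_right, inner_sub_right, e1, e2, inner_smul_right, h.inner_s]
    ring
  have e : (q - c • u) - modelStep u u' s A κ D v =
      inner ℝ (u' - u) q • u' + c • (u' - u) := by
    rw [inner_sub_left, huq]
    simp only [modelStep, q, c]
    module
  have hb : (1 + 2 * K * M * ε) * (K * δ) ≤ 3 * K ^ 2 * M * δ := by
    have e1 : K * M * ε ≤ K * M * 1 := by gcongr
    have e2 : 1 ≤ K * M := by nlinarith
    calc _ ≤ (K * M + 2 * (K * M)) * (K * δ) := by gcongr ?_ * (K * δ); linarith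
      _ = _ := by ring
  rw [e]
  calc _ ≤ ‖u' - u‖ * ‖q‖ + |c| * ‖u' - u‖ := by
        refine (norm_add_le _ _).trans ?_
        rw [norm_smul, norm_smul, h.norm_u', mul_one, Real.norm_eq_abs, Real.norm_eq_abs]
        gcongr
        exact abs_real_inner_le_norm _ _
    _ ≤ (M * ε ^ 2) * (3 * K ^ 2 * M * δ) + (3 * K ^ 2 * M * δ) * (M * ε ^ 2) := by
        gcongr
        · exact h1.trans hb
        · exact h2.trans hb
    _ = _ := by ring

/-- The cross term of the square contributes `(D² - x²)⟨s, v⟩`. Its part `-⟨s, v⟩x²` is kept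
exactly, for it cancels against the flip; the part with `D²` is `O(ε)(‖v‖² + δ²)`. Terms carrying
powers of `K` also carry `ε²`, so smallness of `K⁴ε` makes the constant independent of `K`. -/
theorem norm_sq_perpUpdate_le (hK : 1 ≤ K) (hsmall : 10 * K ^ 4 * M * ε ≤ 1) {v : E}
    (hv : ‖v‖ ≤ K * δ) :
    ‖perpUpdate u s A D v‖ ^ 2 ≤ ‖v - inner ℝ u v • u‖ ^ 2 - inner ℝ s v * inner ℝ u v ^ 2 +
      6 * M ^ 2 * ε * (‖v‖ ^ 2 + δ ^ 2) := by
  have hδ := h.δ_nonneg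
  have hσ := h.σ_nonneg
  have hε := h.ε_nonneg
  have hM := h.M_ge
  have hσδ := h.σδ_le
  have hl := h.norm_linear_part_le v
  have hw := h.abs_sq_sub_le hK hv
  have hA := h.norm_A _ (inner_perp_eq_zero h.norm_u v)
  have hp := norm_perp_le h.norm_u v
  have hns := h.norm_s
  have hsp : inner ℝ s (v - inner ℝ u v • u) = inner ℝ s v := by
    rw [inner_sub_right, inner_smul_right, real_inner_comm u s, h.inner_s]; ring
  have hsy : |inner ℝ s v| ≤ σ * ‖v‖ := h.abs_inner_s_le v
  have hD := h.D_nonneg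
  have hDδ := h.D_le
  unfold perpUpdate
  generalize inner ℝ u v = x at *
  generalize v - x • u = p at *
  rw [norm_add_sq_real, inner_smul_right, norm_smul, mul_pow, Real.norm_eq_abs, sq_abs,
    inner_sub_left, real_inner_comm s p, hsp]
  generalize inner ℝ s v = y at *
  have hK4 : 1 ≤ K ^ 4 := one_le_pow₀ hK
  have hKε : K ^ 4 * ε ≤ 1 := by
    have : 0 ≤ K ^ 4 * ε := by positivity
    nlinarith
  have hε1 : ε ≤ 1 := by nlinarith
  have hM2 : M ≤ M ^ 2 := by nlinarith
  have t1 : ‖p - A p‖ ^ 2 ≤ ‖p‖ ^ 2 + 3 * M ^ 2 * ε * ‖v‖ ^ 2 := by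
    have e1 : (1 + M * ε) ^ 2 ≤ 1 + 3 * M ^ 2 * ε := by
      have : M ^ 2 * (ε * ε) ≤ M ^ 2 * (1 * ε) := by gcongr
      have : M * ε ≤ M ^ 2 * ε := by gcongr
      nlinarith
    calc ‖p - A p‖ ^ 2 ≤ ((1 + M * ε) * ‖p‖) ^ 2 := by gcongr
      _ = (1 + M * ε) ^ 2 * ‖p‖ ^ 2 := by ring
      _ ≤ (1 + 3 * M ^ 2 * ε) * ‖p‖ ^ 2 := by gcongr
      _ = ‖p‖ ^ 2 + 3 * M ^ 2 * ε * ‖p‖ ^ 2 := by ring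
      _ ≤ _ := by gcongr
  have t2 : D ^ 2 * y ≤ M ^ 2 * ε * (‖v‖ ^ 2 + δ ^ 2) := by
    calc D ^ 2 * y ≤ D ^ 2 * |y| := by gcongr; exact le_abs_self y
      _ ≤ δ ^ 2 * (σ * ‖v‖) := by gcongr
      _ = (σ * δ) * (δ * ‖v‖) := by ring
      _ ≤ (M * ε) * (‖v‖ ^ 2 + δ ^ 2) := by
          gcongr
          nlinarith [sq_nonneg (δ - ‖v‖), sq_nonneg (δ + ‖v‖)]
      _ ≤ _ := by gcongr
  have t3 : -((D ^ 2 - x ^ 2) * inner ℝ (A p) s) ≤ M ^ 2 * ε * δ ^ 2 := by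
    have e1 : |inner ℝ (A p) s| ≤ (M * ε * ‖v‖) * σ := by
      refine (abs_real_inner_le_norm _ _).trans ?_
      have := h.Mε_nonneg
      gcongr
      exact hA.trans (by gcongr)
    calc _ ≤ |D ^ 2 - x ^ 2| * |inner ℝ (A p) s| := by rw [← abs_mul]; exact neg_le_abs _
      _ ≤ (K * δ) ^ 2 * ((M * ε * (K * δ)) * σ) := by
          gcongr
          exact e1.trans (by gcongr)
      _ = (K ^ 3 * ε) * M * δ ^ 2 * (σ * δ) := by ring
      _ ≤ (K ^ 4 * ε) * M * δ ^ 2 * (M * ε) := by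
          gcongr
          norm_num
      _ ≤ 1 * M * δ ^ 2 * (M * ε) := by gcongr
      _ = _ := by ring
  have t4 : ((D ^ 2 - x ^ 2) / 2) ^ 2 * ‖s‖ ^ 2 ≤ M ^ 2 * ε * δ ^ 2 := by
    have e1 : ((D ^ 2 - x ^ 2) / 2) ^ 2 ≤ ((K * δ) ^ 2) ^ 2 := by
      rw [← sq_abs ((D ^ 2 - x ^ 2) / 2), abs_div, abs_two]
      gcongr
      linarith [abs_nonneg (D ^ 2 - x ^ 2)]
    calc _ ≤ ((K * δ) ^ 2) ^ 2 * σ ^ 2 := by gcongr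
      _ = K ^ 4 * δ ^ 2 * (σ * δ) ^ 2 := by ring
      _ ≤ K ^ 4 * δ ^ 2 * (M * ε) ^ 2 := by gcongr
      _ = (K ^ 4 * ε) * (M ^ 2 * ε * δ ^ 2) := by ring
      _ ≤ 1 * (M ^ 2 * ε * δ ^ 2) := by gcongr
      _ = _ := one_mul _
  have t5 : 0 ≤ M ^ 2 * ε * ‖v‖ ^ 2 := by positivity
  have t6 : 0 ≤ M ^ 2 * ε * δ ^ 2 := by positivity
  linarith

end StepBounds

theorem energy_modelStep_sub {u' : E} (hu' : ‖u'‖ = 1) (u s : E) (A : E →L[ℝ] E) (κ κ' D : ℝ)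
    (v ζ : E) : energy u' κ' (modelStep u u' s A κ D v - ζ) =
      (flipUpdate u s κ v + inner ℝ u' ζ) ^ 2 - κ' / 2 * (flipUpdate u s κ v + inner ℝ u' ζ) ^ 3 +
        2 * (‖perpUpdate u s A D v - inner ℝ u' (perpUpdate u s A D v) • u'‖ ^ 2 -
          2 * inner ℝ (perpUpdate u s A D v - inner ℝ u' (perpUpdate u s A D v) • u') ζ +
            ‖ζ - inner ℝ u' ζ • u'‖ ^ 2) := by
  unfold modelStep
  generalize perpUpdate u s A D v = q
  generalize flipUpdate u s κ v = c
  have hqq := inner_perp_eq_zero hu' q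
  have huu : inner ℝ u' u' = (1 : ℝ) := by rw [real_inner_self_eq_norm_sq, hu']; norm_num
  have e1 : inner ℝ u' ((q - inner ℝ u' q • u') - c • u' - ζ) = -(c + inner ℝ u' ζ) := by
    rw [inner_sub_right, inner_sub_right, hqq, inner_smul_right, huu]; ring
  have e2 : (q - inner ℝ u' q • u') - c • u' - ζ - (-(c + inner ℝ u' ζ)) • u' =
      (q - inner ℝ u' q • u') - (ζ - inner ℝ u' ζ • u') := by module
  have e3 : inner ℝ (q - inner ℝ u' q • u') (ζ - inner ℝ u' ζ • u') =
      inner ℝ (q - inner ℝ u' q • u') ζ := by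
    rw [inner_sub_right, inner_smul_right, real_inner_comm u' (_ - _), hqq]; ring
  unfold energy
  rw [e1, e2, norm_sub_sq_real, e3]
  ring

/-- Squaring `c` produces `κx³`, whereas the cubic correction passes from `+κx³/2` to `-κc³/2` under
the flip `x ↦ -c`; the net cubic term is again `+κx³/2`. Only the gain `2yx²`, a term linear in the
noise `z`, and second-order errors are left. -/
theorem flip_energy_le {x y c z κ κ' σ X τ e : ℝ} (hX : 0 ≤ X) (hσ : 0 ≤ σ) (hx : |x| ≤ X)
    (hz : |z| ≤ X) (hc : c = (1 + y) * x + κ / 2 * x ^ 2) (hc2 : |c| ≤ 2 * X)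
    (hcx : |c - x| ≤ 2 * τ * X) (hσX : σ * X ≤ τ) (hτ : τ ≤ 1) (hκ : |κ| ≤ σ) (hκ' : |κ'| ≤ σ)
    (he : |κ' - κ| ≤ σ * e) (he0 : 0 ≤ e) :
    (c + z) ^ 2 - κ' / 2 * (c + z) ^ 3 ≤ x ^ 2 + κ / 2 * x ^ 3 + 2 * y * x ^ 2 +
      (2 * c - 3 * κ' / 2 * c ^ 2) * z + (11 * τ ^ 2 + 4 * τ * e) * X ^ 2 + 5 * z ^ 2 := by
  have hτ0 : 0 ≤ τ := (mul_nonneg hσ hX).trans hσX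
  have e1 : (c + z) ^ 2 - κ' / 2 * (c + z) ^ 3 = x ^ 2 + κ / 2 * x ^ 3 + 2 * y * x ^ 2 +
      (2 * c - 3 * κ' / 2 * c ^ 2) * z + (c - x) ^ 2 - κ / 2 * ((c - x) * (x ^ 2 + x * c + c ^ 2))
        - (κ' - κ) / 2 * c ^ 3 + z ^ 2 - κ' / 2 * ((3 * c + z) * z ^ 2) := by
    have : (c - x) = y * x + κ / 2 * x ^ 2 := by rw [hc]; ring
    have h2 : (c - x) ^ 2 = c ^ 2 - x ^ 2 - 2 * x * (y * x + κ / 2 * x ^ 2) := by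
      rw [← this]; ring
    rw [h2]; ring
  have f1 : (c - x) ^ 2 ≤ 4 * τ ^ 2 * X ^ 2 := by
    rw [← sq_abs]
    calc |c - x| ^ 2 ≤ (2 * τ * X) ^ 2 := by gcongr
      _ = _ := by ring
  have f2 : -(κ / 2 * ((c - x) * (x ^ 2 + x * c + c ^ 2))) ≤ 7 * τ ^ 2 * X ^ 2 := by
    refine (neg_le_abs _).trans ?_
    rw [abs_mul, abs_mul, abs_div, abs_two]
    have : |x ^ 2 + x * c + c ^ 2| ≤ X ^ 2 + X * (2 * X) + (2 * X) ^ 2 := by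
      refine (abs_add_three _ _ _).trans ?_
      rw [abs_mul, abs_pow, abs_pow]
      gcongr
    calc |κ| / 2 * (|c - x| * |x ^ 2 + x * c + c ^ 2|)
        ≤ σ / 2 * ((2 * τ * X) * (X ^ 2 + X * (2 * X) + (2 * X) ^ 2)) := by gcongr
      _ = (σ * X) * (7 * τ * X ^ 2) := by ring
      _ ≤ τ * (7 * τ * X ^ 2) := by gcongr
      _ = _ := by ring
  have f3 : -((κ' - κ) / 2 * c ^ 3) ≤ 4 * τ * e * X ^ 2 := by
    refine (neg_le_abs _).trans ?_
    rw [abs_mul, abs_div, abs_two, abs_pow]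
    calc |κ' - κ| / 2 * |c| ^ 3 ≤ σ * e / 2 * (2 * X) ^ 3 := by gcongr
      _ = (σ * X) * (4 * e * X ^ 2) := by ring
      _ ≤ τ * (4 * e * X ^ 2) := by gcongr
      _ = _ := by ring
  have f4 : -(κ' / 2 * ((3 * c + z) * z ^ 2)) ≤ 4 * z ^ 2 := by
    refine (neg_le_abs _).trans ?_
    rw [abs_mul, abs_mul, abs_div, abs_two, abs_of_nonneg (sq_nonneg z)]
    have : |3 * c + z| ≤ 7 * X := by
      refine (abs_add_le _ _).trans ?_
      rw [abs_mul, abs_of_pos (by norm_num : (0 : ℝ) < 3)]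
      linarith
    calc |κ'| / 2 * (|3 * c + z| * z ^ 2) ≤ σ / 2 * (7 * X * z ^ 2) := by gcongr
      _ = (σ * X) * (7 / 2 * z ^ 2) := by ring
      _ ≤ 1 * (7 / 2 * z ^ 2) := by gcongr; linarith
      _ ≤ _ := by linarith [sq_nonneg z]
  rw [e1]
  linarith

namespace StepBounds

variable {u u' s : E} {A : E →L[ℝ] E} {κ κ' D σ δ ε M K : ℝ}
  (h : StepBounds u u' s A κ κ' D σ δ ε M)
include h

theorem small_facts (hK : 1 ≤ K) (hsmall : 10 * K ^ 4 * M * ε ≤ 1) :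
    10 * (K * (M * ε)) ≤ 1 ∧ K ^ 4 * ε ≤ 1 ∧ ε ≤ 1 := by
  have hε := h.ε_nonneg
  have hM := h.M_ge
  have hK4 : 1 ≤ K ^ 4 := one_le_pow₀ hK
  have hKε : K ^ 4 * ε ≤ 1 := by
    have : 0 ≤ K ^ 4 * ε := by positivity
    nlinarith
  have hKK : K ≤ K ^ 4 := by
    calc K = K ^ 1 := (pow_one K).symm
      _ ≤ _ := pow_le_pow_right₀ hK (by norm_num)
  refine ⟨?_, hKε, by nlinarith⟩
  calc 10 * (K * (M * ε)) ≤ 10 * (K ^ 4 * (M * ε)) := by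
        have := h.Mε_nonneg
        gcongr
    _ ≤ 1 := by linarith

theorem norm_perpUpdate_le_two (hK : 1 ≤ K) (hsmall : 10 * K ^ 4 * M * ε ≤ 1) {v : E}
    (hv : ‖v‖ ≤ K * δ) : ‖perpUpdate u s A D v‖ ≤ 2 * (K * δ) := by
  have := (h.small_facts hK hsmall).1
  have hδ := h.δ_nonneg
  refine (h.norm_perpUpdate_le hK hv).trans ?_
  gcongr
  linarith

theorem abs_flipUpdate_le_two (hK : 1 ≤ K) (hsmall : 10 * K ^ 4 * M * ε ≤ 1) {v : E}
    (hv : ‖v‖ ≤ K * δ) : |flipUpdate u s κ v| ≤ 2 * (K * δ) := by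
  have := (h.small_facts hK hsmall).1
  have hδ := h.δ_nonneg
  refine (h.abs_flipUpdate_le hK hv).trans ?_
  gcongr
  linarith

theorem norm_modelStep_le (hK : 1 ≤ K) (hsmall : 10 * K ^ 4 * M * ε ≤ 1) {v : E}
    (hv : ‖v‖ ≤ K * δ) : ‖modelStep u u' s A κ D v‖ ≤ 4 * (K * δ) := by
  have h1 := h.norm_perpUpdate_le_two hK hsmall hv
  have h2 := h.abs_flipUpdate_le_two hK hsmall hv
  refine (norm_sub_le _ _).trans ?_
  rw [norm_smul, h.norm_u', mul_one, Real.norm_eq_abs]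
  linarith [(norm_perp_le h.norm_u' (perpUpdate u s A D v))]

/-- The coefficient of the noise in the energy after a predicted step. -/
def _root_.SGDCoupling.energyGradient (u u' s : E) (A : E →L[ℝ] E) (κ κ' D : ℝ) (v : E) : E :=
  (2 * flipUpdate u s κ v - 3 * κ' / 2 * flipUpdate u s κ v ^ 2) • u' -
    (4 : ℝ) • (perpUpdate u s A D v - inner ℝ u' (perpUpdate u s A D v) • u')

theorem norm_energyGradient_le (hK : 1 ≤ K) (hsmall : 10 * K ^ 4 * M * ε ≤ 1) {v : E}
    (hv : ‖v‖ ≤ K * δ) : ‖energyGradient u u' s A κ κ' D v‖ ≤ 13 * (K * δ) := by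
  have h1 := h.norm_perpUpdate_le_two hK hsmall hv
  have h2 := h.abs_flipUpdate_le_two hK hsmall hv
  have h3 := (norm_perp_le h.norm_u' (perpUpdate u s A D v)).trans h1
  have h4 := (h.small_facts hK hsmall).1
  have h5 := h.σ_mul_le hK
  have hδ := h.δ_nonneg
  have hσ := h.σ_nonneg
  unfold energyGradient
  refine (norm_sub_le _ _).trans ?_
  rw [norm_smul, norm_smul, h.norm_u', mul_one, Real.norm_eq_abs, Real.norm_eq_abs,
    abs_of_pos (by norm_num : (0 : ℝ) < 4)]
  have h6 : |3 * κ' / 2 * flipUpdate u s κ v ^ 2| ≤ K * δ := by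
    rw [abs_mul, abs_div, abs_mul, abs_two, abs_of_pos (by norm_num : (0 : ℝ) < 3), abs_pow]
    calc 3 * |κ'| / 2 * |flipUpdate u s κ v| ^ 2 ≤ 3 * σ / 2 * (2 * (K * δ)) ^ 2 := by
          gcongr; exact h.abs_κ'
      _ = 6 * (σ * (K * δ)) * (K * δ) := by ring
      _ ≤ 1 * (K * δ) := by gcongr; linarith
      _ = _ := one_mul _
  have h7 := abs_sub (2 * flipUpdate u s κ v) (3 * κ' / 2 * flipUpdate u s κ v ^ 2)
  rw [abs_mul, abs_two] at h7
  linarith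

/-- The weight `2` on the orthogonal part is what makes its loss `-2⟨s, v⟩x²` cancel the gain of
`flip_energy_le`. The growth constant does not involve `K`, which is why `K` may be fixed
afterwards. -/
theorem energy_step_le (hK : 1 ≤ K) (hsmall : 10 * K ^ 4 * M * ε ≤ 1) {v ζ : E}
    (hv : ‖v‖ ≤ K * δ) (hζ : ‖ζ‖ ≤ K * δ) :
    energy u' κ' (modelStep u u' s A κ D v - ζ) ≤ (1 + 30 * M ^ 2 * ε) * energy u κ v +
      30 * M ^ 2 * ε * δ ^ 2 + inner ℝ (energyGradient u u' s A κ κ' D v) ζ + 7 * ‖ζ‖ ^ 2 := by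
  obtain ⟨hs1, hs2, hs3⟩ := h.small_facts hK hsmall
  have hδ := h.δ_nonneg
  have hε := h.ε_nonneg
  have hM := h.M_ge
  have hu' := h.norm_u'
  have hKδ : 0 ≤ K * δ := by positivity
  have hMε := h.Mε_nonneg
  have hx := (abs_inner_unit_le h.norm_u v).trans hv
  have hcx : |flipUpdate u s κ v - inner ℝ u v| ≤ 2 * (K * (M * ε)) * (K * δ) := by
    refine (h.abs_flipUpdate_sub_le hK hv).trans ?_
    calc 2 * K * M * ε * |inner ℝ u v| = 2 * (K * (M * ε)) * |inner ℝ u v| := by ring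
      _ ≤ _ := by gcongr
  have hflip := flip_energy_le (c := flipUpdate u s κ v) (y := inner ℝ s v) (z := inner ℝ u' ζ) hKδ
    h.σ_nonneg hx
    ((abs_inner_unit_le hu' ζ).trans hζ) rfl (h.abs_flipUpdate_le_two hK hsmall hv) hcx
    (h.σ_mul_le hK) (by linarith) h.abs_κ h.abs_κ' h.abs_κ_sub (by positivity)
  have hperp := h.norm_sq_perpUpdate_le hK hsmall hv
  have hlow : 1 / 2 * ‖v‖ ^ 2 ≤ energy u κ v := by
    refine half_norm_sq_le_energy h.norm_u h.abs_κ ?_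
    calc σ * ‖v‖ ≤ σ * (K * δ) := mul_le_mul_of_nonneg_left hv h.σ_nonneg
      _ ≤ _ := h.σ_mul_le hK
      _ ≤ 1 := by linarith
  have hzz : inner ℝ u' ζ ^ 2 ≤ ‖ζ‖ ^ 2 := by
    rw [← sq_abs]; gcongr; exact abs_inner_unit_le hu' ζ
  have hpz : ‖ζ - inner ℝ u' ζ • u'‖ ^ 2 ≤ ‖ζ‖ ^ 2 := by gcongr; exact norm_perp_le hu' ζ
  have hq := norm_perp_le hu' (perpUpdate u s A D v)
  have hen : energy u κ v = inner ℝ u v ^ 2 + κ / 2 * inner ℝ u v ^ 3 +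
    2 * ‖v - inner ℝ u v • u‖ ^ 2 := rfl
  -- These errors are of order `K⁴ε²δ²`; one factor `ε` absorbs `K⁴`.
  have herr : (11 * (K * (M * ε)) ^ 2 + 4 * (K * (M * ε)) * (M * ε ^ 2)) * (K * δ) ^ 2 ≤
      15 * (M ^ 2 * ε * δ ^ 2) := by
    have e1 : (K * (M * ε)) ^ 2 * (K * δ) ^ 2 = (K ^ 4 * ε) * (M ^ 2 * ε * δ ^ 2) := by ring
    have e2 : (K * (M * ε)) * (M * ε ^ 2) * (K * δ) ^ 2 ≤ (K ^ 4 * ε) * (M ^ 2 * ε * δ ^ 2) := by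
      calc (K * (M * ε)) * (M * ε ^ 2) * (K * δ) ^ 2 =
            (K ^ 3 * ε) * (M ^ 2 * ε * δ ^ 2) * ε := by ring
        _ ≤ (K ^ 4 * ε) * (M ^ 2 * ε * δ ^ 2) * 1 := by
          gcongr
          norm_num
        _ = _ := mul_one _
    have e3 : (K ^ 4 * ε) * (M ^ 2 * ε * δ ^ 2) ≤ 1 * (M ^ 2 * ε * δ ^ 2) := by gcongr
    nlinarith
  have e := energy_modelStep_sub hu' u s A κ κ' D v ζ
  have egr : inner ℝ (energyGradient u u' s A κ κ' D v) ζ =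
      (2 * flipUpdate u s κ v - 3 * κ' / 2 * flipUpdate u s κ v ^ 2) * inner ℝ u' ζ -
        4 * inner ℝ (perpUpdate u s A D v - inner ℝ u' (perpUpdate u s A D v) • u') ζ := by
    unfold energyGradient
    rw [inner_sub_left, real_inner_smul_left, real_inner_smul_left]
  have hq2 : ‖perpUpdate u s A D v - inner ℝ u' (perpUpdate u s A D v) • u'‖ ^ 2 ≤
      ‖perpUpdate u s A D v‖ ^ 2 := by gcongr
  have hg : 0 ≤ M ^ 2 * ε := by positivity
  have hlow2 : M ^ 2 * ε * (1 / 2 * ‖v‖ ^ 2) ≤ M ^ 2 * ε * energy u κ v := by gcongr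
  have hgδ : 0 ≤ M ^ 2 * ε * δ ^ 2 := by positivity
  have hgE : 0 ≤ M ^ 2 * ε * energy u κ v := le_trans (by positivity) hlow2
  rw [e, egr]
  linarith

end StepBounds

end PredictedStep

/-! ### Comparison of a gradient step with the predicted step -/

section Coupling

variable {d : ℕ}

theorem predStep_eq_modelStep (L : Vec d → ℝ) (u : Vec d → Vec d) (η : ℝ) (p q v : Vec d) :
    predStep L u η p q v = modelStep (u p) (u q) (η • gradSperp L u p) (η • hess L p)
      (η * kappa L u p) (deltaAt L u p) v := by
  simp only [predStep, modelStep, perpUpdate, flipUpdate, perp, _root_.smul_apply,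
    real_inner_smul_left, smul_smul, mul_comm η (_ / 2)]
  congr 3
  ring

namespace EdgeTrajectory

variable {L : Vec d → ℝ} {u : Vec d → Vec d} {N : Set (Vec d)} {η ρ C ε δ K : ℝ} {T : ℕ}
  {θc : ℕ → Vec d} (h : EdgeTrajectory L u N η ρ C ε T θc)
include h

theorem stepBounds (hδ : ∀ t ≤ T, deltaAt L u (θc t) ≤ δ) (hσδ : η * ρ * δ ≤ 2 * C * ε)
    {t : ℕ} (ht : t < T) :
    StepBounds (u (θc t)) (u (θc (t + 1))) (η • gradSperp L u (θc t)) (η • hess L (θc t))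
      (η * kappa L u (θc t)) (η * kappa L u (θc (t + 1))) (deltaAt L u (θc t)) (η * ρ) δ ε
      (20 * C ^ 2) := by
  obtain ⟨s, -, hp⟩ := h.exists_edgePoint t ht.le
  obtain ⟨s', -, hp'⟩ := h.exists_edgePoint (t + 1) ht
  have hη := h.η_pos
  have hC := h.C_ge
  have hε := h.ε_nonneg
  have hC2 : 8 * C ≤ C ^ 2 := by nlinarith
  refine ⟨hp.norm_u, hp'.norm_u, ?_, ?_, ?_, ?_, ?_, ?_, ?_, ?_, Real.sqrt_nonneg _,
    hδ t ht.le, ?_, hε, by nlinarith⟩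
  · refine (h.norm_u_sub_le ht).trans ?_
    gcongr ?_ * ε ^ 2
    linarith
  · rw [inner_smul_right, hp.inner_gradSperp, mul_zero]
  · rw [norm_smul, Real.norm_of_nonneg hη.le]; exact hp.norm_gradSperp_le
  · rw [abs_mul, abs_of_pos hη]; exact hp.abs_kappa_le
  · rw [abs_mul, abs_of_pos hη]; exact hp'.abs_kappa_le
  · rw [← mul_sub, abs_mul, abs_of_pos hη]; exact h.abs_kappa_sub_le ht
  · intro p hpu
    rw [_root_.smul_apply, inner_smul_right, hp.inner_u_hess, hpu]; ring
  · intro p hpu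
    rw [_root_.smul_apply, norm_smul, Real.norm_of_nonneg hη.le]
    refine (hp.norm_hess_perp_le hpu).trans ?_
    gcongr ?_ * ‖p‖
    have : 8 * C * ε ≤ C ^ 2 * ε := by gcongr
    linarith [mul_nonneg hp.C_pos.le hε]
  · refine hσδ.trans ?_
    gcongr ?_ * ε
    linarith

/-- The `u`-component of `∇³L(u, p)` is `⟨∇S^⊥, p⟩` by symmetry and `gradS_eq`. For the remaining
part `e`, symmetry gives `‖e‖² = ⟨u, ∇³L(p, e)⟩`, to which the non-worst-case bound applies because
`p` and `e` are both orthogonal to `u`. -/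
theorem norm_third_u_perp_le {t : ℕ} (ht : t ≤ T) {s : ℝ}
    (hp : EdgePoint L u N η ρ C (C * ε) s (θc t)) {p : Vec d} (hpu : inner ℝ (u (θc t)) p = 0) :
    ‖third L (θc t) (u (θc t)) p - inner ℝ (gradSperp L u (θc t)) p • u (θc t)‖ ≤
      C * ε * (ρ * ‖p‖) := by
  obtain ⟨Q, hQ⟩ : ∃ Q, Q = third L (θc t) (u (θc t)) p := ⟨_, rfl⟩
  have h1 : inner ℝ (u (θc t)) Q = inner ℝ (gradSperp L u (θc t)) p := by
    rw [hQ, real_inner_comm, hp.reg.third_symm hp.mem, ← hp.gradS_eq, real_inner_comm,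
      inner_gradS_eq L u, hpu]
    ring
  rw [← h1, ← hQ]
  obtain ⟨e, he⟩ : ∃ e, e = Q - inner ℝ (u (θc t)) Q • u (θc t) := ⟨_, rfl⟩
  have h2 : inner ℝ (u (θc t)) e = 0 := he ▸ inner_perp_eq_zero hp.norm_u Q
  have h3 : ‖e‖ ^ 2 = inner ℝ (u (θc t)) (third L (θc t) p e) := by
    rw [← hp.reg.third_symm hp.mem, hp.reg.third_comm hp.mem p, ← hQ,
      ← real_inner_self_eq_norm_sq]
    nth_rewrite 1 [he]
    rw [inner_sub_left, real_inner_smul_left, h2]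
    ring
  have h4 := (le_abs_self _).trans (abs_inner_unit_le hp.norm_u (third L (θc t) p e))
  have h5 := h.third_perp t ht p e hpu h2
  rw [← h3] at h4
  rw [← he]
  rcases (norm_nonneg e).eq_or_lt with h0 | h0
  · rw [← h0]
    have := h.ρ_pos
    have := h.ε_nonneg
    have := hp.C_pos
    positivity
  · refine le_of_mul_le_mul_right ?_ h0
    nlinarith

theorem C_mul_small (hK : 1 ≤ K) (hσδ : η * ρ * δ ≤ 2 * C * ε)
    (hsmall : 200 * K ^ 4 * C ^ 2 * ε ≤ 1) {v : Vec d} (hv : ‖v‖ ≤ K * δ) :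
    η * ρ * ‖v‖ ≤ 2 * C * K * ε ∧ C * (η * ρ * ‖v‖) < 1 := by
  have hC := h.C_ge
  have hη := h.η_pos
  have hρ := h.ρ_pos
  have hε := h.ε_nonneg
  have h1 : η * ρ * ‖v‖ ≤ 2 * C * K * ε := by
    calc η * ρ * ‖v‖ ≤ η * ρ * (K * δ) := by gcongr
      _ = K * (η * ρ * δ) := by ring
      _ ≤ K * (2 * C * ε) := by gcongr
      _ = _ := by ring
  refine ⟨h1, ?_⟩
  have hKK : K ≤ K ^ 4 := by
    calc K = K ^ 1 := (pow_one K).symm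
      _ ≤ _ := pow_le_pow_right₀ hK (by norm_num)
  calc C * (η * ρ * ‖v‖) ≤ C * (2 * C * K * ε) := by gcongr
    _ = 2 * K * C ^ 2 * ε := by ring
    _ ≤ 2 * K ^ 4 * C ^ 2 * ε := by gcongr
    _ < 1 := by linarith

/-- Up to `O(ε² δ)`, a gradient step relative to the constrained trajectory is the predicted one. -/
theorem norm_step_sub_predStep_le (hδ : ∀ t ≤ T, deltaAt L u (θc t) ≤ δ)
    (hσδ : η * ρ * δ ≤ 2 * C * ε) (hεδ : ε ≤ η * ρ * δ) (hK : 1 ≤ K)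
    (hsmall : 200 * K ^ 4 * C ^ 2 * ε ≤ 1) {t : ℕ} (ht : t < T) {v : Vec d} (hv : ‖v‖ ≤ K * δ) :
    ‖(v - η • (gradient L (θc t + v) - gradient L (θc t)) +
        (θc t - η • gradient L (θc t) - θc (t + 1))) -
      predStep L u η (θc t) (θc (t + 1)) v‖ ≤ 4000 * C ^ 4 * K ^ 3 * (ε ^ 2 * δ) := by
  obtain ⟨s, hs, hp⟩ := h.exists_edgePoint t ht.le
  have hsb := h.stepBounds hδ hσδ ht
  have hC := h.C_ge
  have hC0 : 0 < C := hp.C_pos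
  have hη := h.η_pos
  have hρ := h.ρ_pos
  have hσ := hp.σ_pos
  have hε := h.ε_nonneg
  have hε1 := h.ε_le_one.2
  have hδ0 := hsb.δ_nonneg
  obtain ⟨hv1, hv2⟩ := h.C_mul_small hK hσδ hsmall hv
  have hT := hp.reg.norm_gradient_taylor_two_le hp.ball_subset hp.ρ₄_nonneg (hp.mem_ball_iff.2 hv2)
  have hr := (h.step_bounds ht).2
  have hframe := hsb.norm_modelStep_sub_le hK hv hε1
  rw [predStep_eq_modelStep]
  generalize modelStep (u (θc t)) (u (θc (t + 1))) (η • gradSperp L u (θc t)) (η • hess L (θc t))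
      (η * kappa L u (θc t)) (deltaAt L u (θc t)) v = W at *
  generalize θc t - η • gradient L (θc t) - θc (t + 1) = r at *
  obtain ⟨x, hx⟩ : ∃ x, x = inner ℝ (u (θc t)) v := ⟨_, rfl⟩
  obtain ⟨p, hpd⟩ : ∃ p, p = v - x • u (θc t) := ⟨_, rfl⟩
  have hpu : inner ℝ (u (θc t)) p = 0 := by rw [hpd, hx]; exact inner_perp_eq_zero hp.norm_u v
  have hpn : ‖p‖ ≤ K * δ := by
    rw [hpd, hx]; exact (norm_perp_le hp.norm_u v).trans hv
  have hxn : |x| ≤ K * δ := by rw [hx]; exact (abs_inner_unit_le hp.norm_u v).trans hv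
  have he := h.norm_third_u_perp_le ht.le hp hpu
  have hpp := h.third_perp t ht.le p p hpu hpu
  have hspv : inner ℝ (gradSperp L u (θc t)) p = inner ℝ (gradSperp L u (θc t)) v := by
    rw [hpd, inner_sub_right, inner_smul_right, hp.inner_gradSperp_u]; ring
  rw [hspv] at he
  have hvd : v = x • u (θc t) + p := by rw [hpd]; abel
  have hHv : hess L (θc t) v = (x * sharpness L (θc t)) • u (θc t) + hess L (θc t) p := by
    conv_lhs => rw [hvd]
    rw [map_add, map_smul, hp.topPair.apply_w, smul_smul]
  have hQuu : third L (θc t) (u (θc t)) (u (θc t)) =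
      gradSperp L u (θc t) + kappa L u (θc t) • u (θc t) := by
    rw [← hp.gradS_eq, gradSperp, perp, kappa, real_inner_comm]; abel
  have hQvv : third L (θc t) v v = x ^ 2 • (gradSperp L u (θc t) + kappa L u (θc t) • u (θc t)) +
      (2 * x) • third L (θc t) (u (θc t)) p + third L (θc t) p p := by
    conv_lhs => rw [hvd]
    simp only [map_add, map_smul, _root_.add_apply, _root_.smul_apply]
    rw [hp.reg.third_comm hp.mem p (u (θc t)), hQuu]
    module
  have hD : deltaAt L u (θc t) ^ 2 = 2 * (alpha L (θc t) / beta L u (θc t)) := by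
    rw [deltaAt, Real.sq_sqrt]
    · ring
    · have := h.alpha_nonneg t ht.le
      have : 0 ≤ beta L u (θc t) := sq_nonneg _
      positivity
  have hq : perpUpdate (u (θc t)) (η • gradSperp L u (θc t)) (η • hess L (θc t))
      (deltaAt L u (θc t)) v = (p - η • hess L (θc t) p) +
        ((2 * (alpha L (θc t) / beta L u (θc t)) - x ^ 2) / 2 * η) • gradSperp L u (θc t) := by
    rw [perpUpdate, ← hx, ← hpd, hD, smul_smul, _root_.smul_apply]
  have hc : flipUpdate (u (θc t)) (η • gradSperp L u (θc t)) (η * kappa L u (θc t)) v =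
      (1 + η * inner ℝ (gradSperp L u (θc t)) v) * x + η * kappa L u (θc t) / 2 * x ^ 2 := by
    rw [flipUpdate, ← hx, real_inner_smul_left]
  rw [hq, hc] at hframe
  have hs0 := hp.s_nonneg
  have hsS : s = 2 - η * sharpness L (θc t) := by rw [hp.sharp]; ring
  obtain ⟨G, hG⟩ : ∃ G, G = gradient L (θc t + v) - gradient L (θc t) - hess L (θc t) v -
    (1 / 2 : ℝ) • third L (θc t) v v := ⟨_, rfl⟩
  rw [← hG] at hT
  have hgrad : gradient L (θc t + v) - gradient L (θc t) = G + hess L (θc t) v +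
    (1 / 2 : ℝ) • third L (θc t) v v := by rw [hG]; abel
  rw [hgrad, hHv, hQvv]
  have hun := hp.norm_u
  generalize third L (θc t) (u (θc t)) p = Qup at *
  generalize third L (θc t) p p = Qpp at *
  generalize hess L (θc t) p = Hp at *
  generalize inner ℝ (gradSperp L u (θc t)) v = y at *
  generalize alpha L (θc t) / beta L u (θc t) = ab at *
  generalize gradSperp L u (θc t) = sp at *
  generalize kappa L u (θc t) = κ at *
  generalize u (θc t) = z at *
  generalize sharpness L (θc t) = S at *
  -- The six error sources: Taylor remainder, projection correction, sharpness defect `s`, mixed and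
  -- purely orthogonal third derivatives, and the change of frame.
  have key : (v - η • (G + ((x * S) • z + Hp) +
      (1 / 2 : ℝ) • (x ^ 2 • (sp + κ • z) + (2 * x) • Qup + Qpp)) + r) - W =
      -(η • G) + (r - (η * ab) • sp) + (s * x) • z - (η * x) • (Qup - y • z) -
        (η / 2) • Qpp + (((p - η • Hp) + ((2 * ab - x ^ 2) / 2 * η) • sp -
          ((1 + η * y) * x + η * κ / 2 * x ^ 2) • z) - W) := by
    rw [hvd, hsS]
    module
  rw [key]
  have b1 : ‖-(η • G)‖ ≤ 4 * C ^ 3 * K ^ 3 * (ε ^ 2 * δ) := by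
    rw [norm_neg, norm_smul, Real.norm_of_nonneg hη.le]
    calc η * ‖G‖ ≤ η * (C * (η * ρ ^ 2) * ‖v‖ ^ 3) := by gcongr
      _ = C * (η * ρ * ‖v‖) ^ 2 * ‖v‖ := by ring
      _ ≤ C * (2 * C * K * ε) ^ 2 * (K * δ) := by gcongr
      _ = _ := by ring
  -- The bound on the correction is available after multiplication by `σ`; `ε ≤ σδ` converts `ε³/σ`
  -- into `ε²δ`.
  have b2 : ‖r - (η * ab) • sp‖ ≤ 450 * C ^ 4 * (ε ^ 2 * δ) := by
    refine le_of_mul_le_mul_left ?_ hσ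
    calc _ ≤ 450 * C ^ 4 * ε ^ 3 := hr
      _ = 450 * C ^ 4 * ε ^ 2 * ε := by ring
      _ ≤ 450 * C ^ 4 * ε ^ 2 * (η * ρ * δ) := by gcongr
      _ = _ := by ring
  have b3 : ‖(s * x) • z‖ ≤ 150 * C ^ 3 * K * (ε ^ 2 * δ) := by
    rw [norm_smul, hun, mul_one, Real.norm_eq_abs, abs_mul, abs_of_nonneg hs0]
    calc s * |x| ≤ 150 * C ^ 3 * ε ^ 3 * (K * δ) := by gcongr
      _ = 150 * C ^ 3 * K * (ε ^ 2 * δ) * ε := by ring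
      _ ≤ 150 * C ^ 3 * K * (ε ^ 2 * δ) * 1 := by gcongr
      _ = _ := mul_one _
  have hσp : η * ρ * ‖p‖ ≤ 2 * C * K * ε := (h.C_mul_small hK hσδ hsmall hpn).1
  have b4 : ‖(η * x) • (Qup - y • z)‖ ≤ 2 * C ^ 2 * K ^ 2 * (ε ^ 2 * δ) := by
    rw [norm_smul, Real.norm_eq_abs, abs_mul, abs_of_pos hη]
    calc η * |x| * ‖Qup - y • z‖ ≤ η * |x| * (C * ε * (ρ * ‖p‖)) := by gcongr
      _ = |x| * (C * ε * (η * ρ * ‖p‖)) := by ring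
      _ ≤ (K * δ) * (C * ε * (2 * C * K * ε)) := by gcongr
      _ = _ := by ring
  have b5 : ‖(η / 2) • Qpp‖ ≤ 2 * C ^ 2 * K ^ 2 * (ε ^ 2 * δ) := by
    rw [norm_smul, Real.norm_of_nonneg (by positivity)]
    calc η / 2 * ‖Qpp‖ ≤ η * (C * ε * (ρ * ‖p‖ * ‖p‖)) := by gcongr; linarith
      _ = C * ε * (η * ρ * ‖p‖) * ‖p‖ := by ring
      _ ≤ C * ε * (2 * C * K * ε) * (K * δ) := by gcongr
      _ = _ := by ring
  have b6 : 6 * K ^ 2 * (20 * C ^ 2) ^ 2 * (ε ^ 2 * δ) = 2400 * C ^ 4 * K ^ 2 * (ε ^ 2 * δ) := by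
    ring
  rw [b6] at hframe
  have hu0 : 0 ≤ ε ^ 2 * δ := by positivity
  generalize ε ^ 2 * δ = U at *
  have hC1 : 1 ≤ C := by linarith
  have p34 : C ^ 3 ≤ C ^ 4 := pow_le_pow_right₀ hC1 (by norm_num)
  have p24 : C ^ 2 ≤ C ^ 4 := pow_le_pow_right₀ hC1 (by norm_num)
  have k13 : K ≤ K ^ 3 := by
    calc K = K ^ 1 := (pow_one K).symm
      _ ≤ _ := pow_le_pow_right₀ hK (by norm_num)
  have k23 : K ^ 2 ≤ K ^ 3 := pow_le_pow_right₀ hK (by norm_num)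
  have k03 : 1 ≤ K ^ 3 := one_le_pow₀ hK
  have c1 : 4 * C ^ 3 * K ^ 3 * U ≤ 4 * C ^ 4 * K ^ 3 * U := by gcongr
  have c2 : 450 * C ^ 4 * U ≤ 450 * C ^ 4 * K ^ 3 * U := by
    gcongr ?_ * U; exact le_mul_of_one_le_right (by positivity) k03
  have c3 : 150 * C ^ 3 * K * U ≤ 150 * C ^ 4 * K ^ 3 * U := by gcongr
  have c4 : 2 * C ^ 2 * K ^ 2 * U ≤ 2 * C ^ 4 * K ^ 3 * U := by gcongr
  have c6 : 2400 * C ^ 4 * K ^ 2 * U ≤ 2400 * C ^ 4 * K ^ 3 * U := by gcongr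
  have c7 : 0 ≤ C ^ 4 * K ^ 3 * U := by positivity
  refine (norm_add_le _ _).trans ?_
  refine (add_le_add_left ((norm_sub_le _ _).trans (add_le_add_left ((norm_sub_le _ _).trans
    (add_le_add_left ((norm_add_le _ _).trans (add_le_add_left (norm_add_le _ _) _)) _)) _))
      _).trans ?_
  linarith

/-- At the edge the quadratic form along `u` is `Sx²/2 ≈ x²/η`. The gradient term is small because
`η‖∇L‖ = O(εδ)`, the orthogonal Hessian by the non-worst-case bound, and replacing `v` by `w` costs
the coupling error times `δ`. -/
theorem abs_loss_sub_le (hσδ : η * ρ * δ ≤ 2 * C * ε) (hεδ : ε ≤ η * ρ * δ) (hδ0 : 0 ≤ δ)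
    (hK : 1 ≤ K) (hsmall : 200 * K ^ 4 * C ^ 2 * ε ≤ 1) {t : ℕ} (ht : t ≤ T) {v w : Vec d}
    (hv : ‖v‖ ≤ K * δ) (hw : ‖w‖ ≤ K * δ) {J : ℝ} (hvw : ‖v - w‖ ≤ J * (ε * δ)) :
    |L (θc t + v) - (L (θc t) + 1 / η * inner ℝ (u (θc t)) w ^ 2)| ≤
      (100 * C ^ 3 * K ^ 3 + 2 * K * J) * (ε * δ ^ 2 / η) := by
  obtain ⟨s, hs, hp⟩ := h.exists_edgePoint t ht
  have hC := h.C_ge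
  have hC0 : 0 < C := hp.C_pos
  have hη := h.η_pos
  have hρ := h.ρ_pos
  have hσ := hp.σ_pos
  have hε := h.ε_nonneg
  have hε1 := h.ε_le_one.2
  obtain ⟨hv1, hv2⟩ := h.C_mul_small hK hσδ hsmall hv
  have hT := hp.reg.abs_taylor_le hp.ball_subset (hp.mem_ball_iff.2 hv2)
  have hd := hp.gapAt.inner_apply_decomp v
  have hxv := (abs_inner_unit_le hp.norm_u v).trans hv
  have hxw := (abs_inner_unit_le hp.norm_u w).trans hw
  have hxvw := (abs_inner_unit_le hp.norm_u (v - w)).trans hvw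
  rw [inner_sub_right] at hxvw
  have hpu := inner_perp_eq_zero hp.norm_u v
  have hpn := (norm_perp_le hp.norm_u v).trans hv
  have hH := hp.norm_hess_perp_le hpu
  have hg := h.grad_le t ht
  have ha : η * ‖gradient L (θc t)‖ ≤ C * (ε * δ) := by
    refine le_of_mul_le_mul_left ?_ hσ
    calc _ ≤ C * ε ^ 2 := hg
      _ = C * ε * ε := by ring
      _ ≤ C * ε * (η * ρ * δ) := by gcongr
      _ = _ := by ring
  have hgv := abs_real_inner_le_norm (gradient L (θc t)) v
  have hHp := abs_real_inner_le_norm (v - inner ℝ (u (θc t)) v • u (θc t))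
    (hess L (θc t) (v - inner ℝ (u (θc t)) v • u (θc t)))
  have hsh := hp.sharp
  have hs0 := hp.s_nonneg
  generalize inner ℝ (u (θc t)) v = x at *
  generalize inner ℝ (u (θc t)) w = x' at *
  generalize v - x • u (θc t) = p at *
  generalize hess L (θc t) p = Hp at *
  generalize inner ℝ v (hess L (θc t) v) = F at *
  generalize sharpness L (θc t) = S at *
  generalize inner ℝ (gradient L (θc t)) v = g at *
  have e : η * (L (θc t + v) - (L (θc t) + 1 / η * x' ^ 2)) =
      η * (L (θc t + v) - L (θc t) - g - 1 / 2 * F) + η * g + (-(s * x ^ 2) / 2) +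
        1 / 2 * (η * inner ℝ p Hp) + (x - x') * (x + x') := by
    have : η * S * x ^ 2 = (2 - s) * x ^ 2 := by rw [hsh]
    rw [hd]
    field_simp
    linarith
  have hU : 0 ≤ ε * δ ^ 2 := by positivity
  have b1 : |η * (L (θc t + v) - L (θc t) - g - 1 / 2 * F)| ≤ 2 * C * K ^ 3 * (ε * δ ^ 2) := by
    rw [abs_mul, abs_of_pos hη]
    calc _ ≤ η * (ρ * ‖v‖ ^ 3) := by gcongr
      _ = (η * ρ * ‖v‖) * ‖v‖ ^ 2 := by ring
      _ ≤ (2 * C * K * ε) * (K * δ) ^ 2 := by gcongr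
      _ = _ := by ring
  have b2 : |η * g| ≤ C * K * (ε * δ ^ 2) := by
    rw [abs_mul, abs_of_pos hη]
    calc η * |g| ≤ η * (‖gradient L (θc t)‖ * ‖v‖) := by gcongr
      _ = (η * ‖gradient L (θc t)‖) * ‖v‖ := by ring
      _ ≤ (C * (ε * δ)) * (K * δ) := by gcongr
      _ = _ := by ring
  have b3 : |(-(s * x ^ 2) / 2)| ≤ 75 * C ^ 3 * K ^ 2 * (ε * δ ^ 2) := by
    rw [abs_div, abs_neg, abs_mul, abs_two, abs_of_nonneg hs0, abs_pow]
    calc s * |x| ^ 2 / 2 ≤ 150 * C ^ 3 * ε ^ 3 * (K * δ) ^ 2 / 2 := by gcongr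
      _ = 75 * C ^ 3 * K ^ 2 * (ε * δ ^ 2) * (ε * ε) := by ring
      _ ≤ 75 * C ^ 3 * K ^ 2 * (ε * δ ^ 2) * (1 * 1) := by gcongr
      _ = _ := by ring
  have b4 : |1 / 2 * (η * inner ℝ p Hp)| ≤ C * K ^ 2 * (ε * δ ^ 2) := by
    rw [abs_mul, abs_mul, abs_of_pos hη, abs_of_pos (by norm_num : (0 : ℝ) < 1 / 2)]
    calc 1 / 2 * (η * |inner ℝ p Hp|) ≤ 1 / 2 * (η * (‖p‖ * ‖Hp‖)) := by gcongr
      _ = 1 / 2 * (‖p‖ * (η * ‖Hp‖)) := by ring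
      _ ≤ 1 / 2 * (‖p‖ * (2 * (C * ε) * ‖p‖)) := by gcongr
      _ = C * ε * ‖p‖ ^ 2 := by ring
      _ ≤ C * ε * (K * δ) ^ 2 := by gcongr
      _ = _ := by ring
  have b5 : |(x - x') * (x + x')| ≤ 2 * K * J * (ε * δ ^ 2) := by
    rw [abs_mul]
    have : |x + x'| ≤ 2 * (K * δ) := by linarith [abs_add_le x x']
    have hJ : 0 ≤ J * (ε * δ) := (abs_nonneg _).trans hxvw
    calc _ ≤ (J * (ε * δ)) * (2 * (K * δ)) := by gcongr
      _ = _ := by ring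
  rw [← mul_div_assoc, le_div_iff₀ hη, mul_comm _ η]
  nth_rewrite 1 [← abs_of_pos hη]
  rw [← abs_mul, e]
  have hC1 : 1 ≤ C := by linarith
  have p13 : C ≤ C ^ 3 := by
    calc C = C ^ 1 := (pow_one C).symm
      _ ≤ _ := pow_le_pow_right₀ hC1 (by norm_num)
  have k13 : K ≤ K ^ 3 := by
    calc K = K ^ 1 := (pow_one K).symm
      _ ≤ _ := pow_le_pow_right₀ hK (by norm_num)
  have k23 : K ^ 2 ≤ K ^ 3 := pow_le_pow_right₀ hK (by norm_num)
  generalize ε * δ ^ 2 = U at *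
  have c1 : 2 * C * K ^ 3 * U ≤ 2 * C ^ 3 * K ^ 3 * U := by gcongr
  have c2 : C * K * U ≤ C ^ 3 * K ^ 3 * U := by gcongr
  have c3 : 75 * C ^ 3 * K ^ 2 * U ≤ 75 * C ^ 3 * K ^ 3 * U := by gcongr
  have c4 : C * K ^ 2 * U ≤ C ^ 3 * K ^ 3 * U := by gcongr
  have c5 : 0 ≤ C ^ 3 * K ^ 3 * U := by positivity
  refine (abs_add_le _ _).trans ?_
  refine (add_le_add_left ((abs_add_le _ _).trans (add_le_add_left ((abs_add_le _ _).trans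
    (add_le_add_left (abs_add_le _ _) _)) _)) _).trans ?_
  linarith

theorem abs_sharpness_sub_le (hσδ : η * ρ * δ ≤ 2 * C * ε)
    (hK : 1 ≤ K) (hsmall : 200 * K ^ 4 * C ^ 2 * ε ≤ 1) {t : ℕ} (ht : t ≤ T) {v w : Vec d}
    (hv : ‖v‖ ≤ K * δ) {J : ℝ} (hJ : 0 ≤ J) (hvw : ‖v - w‖ ≤ J * (ε * δ)) :
    |sharpness L (θc t + v) - (2 / η + inner ℝ (gradSperp L u (θc t)) w +
        kappa L u (θc t) * inner ℝ (u (θc t)) w)| ≤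
      (200 * C ^ 3 * K ^ 2 + 2 * C * J) * (ε ^ 2 / η) := by
  obtain ⟨s, hs, hp⟩ := h.exists_edgePoint t ht
  have hC := h.C_ge
  have hC0 : 0 < C := hp.C_pos
  have hη := h.η_pos
  have hσ := hp.σ_pos
  have hε := h.ε_nonneg
  have hε1 := h.ε_le_one.2
  obtain ⟨hv1, hv2⟩ := h.C_mul_small hK hσδ hsmall hv
  have hT := hp.sharpness_taylor hv2
  have hs0 := hp.s_nonneg
  have e : η * (sharpness L (θc t + v) - (2 / η + inner ℝ (gradSperp L u (θc t)) w +
        kappa L u (θc t) * inner ℝ (u (θc t)) w)) =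
      (η * sharpness L (θc t + v) - (2 - s) - η * inner ℝ (gradS L (θc t)) v) + (-s) +
        η * inner ℝ (gradS L (θc t)) (v - w) := by
    rw [inner_sub_right, inner_gradS_eq L u (θc t) w]
    field_simp
    ring
  have b1 : 2 * C * (η * ρ * ‖v‖) ^ 2 ≤ 8 * C ^ 3 * K ^ 2 * ε ^ 2 := by
    calc 2 * C * (η * ρ * ‖v‖) ^ 2 ≤ 2 * C * (2 * C * K * ε) ^ 2 := by gcongr
      _ = _ := by ring
  have b2 : |(-s)| ≤ 150 * C ^ 3 * K ^ 2 * ε ^ 2 := by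
    rw [abs_neg, abs_of_nonneg hs0]
    calc s ≤ 150 * C ^ 3 * ε ^ 3 := hs
      _ = 150 * C ^ 3 * 1 * ε ^ 2 * ε := by ring
      _ ≤ 150 * C ^ 3 * K ^ 2 * ε ^ 2 * 1 := by
        gcongr
        exact one_le_pow₀ hK
      _ = _ := mul_one _
  have b3 : |η * inner ℝ (gradS L (θc t)) (v - w)| ≤ 2 * C * J * ε ^ 2 := by
    rw [abs_mul, abs_of_pos hη]
    calc _ ≤ η * (‖gradS L (θc t)‖ * ‖v - w‖) := by
          gcongr; exact abs_real_inner_le_norm _ _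
      _ = (η * ‖gradS L (θc t)‖) * ‖v - w‖ := by ring
      _ ≤ (η * ρ) * (J * (ε * δ)) := by gcongr ?_ * ?_; exact hp.norm_gradS_le
      _ = J * ε * (η * ρ * δ) := by ring
      _ ≤ J * ε * (2 * C * ε) := by gcongr
      _ = _ := by ring
  rw [← mul_div_assoc, le_div_iff₀ hη, mul_comm _ η]
  nth_rewrite 1 [← abs_of_pos hη]
  rw [← abs_mul, e]
  have hU : 0 ≤ C ^ 3 * K ^ 2 * ε ^ 2 := by positivity
  refine (abs_add_three _ _ _).trans ?_
  linarith

end EdgeTrajectory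

end Coupling

/-! ### Pathwise coupling by Gronwall -/

section Pathwise

variable {d : ℕ}

theorem one_add_mul_pow_le_exp {m ε : ℝ} (hm : 0 ≤ m) (hε : 0 ≤ ε) {T t : ℕ} (ht : t ≤ T)
    (hT : ε * T ≤ 1) : (1 + m * ε) ^ t ≤ Real.exp m := by
  have h1 : 1 + m * ε ≤ Real.exp (m * ε) := by linarith [Real.add_one_le_exp (m * ε)]
  have h2 : ε * t ≤ 1 := le_trans (mul_le_mul_of_nonneg_left (by exact_mod_cast ht) hε) hT
  calc (1 + m * ε) ^ t ≤ Real.exp (m * ε) ^ t := by gcongr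
    _ = Real.exp (m * (ε * t)) := by rw [← Real.exp_nat_mul]; ring_nf
    _ ≤ Real.exp (m * 1) := by gcongr
    _ = _ := by rw [mul_one]

theorem discrete_gronwall {a : ℕ → ℝ} {α β : ℝ} {T : ℕ} (hα : 0 ≤ α) (hβ : 0 ≤ β)
    (h : ∀ t < T, a (t + 1) ≤ (1 + α) * a t + β) :
    ∀ t ≤ T, a t ≤ (1 + α) ^ t * (a 0 + t * β) := by
  intro t
  induction t with
  | zero => simp
  | succ t ih =>
    intro ht
    have h1 := ih (by omega)
    have h2 : (1 : ℝ) ≤ (1 + α) ^ (t + 1) := one_le_pow₀ (by linarith)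
    calc a (t + 1) ≤ (1 + α) * ((1 + α) ^ t * (a 0 + t * β)) + 1 * β :=
          (h t (by omega)).trans (by gcongr; linarith)
      _ ≤ (1 + α) * ((1 + α) ^ t * (a 0 + t * β)) + (1 + α) ^ (t + 1) * β := by gcongr
      _ = _ := by push_cast; ring

/-- The constant in the bound of the coupling error, on the event that the predicted dynamics stay
in the ball of radius `K δ`. -/
def couplingConst (C K : ℝ) : ℝ := Real.exp (200 * K * C ^ 2) * (32000 * C ^ 4 * K ^ 3)

/-- The constant in the final estimates, when the predicted dynamics stay in the ball of radius
`K δ`. -/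
def finalConst (C K : ℝ) : ℝ :=
  2 * K + couplingConst C K + (100 * C ^ 3 * (2 * K) ^ 3 + 2 * (2 * K) * couplingConst C K) +
    (200 * C ^ 3 * (2 * K) ^ 2 + 2 * C * couplingConst C K)

theorem norm_le_of_coupled {C K ε δ : ℝ} (hδ : 0 ≤ δ) (hK : 1 ≤ K) (hJ : couplingConst C K * ε ≤ 1)
    {v w : Vec d} (hw : ‖w‖ ≤ K * δ) (hvw : ‖v - w‖ ≤ couplingConst C K * (ε * δ)) :
    ‖v‖ ≤ 2 * K * δ := by
  have e : v = (v - w) + w := by abel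
  have h1 : couplingConst C K * (ε * δ) ≤ 1 * δ := by rw [← mul_assoc]; gcongr
  have h2 : 1 * δ ≤ K * δ := by gcongr
  rw [e]
  refine (norm_add_le _ _).trans ?_
  linarith

namespace EdgeTrajectory

variable {L : Vec d → ℝ} {u : Vec d → Vec d} {N : Set (Vec d)} {η ρ C ε δ K : ℝ} {T : ℕ}
  {θc : ℕ → Vec d} (h : EdgeTrajectory L u N η ρ C ε T θc)
include h

/-- The noise is an arbitrary sequence here and cancels in the difference. Only the predicted path
is assumed bounded; the SGD path is bounded along the induction, since `couplingConst C K * ε ≤ 1`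
puts it in the ball of radius `2Kδ`, where the one-step comparison is used. -/
theorem coupling (hδ : ∀ t ≤ T, deltaAt L u (θc t) ≤ δ)
    (hσδ : η * ρ * δ ≤ 2 * C * ε) (hεδ : ε ≤ η * ρ * δ) (hK : 1 ≤ K)
    (hsmall : 3200 * K ^ 4 * C ^ 2 * ε ≤ 1) (hJ : couplingConst C K * ε ≤ 1)
    {θ ξ : ℕ → Vec d} (hθ : ∀ t, θ (t + 1) = θ t - η • (gradient L (θ t) + ξ t)) :
    ∀ t ≤ T, (∀ s ≤ t, ‖predicted L u η θc (θ 0 - θc 0) ξ s‖ ≤ K * δ) →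
      ‖(θ t - θc t) - predicted L u η θc (θ 0 - θc 0) ξ t‖ ≤
        couplingConst C K * (ε * δ) := by
  have hC : 8 ≤ C := h.C_ge
  have hC0 : 0 < C := by linarith
  have hε := h.ε_nonneg
  have hK0 : 0 < K := by linarith
  have hδ0 : 0 ≤ δ := (Real.sqrt_nonneg _).trans (hδ 0 (Nat.zero_le T))
  have hJ0 : 0 ≤ couplingConst C K := by unfold couplingConst; positivity
  set w := predicted L u η θc (θ 0 - θc 0) ξ with hw
  obtain ⟨α, hα⟩ : ∃ α, α = 200 * K * C ^ 2 := ⟨_, rfl⟩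
  obtain ⟨β, hβ⟩ : ∃ β, β = 32000 * C ^ 4 * K ^ 3 := ⟨_, rfl⟩
  have hα0 : 0 ≤ α := by rw [hα]; positivity
  have hβ0 : 0 ≤ β := by rw [hβ]; positivity
  have hJdef : couplingConst C K = Real.exp α * β := by rw [hα, hβ]; rfl
  have hfin : ∀ t ≤ T, (1 + α * ε) ^ t * (t * (β * (ε ^ 2 * δ))) ≤
      couplingConst C K * (ε * δ) := by
    intro t ht
    have h1 := one_add_mul_pow_le_exp hα0 hε ht h.T_le
    have h2 : ε * t ≤ 1 := le_trans (mul_le_mul_of_nonneg_left (by exact_mod_cast ht) hε) h.T_le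
    calc _ = (1 + α * ε) ^ t * β * (ε * δ) * (ε * t) := by ring
      _ ≤ Real.exp α * β * (ε * δ) * 1 := by gcongr
      _ = _ := by rw [hJdef, mul_one]
  intro t ht hb
  -- The induction runs on the sharper discrete Gronwall bound; the uniform constant would not
  -- reproduce itself.
  refine le_trans ?_ (hfin t ht)
  induction t with
  | zero => simp [hw, predicted]
  | succ t ih =>
    have hbt := hb t (Nat.le_succ t)
    have ih' := ih (by omega) fun s hs => hb s (by omega)
    have he := ih'.trans (hfin t (by omega))
    have hv : ‖θ t - θc t‖ ≤ 2 * K * δ := by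
      have e : θ t - θc t = (θ t - θc t - w t) + w t := by abel
      have h1 : couplingConst C K * (ε * δ) ≤ 1 * δ := by rw [← mul_assoc]; gcongr
      have h2 : 1 * δ ≤ K * δ := by gcongr
      rw [e]
      refine (norm_add_le _ _).trans ?_
      linarith
    have hbt' : ‖w t‖ ≤ 2 * K * δ := hbt.trans (by nlinarith [mul_nonneg hK0.le hδ0])
    have hsm : 200 * (2 * K) ^ 4 * C ^ 2 * ε ≤ 1 := by
      calc 200 * (2 * K) ^ 4 * C ^ 2 * ε = 3200 * K ^ 4 * C ^ 2 * ε := by ring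
        _ ≤ 1 := hsmall
    have h1 := h.norm_step_sub_predStep_le hδ hσδ hεδ (by linarith) hsm ht hv
    have h2 := (h.stepBounds hδ hσδ ht).modelStep_lipschitz (by linarith) hv hbt'
    rw [← predStep_eq_modelStep, ← predStep_eq_modelStep] at h2
    rw [add_sub_cancel] at h1
    have e : θ (t + 1) - θc (t + 1) - w (t + 1) =
        ((θ t - θc t) - η • (gradient L (θ t) - gradient L (θc t)) +
          (θc t - η • gradient L (θc t) - θc (t + 1)) -
            predStep L u η (θc t) (θc (t + 1)) (θ t - θc t)) +
        (predStep L u η (θc t) (θc (t + 1)) (θ t - θc t) -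
          predStep L u η (θc t) (θc (t + 1)) (w t)) := by
      have : w (t + 1) = predStep L u η (θc t) (θc (t + 1)) (w t) - η • ξ t := rfl
      rw [this, hθ t]
      module
    have hU : 0 ≤ ε ^ 2 * δ := by positivity
    have hpow : (1 : ℝ) ≤ (1 + α * ε) ^ (t + 1) := one_le_pow₀ (by
      have := mul_nonneg hα0 hε
      linarith)
    have h0 : 0 ≤ 1 + α * ε := by positivity
    rw [e]
    calc _ ≤ 4000 * C ^ 4 * (2 * K) ^ 3 * (ε ^ 2 * δ) +
          (1 + 5 * (2 * K) * (20 * C ^ 2) * ε) * ‖θ t - θc t - w t‖ :=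
          (norm_add_le _ _).trans (add_le_add h1 h2)
      _ = 1 * (β * (ε ^ 2 * δ)) + (1 + α * ε) * ‖θ t - θc t - w t‖ := by rw [hα, hβ]; ring
      _ ≤ (1 + α * ε) ^ (t + 1) * (β * (ε ^ 2 * δ)) +
          (1 + α * ε) * ((1 + α * ε) ^ t * (t * (β * (ε ^ 2 * δ)))) := by gcongr
      _ = _ := by push_cast; ring

theorem coupledAt (hδ : ∀ t ≤ T, deltaAt L u (θc t) ≤ δ)
    (hσδ : η * ρ * δ ≤ 2 * C * ε) (hεδ : ε ≤ η * ρ * δ) (hK : 1 ≤ K)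
    (hsmall : 3200 * K ^ 4 * C ^ 2 * ε ≤ 1) (hJ : couplingConst C K * ε ≤ 1)
    {θ ξ : ℕ → Vec d} (hθ : ∀ t, θ (t + 1) = θ t - η • (gradient L (θ t) + ξ t))
    {t : ℕ} (ht : t ≤ T)
    (hb : ∀ s ≤ t, ‖predicted L u η θc (θ 0 - θc 0) ξ s‖ ≤ K * δ) :
    CoupledAt (finalConst C K) ε δ L u η (θ t) (θc t)
      (predicted L u η θc (θ 0 - θc 0) ξ t) := by
  have hC : 8 ≤ C := h.C_ge
  have hC0 : 0 < C := by linarith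
  have hε := h.ε_nonneg
  have hη := h.η_pos
  have hK0 : 0 < K := by linarith
  have hδ0 : 0 ≤ δ := (Real.sqrt_nonneg _).trans (hδ 0 (Nat.zero_le T))
  have hJ0 : 0 ≤ couplingConst C K := by unfold couplingConst; positivity
  have hc := h.coupling hδ hσδ hεδ hK hsmall hJ hθ t ht hb
  have hw := hb t le_rfl
  have hv := norm_le_of_coupled hδ0 hK hJ hw hc
  have hw' : ‖predicted L u η θc (θ 0 - θc 0) ξ t‖ ≤ 2 * K * δ :=
    hw.trans (by nlinarith [mul_nonneg hK0.le hδ0])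
  have hsm : 200 * (2 * K) ^ 4 * C ^ 2 * ε ≤ 1 := by
    calc 200 * (2 * K) ^ 4 * C ^ 2 * ε = 3200 * K ^ 4 * C ^ 2 * ε := by ring
      _ ≤ 1 := hsmall
  have hl := h.abs_loss_sub_le hσδ hεδ hδ0 (by linarith) hsm ht hv hw' hc
  have hs := h.abs_sharpness_sub_le hσδ (by linarith) hsm ht hv hJ0 hc
  rw [add_sub_cancel] at hl hs
  have p1 : 0 ≤ 100 * C ^ 3 * (2 * K) ^ 3 + 2 * (2 * K) * couplingConst C K := by positivity
  have p2 : 0 ≤ 200 * C ^ 3 * (2 * K) ^ 2 + 2 * C * couplingConst C K := by positivity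
  refine ⟨max_le ?_ ?_, ?_, ?_, ?_⟩
  · refine hv.trans ?_
    gcongr; unfold finalConst; linarith
  · refine hw'.trans ?_
    gcongr; unfold finalConst; linarith
  · refine hc.trans ?_
    gcongr; unfold finalConst; linarith
  · refine hl.trans ?_
    gcongr; unfold finalConst; linarith
  · refine hs.trans ?_
    gcongr; unfold finalConst; linarith

end EdgeTrajectory

end Pathwise

/-! ### Probability of leaving a ball -/

section Exit

variable {Ω V : Type*} [NormedAddCommGroup V]

/-- The event that `X` up to time `t` and `ζ` before time `t` stay in the ball of radius `R`. -/
def stayEvent (X ζ : ℕ → Ω → V) (R : ℝ) (t : ℕ) : Set Ω :=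
  {ω | (∀ s ≤ t, ‖X s ω‖ ≤ R) ∧ ∀ s < t, ‖ζ s ω‖ ≤ R}

theorem mem_stayEvent_succ {X ζ : ℕ → Ω → V} {R : ℝ} {t : ℕ} {ω : Ω} :
    ω ∈ stayEvent X ζ R (t + 1) ↔
      ω ∈ stayEvent X ζ R t ∧ ‖ζ t ω‖ ≤ R ∧ ‖X (t + 1) ω‖ ≤ R := by
  constructor
  · rintro ⟨h1, h2⟩
    exact ⟨⟨fun s hs => h1 s (by omega), fun s hs => h2 s (by omega)⟩, h2 t (by omega),
      h1 (t + 1) le_rfl⟩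
  · rintro ⟨⟨h1, h2⟩, h3, h4⟩
    refine ⟨fun s hs => ?_, fun s hs => ?_⟩
    · rcases hs.eq_or_lt with rfl | hs
      · exact h4
      · exact h1 s (by omega)
    · rcases (Nat.lt_succ_iff.1 hs).eq_or_lt with rfl | hs
      · exact h3
      · exact h2 s hs

/-- Energy estimate for the probability of leaving the ball of radius `R` before time `T`. -/
theorem exit_probability_le [MeasurableSpace Ω] [InnerProductSpace ℝ V] (P : Measure Ω)
    [IsProbabilityMeasure P] {X ζ l : ℕ → Ω → V}
    {En : ℕ → Ω → ℝ} {R δ ε m Q : ℝ} {T : ℕ} (hε : 0 ≤ ε) (hT : ε * T ≤ 1)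
    (hm : 0 ≤ m) (hQ : 0 ≤ Q) (hR : 0 ≤ R)
    (hGm : ∀ t ≤ T, MeasurableSet (stayEvent X ζ R t))
    (hEi : ∀ t ≤ T, Integrable (En t) P)
    (hζi : ∀ t < T, Integrable (fun ω => ‖ζ t ω‖ ^ 2) P)
    (hli : ∀ t < T, Integrable ((stayEvent X ζ R t).indicator fun ω => inner ℝ (l t ω) (ζ t ω)) P)
    (hmart : ∀ t < T,
      ∫ ω, (stayEvent X ζ R t).indicator (fun ω => inner ℝ (l t ω) (ζ t ω)) ω ∂P = 0)
    (hζ : ∀ t < T, ∫ ω, ‖ζ t ω‖ ^ 2 ∂P ≤ Q * (ε * δ ^ 2))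
    (hl : ∀ t < T, ∀ ω ∈ stayEvent X ζ R t, ‖l t ω‖ ≤ 13 * R)
    (hE0 : ∀ t ≤ T, ∀ ω ∈ stayEvent X ζ R t, 0 ≤ En t ω)
    (hlow : ∀ t < T, ∀ ω ∈ stayEvent X ζ R t, ‖ζ t ω‖ ≤ R →
      1 / 2 * ‖X (t + 1) ω‖ ^ 2 ≤ En (t + 1) ω)
    (hstep : ∀ t < T, ∀ ω ∈ stayEvent X ζ R t, ‖ζ t ω‖ ≤ R →
      En (t + 1) ω ≤ (1 + m * ε) * En t ω + m * ε * δ ^ 2 + inner ℝ (l t ω) (ζ t ω) +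
        7 * ‖ζ t ω‖ ^ 2)
    (hinit : ∀ ω, En 0 ω ≤ 3 * δ ^ 2) (hinit' : ∀ ω, ω ∈ stayEvent X ζ R 0) :
    P.real (stayEvent X ζ R T)ᶜ * R ^ 2 ≤ 2 * Real.exp m * (3 + m + 14 * Q) * δ ^ 2 := by
  classical
  set G := stayEvent X ζ R with hG
  -- Energy of the process stopped at exit: once the path has left, the value is frozen at `R² / 2`,
  -- the least energy possible for a displacement outside the ball.
  set Ψ : ℕ → Ω → ℝ := fun t ω => (G t).indicator (En t) ω +
    (G t)ᶜ.indicator (fun _ => R ^ 2 / 2) ω with hΨ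
  have hΨi : ∀ t ≤ T, Integrable (Ψ t) P := fun t ht =>
    ((hEi t ht).indicator (hGm t ht)).add ((integrable_const _).indicator (hGm t ht).compl)
  have hin : ∀ t ω, ω ∈ G t → Ψ t ω = En t ω := by
    intro t ω hω
    simp [hΨ, hω]
  have hout : ∀ t ω, ω ∉ G t → Ψ t ω = R ^ 2 / 2 := by
    intro t ω hω
    simp [hΨ, hω]
  have hΨ0 : ∀ t ≤ T, ∀ ω, 0 ≤ Ψ t ω := by
    intro t ht ω
    by_cases hω : ω ∈ G t
    · rw [hin t ω hω]; exact hE0 t ht ω hω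
    · rw [hout t ω hω]; positivity
  have hpt : ∀ t < T, ∀ ω, Ψ (t + 1) ω ≤ (1 + m * ε) * Ψ t ω + m * ε * δ ^ 2 +
      (G t).indicator (fun ω => inner ℝ (l t ω) (ζ t ω)) ω + 14 * ‖ζ t ω‖ ^ 2 := by
    intro t ht ω
    have hp1 : 0 ≤ m * ε * δ ^ 2 := by positivity
    have hp2 : 0 ≤ m * ε * Ψ t ω := mul_nonneg (by positivity) (hΨ0 t ht.le ω)
    have hp3 : 0 ≤ ‖ζ t ω‖ ^ 2 := by positivity
    by_cases hω : ω ∈ G t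
    · rw [Set.indicator_of_mem hω]
      by_cases hz : ‖ζ t ω‖ ≤ R
      · have h1 := hstep t ht ω hω hz
        have h2 := hlow t ht ω hω hz
        have h3 : Ψ (t + 1) ω ≤ En (t + 1) ω := by
          by_cases hω' : ω ∈ G (t + 1)
          · rw [hin _ ω hω']
          · rw [hout _ ω hω']
            have h4 : R < ‖X (t + 1) ω‖ := by
              by_contra hc
              exact hω' (mem_stayEvent_succ.2 ⟨hω, hz, not_lt.1 hc⟩)
            have : R ^ 2 ≤ ‖X (t + 1) ω‖ ^ 2 := by gcongr
            linarith
        rw [hin t ω hω]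
        linarith
      -- Exit through one large noise increment, where the energy step estimate does not apply. Then
      -- `R < ‖ζ‖`, so both the frozen value and the possibly negative linear term `⟨l, ζ⟩ ≥
      -- -13R‖ζ‖` are paid by `14‖ζ‖²`.
      · have hω' : ω ∉ G (t + 1) := fun hc => hz (mem_stayEvent_succ.1 hc).2.1
        rw [hout _ ω hω']
        push Not at hz
        have h1 := hl t ht ω hω
        have h2 := (abs_le.1 (abs_real_inner_le_norm (l t ω) (ζ t ω))).1
        have h3 : ‖l t ω‖ * ‖ζ t ω‖ ≤ 13 * R * ‖ζ t ω‖ := by gcongr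
        have h4 : R ^ 2 ≤ ‖ζ t ω‖ ^ 2 := by gcongr
        have h5 : R * ‖ζ t ω‖ ≤ ‖ζ t ω‖ ^ 2 := by
          rw [sq]; gcongr
        linarith [hΨ0 t ht.le ω]
    · have hω' : ω ∉ G (t + 1) := fun hc => hω (mem_stayEvent_succ.1 hc).1
      rw [Set.indicator_of_notMem hω, hout _ ω hω', ← hout _ ω hω]
      linarith
  have hrec : ∀ t < T, ∫ ω, Ψ (t + 1) ω ∂P ≤ (1 + m * ε) * ∫ ω, Ψ t ω ∂P +
      (m + 14 * Q) * (ε * δ ^ 2) := by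
    intro t ht
    have i1 := (hΨi t ht.le).const_mul (1 + m * ε)
    have i2 : Integrable (fun ω => (1 + m * ε) * Ψ t ω + m * ε * δ ^ 2) P :=
      i1.add (integrable_const _)
    have i3 : Integrable (fun ω => (1 + m * ε) * Ψ t ω + m * ε * δ ^ 2 +
        (G t).indicator (fun ω => inner ℝ (l t ω) (ζ t ω)) ω) P := i2.add (hli t ht)
    have i4 := (hζi t ht).const_mul 14
    have h1 := integral_mono (hΨi (t + 1) ht) (i3.add i4) (hpt t ht)
    have h2 : ∫ ω, ((1 + m * ε) * Ψ t ω + m * ε * δ ^ 2 +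
        (G t).indicator (fun ω => inner ℝ (l t ω) (ζ t ω)) ω + 14 * ‖ζ t ω‖ ^ 2) ∂P =
        (1 + m * ε) * ∫ ω, Ψ t ω ∂P + m * ε * δ ^ 2 + 0 + 14 * ∫ ω, ‖ζ t ω‖ ^ 2 ∂P := by
      rw [integral_add i3 i4, ← integral_const_mul 14]
      congr 1
      refine (integral_add i2 (hli t ht)).trans ?_
      rw [hmart t ht]
      congr 1
      refine (integral_add i1 (integrable_const _)).trans ?_
      rw [integral_const_mul]
      simp
    have h3 := hζ t ht
    refine h1.trans (h2.le.trans ?_)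
    linarith
  have hβ : 0 ≤ (m + 14 * Q) * (ε * δ ^ 2) := by positivity
  have hgr := discrete_gronwall (a := fun t => ∫ ω, Ψ t ω ∂P) (by positivity) hβ hrec T le_rfl
  have h0 : ∫ ω, Ψ 0 ω ∂P ≤ 3 * δ ^ 2 := by
    have := integral_mono (hΨi 0 (Nat.zero_le T)) (integrable_const (μ := P) (3 * δ ^ 2))
      (fun ω => by rw [hin 0 ω (hinit' ω)]; exact hinit ω)
    simpa using this
  -- Markov's inequality for the frozen value.
  have hlast : P.real (G T)ᶜ * (R ^ 2 / 2) ≤ ∫ ω, Ψ T ω ∂P := by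
    have i1 : Integrable ((G T)ᶜ.indicator fun _ => R ^ 2 / 2) P :=
      (integrable_const _).indicator (hGm T le_rfl).compl
    have h1 := integral_mono i1 (hΨi T le_rfl) (fun ω => by
      by_cases hω : ω ∈ G T
      · simpa [hω] using hΨ0 T le_rfl ω
      · rw [hout _ ω hω]; simp [hω])
    rwa [integral_indicator_const _ (hGm T le_rfl).compl, smul_eq_mul] at h1
  have hexp := one_add_mul_pow_le_exp hm hε le_rfl hT
  have hsum : (∫ ω, Ψ 0 ω ∂P) + T * ((m + 14 * Q) * (ε * δ ^ 2)) ≤ (3 + m + 14 * Q) * δ ^ 2 := by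
    have : (m + 14 * Q) * δ ^ 2 * (ε * T) ≤ (m + 14 * Q) * δ ^ 2 * 1 := by gcongr
    linarith
  have hfin : ∫ ω, Ψ T ω ∂P ≤ Real.exp m * ((3 + m + 14 * Q) * δ ^ 2) := by
    refine hgr.trans ?_
    gcongr
    exact add_nonneg (integral_nonneg (hΨ0 0 (Nat.zero_le T))) (by positivity)
  linarith

end Exit

/-! ### Uniform sampling of batches -/

section Sampling

variable {n : ℕ} {Ω : Type*} [MeasurableSpace Ω] {P : Measure Ω} {b : ℕ}
  {B : ℕ → Ω → Finset (Fin n)}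

/-- Extension of a finite history by empty batches. -/
def extendHistory (t : ℕ) (x : Finset.range t → Finset (Fin n)) : ℕ → Finset (Fin n) :=
  fun s => if hs : s ∈ Finset.range t then x ⟨s, hs⟩ else ∅

theorem apply_extendHistory {β : Type*} {φ : (ℕ → Finset (Fin n)) → β} {t : ℕ}
    (hφ : DependsOn φ (Set.Iio t)) (x : ℕ → Finset (Fin n)) :
    φ (extendHistory t fun s => x s) = φ x :=
  hφ fun s hs => by simp [extendHistory, Set.mem_Iio.1 hs]

theorem measurable_batch (hB : ∀ t s, MeasurableSet {ω | B t ω = s}) (t : ℕ) :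
    Measurable[_, ⊤] (B t) :=
  let _ : MeasurableSpace (Finset (Fin n)) := ⊤
  measurable_to_countable' fun s => hB t s

/-- A function of the first `t` batches factors through a finite discrete space, so no regularity of
the function is needed. Integrability is obtained in the same way. -/
theorem measurable_of_dependsOn {β : Type*} [MeasurableSpace β]
    (hB : ∀ t s, MeasurableSet {ω | B t ω = s}) {φ : (ℕ → Finset (Fin n)) → β} {t : ℕ}
    (hφ : DependsOn φ (Set.Iio t)) : Measurable fun ω => φ fun s => B s ω := by
  let _ : MeasurableSpace (Finset (Fin n)) := ⊤
  have h : Measurable fun ω => fun s : Finset.range t => B s ω :=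
    measurable_pi_lambda _ fun s => measurable_batch hB s
  have h2 : Measurable fun x : Finset.range t → Finset (Fin n) => φ (extendHistory t x) :=
    Measurable.of_discrete
  convert h2.comp h using 1
  ext ω
  exact (apply_extendHistory hφ fun s => B s ω).symm

theorem integrable_of_dependsOn [IsFiniteMeasure P] {β : Type*} [NormedAddCommGroup β]
    (hB : ∀ t s, MeasurableSet {ω | B t ω = s}) {φ : (ℕ → Finset (Fin n)) → β} {t : ℕ}
    (hφ : DependsOn φ (Set.Iio t)) : Integrable (fun ω => φ fun s => B s ω) P := by
  let _ : MeasurableSpace (Finset (Fin n)) := ⊤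
  have h : Measurable fun ω => fun s : Finset.range t => B s ω :=
    measurable_pi_lambda _ fun s => measurable_batch hB s
  have h2 : Integrable (fun x : Finset.range t → Finset (Fin n) => φ (extendHistory t x))
      (P.map fun ω => fun s : Finset.range t => B s ω) := Integrable.of_finite
  convert h2.comp_measurable h using 1
  ext ω
  exact (apply_extendHistory hφ fun s => B s ω).symm

/-- The definition prescribes only the mass of sets of size `b`; these masses already add up to one,
so the others vanish. -/
theorem IsUniformSampling.measureReal_eq [IsProbabilityMeasure P] (h : IsUniformSampling P b B)
    (hb : b ≤ n) (t : ℕ) (s : Finset (Fin n)) :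
    P.real {ω | B t ω = s} = if s.card = b then ((n.choose b : ℕ) : ℝ)⁻¹ else 0 := by
  have hcard : ∀ s : Finset (Fin n), s.card = b →
      P.real {ω | B t ω = s} = ((n.choose b : ℕ) : ℝ)⁻¹ := by
    intro s hs
    simp [Measure.real, h.2.1 t s hs]
  split_ifs with hs
  · exact hcard s hs
  · have h1 : ∑ s : Finset (Fin n), P.real {ω | B t ω = s} = 1 := by
      have := sum_measureReal_preimage_singleton (μ := P) (f := B t) Finset.univ
        (fun s _ => h.1 t s)
      simp only [Finset.coe_univ, Set.preimage_univ, probReal_univ] at this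
      exact this
    have h2 : ∑ s ∈ Finset.powersetCard b (Finset.univ : Finset (Fin n)),
        P.real {ω | B t ω = s} = 1 := by
      rw [Finset.sum_congr rfl fun s hs => hcard s (Finset.mem_powersetCard.1 hs).2]
      have : (n.choose b : ℝ) ≠ 0 := by
        exact_mod_cast (Nat.choose_pos hb).ne'
      simp [this]
    rw [← Finset.sum_add_sum_compl (Finset.powersetCard b Finset.univ), h2] at h1
    have h3 : ∑ s ∈ (Finset.powersetCard b (Finset.univ : Finset (Fin n)))ᶜ,
        P.real {ω | B t ω = s} = 0 := by linarith
    exact (Finset.sum_eq_zero_iff_of_nonneg fun _ _ => measureReal_nonneg).1 h3 s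
      (by simp [hs])

/-- A quantity that averages to zero over the batches, given the past, has mean zero. -/
theorem IsUniformSampling.integral_eq_zero [IsProbabilityMeasure P] (h : IsUniformSampling P b B)
    (hb : b ≤ n) {t : ℕ} {φ : Finset (Fin n) → (ℕ → Finset (Fin n)) → ℝ}
    (hφ : ∀ s, DependsOn (φ s) (Set.Iio t))
    (hsum : ∀ x, ∑ s ∈ Finset.powersetCard b Finset.univ, φ s x = 0) :
    ∫ ω, φ (B t ω) (fun s => B s ω) ∂P = 0 := by
  classical
  let _ : MeasurableSpace (Finset (Fin n)) := ⊤
  have hint : ∀ s, Integrable (fun ω => φ s fun i => B i ω) P := fun s =>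
    integrable_of_dependsOn h.1 (hφ s)
  have hind : ∀ s : Finset (Fin n),
      ∫ ω, ({ω | B t ω = s}.indicator (fun ω => φ s fun i => B i ω) ω) ∂P =
        P.real {ω | B t ω = s} * ∫ ω, (φ s fun i => B i ω) ∂P := by
    intro s
    -- The current batch is independent of all earlier ones, so on each event `B t = s` the
    -- expectation factors.
    have h1 := h.2.2.indepFun_finset {t} (Finset.range t) (by simp) (measurable_batch h.1)
    have h2 := h1.comp
      (φ := fun x : ({t} : Finset ℕ) → Finset (Fin n) =>
        if x ⟨t, Finset.mem_singleton_self t⟩ = s then (1 : ℝ) else 0)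
      (ψ := fun x : Finset.range t → Finset (Fin n) => φ s (extendHistory t x))
      Measurable.of_discrete Measurable.of_discrete
    have hm : ∀ S : Finset ℕ, Measurable fun ω => fun i : S => B i ω := fun S =>
      measurable_pi_lambda _ fun i => measurable_batch h.1 i
    have h3 := h2.integral_fun_mul_eq_mul_integral
      (Measurable.of_discrete.comp (hm {t})).aestronglyMeasurable
      (Measurable.of_discrete.comp (hm (Finset.range t))).aestronglyMeasurable
    have hx : ∀ ω, φ s (extendHistory t fun i => B i ω) = φ s fun i => B i ω := fun ω =>
      apply_extendHistory (hφ s) fun i => B i ω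
    simp only [Function.comp_apply, hx] at h3
    have e1 : ∫ ω, (if B t ω = s then (1 : ℝ) else 0) ∂P = P.real {ω | B t ω = s} := by
      rw [← integral_indicator_one (h.1 t s)]
      congr 1 with ω
      simp [Set.indicator_apply]
    rw [e1] at h3
    rw [← h3]
    congr 1 with ω
    by_cases hω : B t ω = s <;> simp [hω]
  have hdecomp : ∀ ω, φ (B t ω) (fun s => B s ω) =
      ∑ s, {ω | B t ω = s}.indicator (fun ω => φ s fun i => B i ω) ω := by
    intro ω
    simp [Set.indicator_apply]
  simp_rw [hdecomp]
  rw [integral_finsetSum _ fun s _ => (hint s).indicator (h.1 t s)]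
  simp_rw [hind, h.measureReal_eq hb]
  simp only [ite_mul, zero_mul]
  rw [← Finset.sum_filter, ← Finset.mul_sum, ← integral_finsetSum _ fun s _ => hint s]
  have e : Finset.univ.filter (fun s : Finset (Fin n) => s.card = b) =
      Finset.powersetCard b Finset.univ := by
    ext s; simp
  rw [e]
  simp [hsum]

/-- Double counting: every index lies in `(n - 1).choose (b - 1)` of the batches, and `n * (n -
1).choose (b - 1) = b * n.choose b`. -/
theorem sum_powersetCard_sum {V : Type*} [AddCommGroup V] [Module ℝ V] (hb0 : 0 < b) (hb : b ≤ n)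
    (g : Fin n → V) :
    ∑ s ∈ Finset.powersetCard b Finset.univ, ((b : ℝ)⁻¹ • ∑ i ∈ s, g i - (n : ℝ)⁻¹ • ∑ i, g i) =
      0 := by
  classical
  have h1 : ∑ s ∈ Finset.powersetCard b (Finset.univ : Finset (Fin n)), ∑ i ∈ s, g i =
      ((n - 1).choose (b - 1) : ℝ) • ∑ i, g i := by
    rw [Finset.sum_comm' (t' := Finset.univ)
      (s' := fun i => (Finset.powersetCard b Finset.univ).filter ({i} ⊆ ·)) (by
        intro s i
        simp [Finset.singleton_subset_iff])]
    rw [Finset.smul_sum]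
    refine Finset.sum_congr rfl fun i _ => ?_
    rw [Finset.sum_const, Finset.card_filter_powersetCard_subset _ _ _ (Finset.subset_univ _)
      (by simpa using Nat.succ_le_iff.2 hb0)]
    simp [Nat.cast_smul_eq_nsmul]
  rw [Finset.sum_sub_distrib, ← Finset.smul_sum, h1, Finset.sum_const, smul_smul,
    ← Nat.cast_smul_eq_nsmul ℝ, smul_smul, ← sub_smul]
  obtain ⟨b, rfl⟩ := Nat.exists_eq_add_of_lt hb0
  obtain ⟨n, rfl⟩ := Nat.exists_eq_add_of_lt (hb0.trans_le hb)
  have h2 := Nat.add_one_mul_choose_eq n b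
  have h3 : ((n : ℝ) + 1) * (n.choose b) = ((n + 1).choose (b + 1)) * ((b : ℝ) + 1) := by
    exact_mod_cast h2
  have e : (((0 + b + 1 : ℕ) : ℝ)⁻¹ * (((0 + n + 1 - 1).choose (0 + b + 1 - 1) : ℕ) : ℝ) -
      ((Finset.powersetCard (0 + b + 1) (Finset.univ : Finset (Fin (0 + n + 1)))).card : ℝ) *
        ((0 + n + 1 : ℕ) : ℝ)⁻¹) = 0 := by
    simp only [zero_add, Finset.card_powersetCard, Finset.card_univ, Fintype.card_fin,
      Nat.add_sub_cancel, Nat.cast_add, Nat.cast_one]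
    field_simp
    linarith
  rw [e, zero_smul]

end Sampling

/-! ### Unbiasedness and dependence on past batches -/

section History

variable {d n b : ℕ} {ℓ : Fin n → Vec d → ℝ} {N : Set (Vec d)}

/-- Where some sample loss fails to be differentiable, `gradient` takes a default value and
additivity may fail; so unbiasedness is available only on `N`. -/
theorem gradient_empLoss (hN : IsOpen N) (hℓ : ∀ i, ContDiffOn ℝ 4 (ℓ i) N) {θ : Vec d}
    (hθ : θ ∈ N) : gradient (empLoss ℓ) θ = (n : ℝ)⁻¹ • ∑ i, gradient (ℓ i) θ := by
  have h1 : ∀ i, HasFDerivAt (ℓ i) (fderiv ℝ (ℓ i) θ) θ := fun i =>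
    (((hℓ i).contDiffAt (hN.mem_nhds hθ)).differentiableAt (by norm_num)).hasFDerivAt
  have h2 : HasFDerivAt (empLoss ℓ) ((n : ℝ)⁻¹ • ∑ i, fderiv ℝ (ℓ i) θ) θ :=
    (HasFDerivAt.fun_sum fun i _ => h1 i).const_mul _
  simp only [gradient, h2.fderiv, map_smul, map_sum]

theorem contDiffOn_empLoss (hℓ : ∀ i, ContDiffOn ℝ 4 (ℓ i) N) : ContDiffOn ℝ 4 (empLoss ℓ) N :=
  contDiffOn_const.mul (ContDiffOn.sum fun i _ => hℓ i)

/-- The mini-batch gradient is unbiased. -/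
theorem sum_batchGrad_sub (hN : IsOpen N) (hℓ : ∀ i, ContDiffOn ℝ 4 (ℓ i) N) (hb0 : 0 < b)
    (hb : b ≤ n) {θ : Vec d} (hθ : θ ∈ N) :
    ∑ s ∈ Finset.powersetCard b Finset.univ, (batchGrad ℓ b s θ - gradient (empLoss ℓ) θ) = 0 := by
  rw [gradient_empLoss hN hℓ hθ]
  exact sum_powersetCard_sum hb0 hb _

theorem dependsOn_sgd (ℓ : Fin n → Vec d → ℝ) (b : ℕ) (η : ℝ) (θ₀ : Vec d) (t : ℕ) :
    DependsOn (fun B => sgd ℓ η b θ₀ B t) (Set.Iio t) := by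
  induction t with
  | zero => exact fun _ _ _ => rfl
  | succ t ih =>
    intro x y hxy
    have h1 := ih fun i hi => hxy i (Set.mem_Iio.2 (Nat.lt_succ_of_lt hi))
    have h2 := hxy t (Set.mem_Iio.2 t.lt_succ_self)
    simp only at h1
    simp only [sgd, h1, h2]

theorem dependsOn_noise (ℓ : Fin n → Vec d → ℝ) (b : ℕ) (η : ℝ) (θ₀ : Vec d) (t : ℕ) :
    DependsOn (fun B => noise ℓ η b θ₀ B t) (Set.Iio (t + 1)) := by
  intro x y hxy
  have h1 := dependsOn_sgd ℓ b η θ₀ t fun i hi => hxy i (Set.mem_Iio.2 (Nat.lt_succ_of_lt hi))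
  have h2 := hxy t (Set.mem_Iio.2 t.lt_succ_self)
  simp only at h1
  simp only [noise, h1, h2]

theorem dependsOn_predicted (ℓ : Fin n → Vec d → ℝ) (b : ℕ) (η : ℝ) (θ₀ : Vec d)
    (L : Vec d → ℝ) (u : Vec d → Vec d) (θc : ℕ → Vec d) (v₀ : Vec d) (t : ℕ) :
    DependsOn (fun B => predicted L u η θc v₀ (noise ℓ η b θ₀ B) t) (Set.Iio t) := by
  induction t with
  | zero => exact fun _ _ _ => rfl
  | succ t ih =>
    intro x y hxy
    have h1 := ih fun i hi => hxy i (Set.mem_Iio.2 (Nat.lt_succ_of_lt hi))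
    have h2 := dependsOn_noise ℓ b η θ₀ t hxy
    simp only at h1 h2
    simp only [predicted, h1, h2]

end History

/-! ### The predicted dynamics stay small with high probability -/

section Stay

variable {d n b : ℕ} {ℓ : Fin n → Vec d → ℝ} {u : Vec d → Vec d} {N : Set (Vec d)}
  {η ρ C ε δ K : ℝ} {T : ℕ} {θc : ℕ → Vec d} {Ω : Type*} [MeasurableSpace Ω] {P : Measure Ω}
  {B : ℕ → Ω → Finset (Fin n)}

theorem sgd_succ_eq (ℓ : Fin n → Vec d → ℝ) (η : ℝ) (b : ℕ) (θ₀ : Vec d)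
    (x : ℕ → Finset (Fin n)) (t : ℕ) :
    sgd ℓ η b θ₀ x (t + 1) = sgd ℓ η b θ₀ x t -
      η • (gradient (empLoss ℓ) (sgd ℓ η b θ₀ x t) + noise ℓ η b θ₀ x t) := by
  simp [sgd, noise]

/-- The batch sequences for which the predicted dynamics up to time `t` and the scaled noise before
time `t` stay in the ball of radius `R`. -/
def staySequences (ℓ : Fin n → Vec d → ℝ) (u : Vec d → Vec d) (η : ℝ) (b : ℕ) (θ₀ : Vec d)
    (θc : ℕ → Vec d) (R : ℝ) (t : ℕ) : Set (ℕ → Finset (Fin n)) :=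
  stayEvent (fun t x => predicted (empLoss ℓ) u η θc (θ₀ - θc 0) (noise ℓ η b θ₀ x) t)
    (fun t x => η • noise ℓ η b θ₀ x t) R t

theorem dependsOn_mem_staySequences (θ₀ : Vec d) (R : ℝ) (t : ℕ) :
    DependsOn (fun x => x ∈ staySequences ℓ u η b θ₀ θc R t) (Set.Iio t) := by
  intro x y hxy
  have h1 : ∀ s ≤ t, predicted (empLoss ℓ) u η θc (θ₀ - θc 0) (noise ℓ η b θ₀ x) s =
      predicted (empLoss ℓ) u η θc (θ₀ - θc 0) (noise ℓ η b θ₀ y) s := fun s hs =>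
    dependsOn_predicted ℓ b η θ₀ _ u θc _ s fun i hi => hxy i (lt_of_lt_of_le hi hs)
  have h2 : ∀ s < t, noise ℓ η b θ₀ x s = noise ℓ η b θ₀ y s := fun s hs =>
    dependsOn_noise ℓ b η θ₀ s fun i hi => hxy i (Set.mem_Iio.2 (by
      have := Set.mem_Iio.1 hi
      omega))
  simp only [staySequences, stayEvent, Set.mem_ofPred_eq, eq_iff_iff]
  refine and_congr ?_ ?_
  · exact forall₂_congr fun s hs => by rw [h1 s hs]
  · exact forall₂_congr fun s hs => by rw [h2 s hs]

theorem measurableSet_stay (hB : ∀ t s, MeasurableSet {ω | B t ω = s}) (θ₀ : Vec d) (R : ℝ)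
    (t : ℕ) :
    MeasurableSet {ω | (fun s => B s ω) ∈ staySequences ℓ u η b θ₀ θc R t} :=
  measurableSet_setOfPred.2 (measurable_of_dependsOn hB (dependsOn_mem_staySequences θ₀ R t))

namespace EdgeTrajectory

/-- On the stay event, SGD remains in the neighbourhood on which the losses are smooth. -/
theorem sgd_mem (h : EdgeTrajectory (empLoss ℓ) u N η ρ C ε T θc)
    (hδ : ∀ t ≤ T, deltaAt (empLoss ℓ) u (θc t) ≤ δ) (hσδ : η * ρ * δ ≤ 2 * C * ε)
    (hεδ : ε ≤ η * ρ * δ) (hK : 1 ≤ K) (hsmall : 3200 * K ^ 4 * C ^ 2 * ε ≤ 1)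
    (hJ : couplingConst C K * ε ≤ 1) {θ₀ : Vec d} {t : ℕ} (ht : t ≤ T)
    {x : ℕ → Finset (Fin n)} (hx : x ∈ staySequences ℓ u η b θ₀ θc (K * δ) t) :
    sgd ℓ η b θ₀ x t ∈ N := by
  have hδ0 : 0 ≤ δ := (Real.sqrt_nonneg _).trans (hδ 0 (Nat.zero_le T))
  have h1 := h.coupling hδ hσδ hεδ hK hsmall hJ (sgd_succ_eq ℓ η b θ₀ x) t ht hx.1
  have h2 := norm_le_of_coupled hδ0 hK hJ (hx.1 t le_rfl) h1
  have hsm : 200 * (2 * K) ^ 4 * C ^ 2 * ε ≤ 1 := by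
    calc 200 * (2 * K) ^ 4 * C ^ 2 * ε = 3200 * K ^ 4 * C ^ 2 * ε := by ring
      _ ≤ 1 := hsmall
  have h3 := h.ball t ht _ (h.C_mul_small (by linarith) hσδ hsm h2).2
  rwa [add_sub_cancel] at h3

/-- The indicator depends only on batches before time `t`, and by the pathwise coupling it confines
the SGD iterate to `N`, where the current batch gradient is unbiased. -/
theorem integral_inner_noise_eq_zero [IsProbabilityMeasure P]
    (h : EdgeTrajectory (empLoss ℓ) u N η ρ C ε T θc)
    (hδ : ∀ t ≤ T, deltaAt (empLoss ℓ) u (θc t) ≤ δ) (hσδ : η * ρ * δ ≤ 2 * C * ε)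
    (hεδ : ε ≤ η * ρ * δ) (hK : 1 ≤ K) (hsmall : 3200 * K ^ 4 * C ^ 2 * ε ≤ 1)
    (hJ : couplingConst C K * ε ≤ 1) (hℓ : ∀ i, ContDiffOn ℝ 4 (ℓ i) N)
    (hB : IsUniformSampling P b B) (hb0 : 0 < b) (hb : b ≤ n) (θ₀ : Vec d) {t : ℕ} (ht : t ≤ T)
    {l : (ℕ → Finset (Fin n)) → Vec d} (hl : DependsOn l (Set.Iio t)) :
    ∫ ω, {ω | (fun s => B s ω) ∈ staySequences ℓ u η b θ₀ θc (K * δ) t}.indicator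
      (fun ω => inner ℝ (l fun s => B s ω) (η • noise ℓ η b θ₀ (fun s => B s ω) t)) ω ∂P = 0 := by
  classical
  refine Eq.trans ?_ (hB.integral_eq_zero hb (t := t)
    (φ := fun s x => if x ∈ staySequences ℓ u η b θ₀ θc (K * δ) t then
      inner ℝ (l x) (η • (batchGrad ℓ b s (sgd ℓ η b θ₀ x t) -
        gradient (empLoss ℓ) (sgd ℓ η b θ₀ x t))) else 0) ?_ ?_)
  · congr 1
  · intro s x y hxy
    have h1 := dependsOn_mem_staySequences (ℓ := ℓ) (u := u) (η := η) (b := b) (θc := θc) θ₀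
      (K * δ) t hxy
    have h2 := hl hxy
    have h3 := dependsOn_sgd ℓ b η θ₀ t hxy
    simp only at h1 h2 h3
    simp only [h1, h2, h3]
  · intro x
    by_cases hx : x ∈ staySequences ℓ u η b θ₀ θc (K * δ) t
    · simp only [hx, if_true]
      rw [← inner_sum, ← Finset.smul_sum, sum_batchGrad_sub h.reg.isOpen hℓ hb0 hb
        (h.sgd_mem hδ hσδ hεδ hK hsmall hJ ht hx), smul_zero, inner_zero_right]
    · simp [hx]

/-- The right side is free of `K`: this is what makes the exit probability small for large `K`. -/
theorem prob_exit_le [IsProbabilityMeasure P]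
    (h : EdgeTrajectory (empLoss ℓ) u N η ρ C ε T θc)
    (hδ : ∀ t ≤ T, deltaAt (empLoss ℓ) u (θc t) ≤ δ) (hσδ : η * ρ * δ ≤ 2 * C * ε)
    (hεδ : ε ≤ η * ρ * δ) (hK : 1 ≤ K) (hsmall : 3200 * K ^ 4 * C ^ 2 * ε ≤ 1)
    (hJ : couplingConst C K * ε ≤ 1) (hℓ : ∀ i, ContDiffOn ℝ 4 (ℓ i) N)
    (hB : IsUniformSampling P b B) (hb0 : 0 < b) (hb : b ≤ n) {θ₀ : Vec d}
    (h0 : ‖θ₀ - θc 0‖ ≤ δ)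
    (hξ : ∀ t ≤ T, ∫ ω, ‖noise ℓ η b θ₀ (fun s => B s ω) t‖ ^ 2 ∂P ≤ C * (ε * δ ^ 2 / η ^ 2)) :
    P.real {ω | (fun s => B s ω) ∈ staySequences ℓ u η b θ₀ θc (K * δ) T}ᶜ * (K * δ) ^ 2 ≤
      2 * Real.exp (12000 * C ^ 4) * (3 + 12000 * C ^ 4 + 14 * C) * δ ^ 2 := by
  have hC := h.C_ge
  have hC0 : 0 < C := by linarith
  have hη := h.η_pos
  have hρ := h.ρ_pos
  have hε := h.ε_nonneg
  have hδ0 : 0 ≤ δ := (Real.sqrt_nonneg _).trans (hδ 0 (Nat.zero_le T))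
  have hR : 0 ≤ K * δ := by positivity
  have hsm : 10 * K ^ 4 * (20 * C ^ 2) * ε ≤ 1 := by
    have : 0 ≤ K ^ 4 * C ^ 2 * ε := by positivity
    linarith
  -- Before stopping, a predicted step has norm at most `4Kδ` and the noise at most `Kδ`; up to
  -- `5Kδ` the energy is still comparable to the squared norm.
  have hσ5 : η * ρ * (5 * (K * δ)) ≤ 1 := by
    have h1 : K ≤ K ^ 4 := by
      calc K = K ^ 1 := (pow_one K).symm
        _ ≤ _ := pow_le_pow_right₀ hK (by norm_num)
    have h2 : C ≤ C ^ 2 := by nlinarith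
    calc η * ρ * (5 * (K * δ)) = 5 * K * (η * ρ * δ) := by ring
      _ ≤ 5 * K * (2 * C * ε) := by gcongr
      _ = 10 * (K * C * ε) := by ring
      _ ≤ 10 * (K ^ 4 * C ^ 2 * ε) := by gcongr
      _ ≤ 1 := by
        have : 0 ≤ K ^ 4 * C ^ 2 * ε := by positivity
        linarith
  set X' : ℕ → (ℕ → Finset (Fin n)) → Vec d := fun t x =>
    predicted (empLoss ℓ) u η θc (θ₀ - θc 0) (noise ℓ η b θ₀ x) t with hX'
  set l' : ℕ → (ℕ → Finset (Fin n)) → Vec d := fun t x =>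
    energyGradient (u (θc t)) (u (θc (t + 1))) (η • gradSperp (empLoss ℓ) u (θc t))
      (η • hess (empLoss ℓ) (θc t)) (η * kappa (empLoss ℓ) u (θc t))
      (η * kappa (empLoss ℓ) u (θc (t + 1))) (deltaAt (empLoss ℓ) u (θc t)) (X' t x) with hl'
  have hXd : ∀ t, DependsOn (X' t) (Set.Iio t) := fun t =>
    dependsOn_predicted ℓ b η θ₀ _ u θc _ t
  have hld : ∀ t, DependsOn (l' t) (Set.Iio t) := fun t x y hxy => by
    simp only [hl', hXd t hxy]
  have hnorm_u : ∀ t ≤ T, ‖u (θc t)‖ = 1 := fun t ht => by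
    obtain ⟨s, -, hp⟩ := h.exists_edgePoint t ht
    exact hp.norm_u
  have hκ : ∀ t ≤ T, |η * kappa (empLoss ℓ) u (θc t)| ≤ η * ρ := fun t ht => by
    obtain ⟨s, -, hp⟩ := h.exists_edgePoint t ht
    rw [abs_mul, abs_of_pos hη]
    exact hp.abs_kappa_le
  have hσR : ∀ v : Vec d, ‖v‖ ≤ 5 * (K * δ) → η * ρ * ‖v‖ ≤ 1 := fun v hv =>
    le_trans (by gcongr) hσ5
  have hsucc : ∀ t x, X' (t + 1) x = modelStep (u (θc t)) (u (θc (t + 1)))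
      (η • gradSperp (empLoss ℓ) u (θc t)) (η • hess (empLoss ℓ) (θc t))
      (η * kappa (empLoss ℓ) u (θc t)) (deltaAt (empLoss ℓ) u (θc t)) (X' t x) -
        η • noise ℓ η b θ₀ x t := fun t x => by
    rw [← predStep_eq_modelStep]
    rfl
  refine exit_probability_le P
    (X := fun t ω => X' t fun s => B s ω)
    (ζ := fun t ω => η • noise ℓ η b θ₀ (fun s => B s ω) t)
    (l := fun t ω => l' t fun s => B s ω)
    (En := fun t ω => energy (u (θc t)) (η * kappa (empLoss ℓ) u (θc t)) (X' t fun s => B s ω))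
    (R := K * δ) hε h.T_le (by positivity) hC0.le hR ?_ ?_ ?_ ?_ ?_ ?_ ?_ ?_ ?_ ?_ ?_ ?_
  · exact fun t _ => measurableSet_stay hB.1 θ₀ (K * δ) t
  · intro t _
    exact integrable_of_dependsOn hB.1 (t := t) (φ := fun x =>
      energy (u (θc t)) (η * kappa (empLoss ℓ) u (θc t)) (X' t x)) fun x y hxy => by
        simp only [hXd t hxy]
  · intro t _
    exact integrable_of_dependsOn hB.1 (t := t + 1) (φ := fun x => ‖η • noise ℓ η b θ₀ x t‖ ^ 2)
      fun x y hxy => by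
        have := dependsOn_noise ℓ b η θ₀ t hxy
        simp only at this
        simp only [this]
  · intro t _
    refine Integrable.indicator ?_ (measurableSet_stay hB.1 θ₀ (K * δ) t)
    exact integrable_of_dependsOn hB.1 (t := t + 1)
      (φ := fun x => inner ℝ (l' t x) (η • noise ℓ η b θ₀ x t)) fun x y hxy => by
        have h1 := dependsOn_noise ℓ b η θ₀ t hxy
        have h2 := hld t fun i hi => hxy i (Set.mem_Iio.2 (Nat.lt_succ_of_lt hi))
        simp only at h1
        simp only [h1, h2]
  · exact fun t ht => h.integral_inner_noise_eq_zero hδ hσδ hεδ hK hsmall hJ hℓ hB hb0 hb θ₀ ht.le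
      (hld t)
  · intro t ht
    simp only [norm_smul, mul_pow, Real.norm_of_nonneg hη.le]
    rw [integral_const_mul]
    calc _ ≤ η ^ 2 * (C * (ε * δ ^ 2 / η ^ 2)) := by gcongr; exact hξ t ht.le
      _ = _ := by field_simp
  · intro t ht ω hω
    exact (h.stepBounds hδ hσδ ht).norm_energyGradient_le hK hsm (hω.1 t le_rfl)
  · intro t ht ω hω
    refine le_trans (by positivity) (half_norm_sq_le_energy (hnorm_u t ht) (hκ t ht) (hσR _ ?_))
    exact (hω.1 t le_rfl).trans (by linarith)
  · intro t ht ω hω hζ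
    refine half_norm_sq_le_energy (hnorm_u (t + 1) ht) (hκ (t + 1) ht) (hσR _ ?_)
    have h1 := (h.stepBounds hδ hσδ ht).norm_modelStep_le hK hsm (hω.1 t le_rfl)
    rw [hsucc]
    refine (norm_sub_le _ _).trans ?_
    linarith
  · intro t ht ω hω hζ
    have h1 := (h.stepBounds hδ hσδ ht).energy_step_le hK hsm (hω.1 t le_rfl) hζ
    have e : 30 * (20 * C ^ 2) ^ 2 = 12000 * C ^ 4 := by ring
    simp only [hsucc]
    rw [← e]
    exact h1
  · intro ω
    refine (energy_le (hnorm_u 0 (Nat.zero_le T)) (hκ 0 (Nat.zero_le T)) (hσR _ ?_)).trans ?_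
    · change ‖θ₀ - θc 0‖ ≤ _
      nlinarith
    · change 3 * ‖θ₀ - θc 0‖ ^ 2 ≤ _
      gcongr
  · intro ω
    refine ⟨fun s hs => ?_, fun s hs => absurd hs (Nat.not_lt_zero s)⟩
    obtain rfl : s = 0 := by omega
    change ‖θ₀ - θc 0‖ ≤ _
    nlinarith

/-- With high probability, SGD and the predicted dynamics are coupled up to the horizon. -/
theorem prob_coupledAt_ge [IsProbabilityMeasure P]
    (h : EdgeTrajectory (empLoss ℓ) u N η ρ C ε T θc)
    (hδ : ∀ t ≤ T, deltaAt (empLoss ℓ) u (θc t) ≤ δ) (hσδ : η * ρ * δ ≤ 2 * C * ε)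
    (hεδ : ε ≤ η * ρ * δ) (hK : 1 ≤ K) (hsmall : 3200 * K ^ 4 * C ^ 2 * ε ≤ 1)
    (hJ : couplingConst C K * ε ≤ 1) (hℓ : ∀ i, ContDiffOn ℝ 4 (ℓ i) N)
    (hB : IsUniformSampling P b B) (hb0 : 0 < b) (hb : b ≤ n) {θ₀ : Vec d}
    (h0 : ‖θ₀ - θc 0‖ ≤ δ)
    (hξ : ∀ t ≤ T, ∫ ω, ‖noise ℓ η b θ₀ (fun s => B s ω) t‖ ^ 2 ∂P ≤ C * (ε * δ ^ 2 / η ^ 2))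
    (hT0 : δ = 0 → T = 0) {p : ℝ} (hp : 0 ≤ p)
    (hKp : 2 * Real.exp (12000 * C ^ 4) * (3 + 12000 * C ^ 4 + 14 * C) ≤ p * K ^ 2) :
    ENNReal.ofReal (1 - p) ≤ P {ω | ∀ t ≤ T, CoupledAt (finalConst C K) ε δ (empLoss ℓ) u η
      (sgd ℓ η b θ₀ (fun s => B s ω) t) (θc t)
      (predicted (empLoss ℓ) u η θc (θ₀ - θc 0) (noise ℓ η b θ₀ (fun s => B s ω)) t)} := by
  have hδ0 : 0 ≤ δ := (Real.sqrt_nonneg _).trans (hδ 0 (Nat.zero_le T))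
  set G := {ω | (fun s => B s ω) ∈ staySequences ℓ u η b θ₀ θc (K * δ) T} with hG
  have hsub : G ⊆ {ω | ∀ t ≤ T, CoupledAt (finalConst C K) ε δ (empLoss ℓ) u η
      (sgd ℓ η b θ₀ (fun s => B s ω) t) (θc t)
      (predicted (empLoss ℓ) u η θc (θ₀ - θc 0) (noise ℓ η b θ₀ (fun s => B s ω)) t)} := by
    intro ω hω t ht
    exact h.coupledAt hδ hσδ hεδ hK hsmall hJ (sgd_succ_eq ℓ η b θ₀ _) ht
      fun s hs => hω.1 s (hs.trans ht)
  refine le_trans ?_ (measure_mono hsub)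
  have hGm : MeasurableSet G := measurableSet_stay hB.1 θ₀ (K * δ) T
  rw [← ofReal_measureReal]
  refine ENNReal.ofReal_le_ofReal ?_
  -- If `δ = 0` the exit bound carries no information, but then `T = 0` and only the initial
  -- displacement, which vanishes, has to be considered.
  rcases hδ0.eq_or_lt with hz | hpos
  · have hT := hT0 hz.symm
    have : G = Set.univ := by
      refine Set.eq_univ_of_forall fun ω => ⟨fun s hs => ?_, fun s hs => ?_⟩
      · obtain rfl : s = 0 := by omega
        change ‖θ₀ - θc 0‖ ≤ _
        nlinarith
      · omega
    rw [this, probReal_univ]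
    linarith
  · have h1 := h.prob_exit_le hδ hσδ hεδ hK hsmall hJ hℓ hB hb0 hb h0 hξ
    have h2 : P.real Gᶜ * (K * δ) ^ 2 ≤ p * (K * δ) ^ 2 := by
      refine h1.trans ?_
      calc _ ≤ p * K ^ 2 * δ ^ 2 := by gcongr
        _ = _ := by ring
    have h3 := le_of_mul_le_mul_right h2 (by positivity)
    rw [probReal_compl_eq_one_sub hGm] at h3
    linarith

end EdgeTrajectory

end Stay

/-! ### From the assumptions to a single constant -/

section Assumptions

variable {d n : ℕ} {L : Vec d → ℝ} {u : Vec d → Vec d} {η ρ C : ℝ} {T : ℕ} {θc : ℕ → Vec d}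

theorem epsAt_le_eps (L : Vec d → ℝ) (η : ℝ) (θc : ℕ → Vec d) {t : ℕ} (ht : t ≤ T) :
    epsAt L η (θc t) ≤ eps L η T θc :=
  le_ciSup (f := fun t : Fin (T + 1) => epsAt L η (θc t)) (Set.finite_range _).bddAbove
    ⟨t, Nat.lt_succ_of_le ht⟩

theorem deltaAt_le_delta (L : Vec d → ℝ) (u : Vec d → Vec d) (θc : ℕ → Vec d) {t : ℕ}
    (ht : t ≤ T) : deltaAt L u (θc t) ≤ delta L u T θc :=
  le_ciSup (f := fun t : Fin (T + 1) => deltaAt L u (θc t)) (Set.finite_range _).bddAbove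
    ⟨t, Nat.lt_succ_of_le ht⟩

theorem eps_nonneg (hη : 0 ≤ η) (L : Vec d → ℝ) (T : ℕ) (θc : ℕ → Vec d) : 0 ≤ eps L η T θc :=
  (mul_nonneg hη (Real.sqrt_nonneg _)).trans (epsAt_le_eps L η θc (Nat.zero_le T))

/-- A constant dominating all those in the assumptions. -/
def dominatingConst (cgap cα cβ Cnw Cξ Cρ : ℝ) : ℝ :=
  8 + |Cnw| + |Cξ| + |Cρ| + 1 / cβ + 1 / (cα * cβ) + 4 / (2 - cgap)

theorem le_dominatingConst {cgap cα cβ : ℝ} (Cnw Cξ Cρ : ℝ) (hcgap : cgap < 2) (hcα : 0 < cα)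
    (hcβ : 0 < cβ) :
    8 ≤ dominatingConst cgap cα cβ Cnw Cξ Cρ ∧ Cnw ≤ dominatingConst cgap cα cβ Cnw Cξ Cρ ∧
      Cξ ≤ dominatingConst cgap cα cβ Cnw Cξ Cρ ∧ Cρ ≤ dominatingConst cgap cα cβ Cnw Cξ Cρ ∧
      1 / cβ ≤ dominatingConst cgap cα cβ Cnw Cξ Cρ ∧
      1 / (cα * cβ) ≤ dominatingConst cgap cα cβ Cnw Cξ Cρ ∧
      4 / (2 - cgap) ≤ dominatingConst cgap cα cβ Cnw Cξ Cρ := by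
  have h1 := le_abs_self Cnw
  have h2 := le_abs_self Cξ
  have h3 := le_abs_self Cρ
  have h1' := abs_nonneg Cnw
  have h2' := abs_nonneg Cξ
  have h3' := abs_nonneg Cρ
  have h4 : 0 ≤ 1 / cβ := by positivity
  have h5 : 0 ≤ 1 / (cα * cβ) := by positivity
  have h6 : 0 ≤ 4 / (2 - cgap) := div_nonneg (by norm_num) (by linarith)
  unfold dominatingConst
  refine ⟨?_, ?_, ?_, ?_, ?_, ?_, ?_⟩ <;> linarith

theorem sq_mul_alpha_le (hη : 0 < η) {t : ℕ} (ht : t ≤ T) (hα : 0 ≤ alpha L (θc t)) :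
    η ^ 2 * alpha L (θc t) ≤ eps L η T θc ^ 2 := by
  have h1 := epsAt_le_eps L η θc ht
  have h2 : 0 ≤ epsAt L η (θc t) := mul_nonneg hη.le (Real.sqrt_nonneg _)
  calc η ^ 2 * alpha L (θc t) = epsAt L η (θc t) ^ 2 := by
        rw [epsAt, mul_pow, Real.sq_sqrt hα]
    _ ≤ _ := by gcongr

theorem EdgeTrajectory.of_assumptions {cgap cα cβ Cnw Cρ ρ₄ : ℝ} {ℓ : Fin n → Vec d → ℝ}
    {N : Set (Vec d)} {θ₀ : Vec d} (hcgap : cgap < 2) (hcα : 0 < cα) (hcβ : 0 < cβ)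
    (hC : 8 ≤ C) (hnw : Cnw ≤ C) (hCρ : Cρ ≤ C) (hCβ : 1 / cβ ≤ C) (hCαβ : 1 / (cα * cβ) ≤ C)
    (hCgap : 4 / (2 - cgap) ≤ C) (hη : 0 < η) (hρ : 0 < ρ)
    (hu : IsTopEigenvectorField (empLoss ℓ) u)
    (hθc : IsConstrainedTrajectory (empLoss ℓ) u η T θ₀ θc)
    (hedge : sharpness (empLoss ℓ) (θc 0) = 2 / η)
    (hsign : ∀ t < T, 0 ≤ inner ℝ (u (θc t)) (u (θc (t + 1)))) (hN : IsOpen N)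
    (hball : ∀ t ≤ T, Metric.ball (θc t) ((2 - cgap) / (4 * η * ρ)) ⊆ N)
    (hℓ : ∀ i, ContDiffOn ℝ 4 (ℓ i) N) (hthird : ∀ θ ∈ N, ‖third (empLoss ℓ) θ‖ ≤ ρ)
    (hlip : ∀ θ ∈ N, ∀ θ' ∈ N,
      ‖third (empLoss ℓ) θ - third (empLoss ℓ) θ'‖ ≤ ρ₄ * ‖θ - θ'‖)
    (hsharp : ProgressiveSharpening cα cβ ρ (empLoss ℓ) u T θc)
    (hnwc : NonWorstCase Cnw ρ (empLoss ℓ) u η T θc)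
    (hT : (T : ℝ) ≤ 1 / eps (empLoss ℓ) η T θc) (hρ₄ : ρ₄ ≤ Cρ * (η * ρ ^ 2))
    (hsmall : 1000 * C ^ 3 * eps (empLoss ℓ) η T θc ≤ 1) :
    EdgeTrajectory (empLoss ℓ) u N η ρ C (eps (empLoss ℓ) η T θc) T θc := by
  have hC0 : 0 < C := by linarith
  have hε := eps_nonneg hη.le (empLoss ℓ) T θc
  have hα : ∀ t ≤ T, 0 ≤ alpha (empLoss ℓ) (θc t) := fun t ht =>
    le_trans (by positivity) (hsharp t ht).1
  have hmem : ∀ t ≤ T, θc t ∈ stableSet (empLoss ℓ) u η := by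
    intro t ht
    cases t with
    | zero => exact hθc.1.1
    | succ t => exact (hθc.2 t ht).1
  refine
    { reg := ⟨hN, contDiffOn_empLoss hℓ, hthird, fun θ hθ θ' hθ' => (hlip θ hθ θ' hθ').trans ?_⟩
      top := hu
      η_pos := hη
      ρ_pos := hρ
      C_ge := hC
      ε_nonneg := hε
      ε_small := hsmall
      T_le := ?_
      ball := fun t ht v hv => hball t ht ?_
      stat := fun t ht => (hmem t ht).2
      sharp_zero := by rw [hedge]; field_simp
      proj := hθc.2
      sign := hsign
      perp_ge := fun t ht => ?_
      alpha_nonneg := hα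
      alpha_le := fun t ht => sq_mul_alpha_le hη ht (hα t ht)
      grad_le := fun t ht => ?_
      form := fun t ht v hv => ((hnwc t ht).2.1 v hv).trans ?_
      third_perp := fun t ht v w hv hw => ((hnwc t ht).1 v w hv hw).trans ?_ }
  · gcongr
    refine hρ₄.trans ?_
    gcongr
  · rcases hε.eq_or_lt with h0 | h0
    · rw [← h0]; simp
    · calc _ ≤ eps (empLoss ℓ) η T θc * (1 / eps (empLoss ℓ) η T θc) := by gcongr
        _ = 1 := by field_simp
  · rw [mem_ball_iff_norm, add_sub_cancel_left, lt_div_iff₀ (by positivity)]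
    have h1 : 4 / (2 - cgap) * (η * ρ * ‖v‖) < 1 := lt_of_le_of_lt (by gcongr) hv
    rw [div_mul_eq_mul_div, div_lt_one (by linarith)] at h1
    linarith
  · have h1 := (hsharp t ht).2
    calc ρ = 1 / cβ * (cβ * ρ) := by field_simp
      _ ≤ C * ‖gradSperp (empLoss ℓ) u (θc t)‖ := by gcongr
  -- Progressive sharpening bounds the gradient by `α`: `cα cβ ρ₃ ‖∇L‖ ≤ α`, while `η²α ≤ ε²`.
  · obtain ⟨h1, h2⟩ := hsharp t ht
    have h3 := sq_mul_alpha_le hη ht (hα t ht)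
    have h4 : cα * (‖gradient (empLoss ℓ) (θc t)‖ * (cβ * ρ)) ≤ alpha (empLoss ℓ) (θc t) :=
      le_trans (by gcongr) h1
    calc _ = 1 / (cα * cβ) *
          (η ^ 2 * (cα * (‖gradient (empLoss ℓ) (θc t)‖ * (cβ * ρ)))) := by
          field_simp
      _ ≤ C * (η ^ 2 * alpha (empLoss ℓ) (θc t)) := by gcongr
      _ ≤ _ := by gcongr
  · gcongr
  · gcongr

namespace EdgeTrajectory

variable {N : Set (Vec d)} (h : EdgeTrajectory L u N η ρ C (eps L η T θc) T θc)
include h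

/-- Since `δ_t² = 2α/β`, the lower bound on `‖∇S^⊥‖` gives this inequality, and the upper bound
`‖∇S^⊥‖ ≤ ρ` gives the converse one below. Thus `ε` and `σδ` are interchangeable up to constants. -/
theorem mul_delta_le : η * ρ * delta L u T θc ≤ 2 * C * eps L η T θc := by
  have hη := h.η_pos
  have hρ := h.ρ_pos
  have hε := h.ε_nonneg
  have hC0 : 0 < C := by linarith [h.C_ge]
  have key : delta L u T θc ≤ 2 * C * eps L η T θc / (η * ρ) := by
    refine ciSup_le fun t => ?_
    have ht : (t : ℕ) ≤ T := Nat.le_of_lt_succ t.2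
    have h1 := h.perp_ge t ht
    have h2 := h.alpha_le t ht
    have h3 := h.alpha_nonneg t ht
    have hg : 0 < ‖gradSperp L u (θc t)‖ := by
      by_contra hc
      have : C * ‖gradSperp L u (θc t)‖ ≤ 0 :=
        mul_nonpos_of_nonneg_of_nonpos hC0.le (not_lt.1 hc)
      linarith
    refine Real.sqrt_le_iff.2 ⟨by positivity, ?_⟩
    rw [beta, div_pow, div_le_div_iff₀ (by positivity) (by positivity)]
    calc 2 * alpha L (θc t) * (η * ρ) ^ 2 = 2 * (η ^ 2 * alpha L (θc t)) * ρ ^ 2 := by ring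
      _ ≤ 2 * eps L η T θc ^ 2 * (C * ‖gradSperp L u (θc t)‖) ^ 2 := by gcongr
      _ = 2 * (eps L η T θc * C * ‖gradSperp L u (θc t)‖) ^ 2 := by ring
      _ ≤ 4 * (eps L η T θc * C * ‖gradSperp L u (θc t)‖) ^ 2 := by gcongr; norm_num
      _ = _ := by ring
  rw [le_div_iff₀ (by positivity)] at key
  linarith

theorem eps_le_mul_delta : eps L η T θc ≤ η * ρ * delta L u T θc := by
  have hη := h.η_pos
  have hρ := h.ρ_pos
  refine ciSup_le fun t => ?_
  have ht : (t : ℕ) ≤ T := Nat.le_of_lt_succ t.2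
  obtain ⟨s, -, hp⟩ := h.exists_edgePoint t ht
  have h1 := deltaAt_le_delta L u θc ht
  have h2 := le_of_mul_le_mul_left hp.norm_gradSperp_le hη
  have h3 := h.alpha_nonneg t ht
  have hg : 0 < ‖gradSperp L u (θc t)‖ := by
    by_contra hc
    have : C * ‖gradSperp L u (θc t)‖ ≤ 0 :=
      mul_nonpos_of_nonneg_of_nonpos hp.C_pos.le (not_lt.1 hc)
    linarith [h.perp_ge t ht]
  rw [mul_assoc, epsAt]
  refine mul_le_mul_of_nonneg_left (le_trans ?_ (mul_le_mul_of_nonneg_left h1 hρ.le)) hη.le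
  refine Real.sqrt_le_iff.2 ⟨mul_nonneg hρ.le (Real.sqrt_nonneg _), ?_⟩
  rw [deltaAt, mul_pow, Real.sq_sqrt (by unfold beta; positivity), beta, ← mul_div_assoc,
    le_div_iff₀ (by positivity)]
  calc alpha L (θc t) * ‖gradSperp L u (θc t)‖ ^ 2 ≤ alpha L (θc t) * ρ ^ 2 := by gcongr
    _ ≤ ρ ^ 2 * (2 * alpha L (θc t)) := by nlinarith [mul_nonneg (sq_nonneg ρ) h3]

end EdgeTrajectory

end Assumptions

end SGDCoupling

end

/-! ### Conclusion: choice of the constants -/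

theorem theorem1
    (cgap cα cβ Cnw Cξ Cρ : ℝ) (hcgap : cgap < 2) (hcα : 0 < cα) (hcβ : 0 < cβ) :
    ∃ cT : ℝ, 0 < cT ∧ ∃ c₀ : ℝ, 0 < c₀ ∧
      ∀ p : ℝ, 0 < p → p < 1 →
        ∃ ε₀ : ℝ, 0 < ε₀ ∧ ∃ C : ℝ, 0 < C ∧
          ∀ (d n b T : ℕ) (ℓ : Fin n → SGDCoupling.Vec d → ℝ) (η ρ₃ ρ₄ : ℝ)
            (u : SGDCoupling.Vec d → SGDCoupling.Vec d) (θ₀ : SGDCoupling.Vec d)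
            (θc : ℕ → SGDCoupling.Vec d)
            (Ω : Type*) (_ : MeasurableSpace Ω) (P : MeasureTheory.Measure Ω)
            (_ : MeasureTheory.IsProbabilityMeasure P) (B : ℕ → Ω → Finset (Fin n)),
            0 < b → b ≤ n → 0 < η → 0 < ρ₃ →
            SGDCoupling.IsUniformSampling P b B →
            SGDCoupling.IsTopEigenvectorField (SGDCoupling.empLoss ℓ) u →
            SGDCoupling.IsConstrainedTrajectory (SGDCoupling.empLoss ℓ) u η T θ₀ θc →
            -- the trajectory starts at the edge of stability
            SGDCoupling.sharpness (SGDCoupling.empLoss ℓ) (θc 0) = 2 / η →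
            -- consistent choice of the signs of the eigenvectors
            (∀ t < T, 0 ≤ inner ℝ (u (θc t)) (u (θc (t + 1)))) →
            SGDCoupling.Eigengap cgap (SGDCoupling.empLoss ℓ) η T θc →
            SGDCoupling.Regularity cgap ρ₃ ρ₄ ℓ η T θc →
            SGDCoupling.ProgressiveSharpening cα cβ ρ₃ (SGDCoupling.empLoss ℓ) u T θc →
            SGDCoupling.NonWorstCase Cnw ρ₃ (SGDCoupling.empLoss ℓ) u η T θc →
            SGDCoupling.NoiseNondegenerate P u T θc
              (fun ω => SGDCoupling.noise ℓ η b θ₀ (fun s => B s ω)) →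
            SGDCoupling.Scaling cT Cξ Cρ ρ₃ ρ₄ P (SGDCoupling.empLoss ℓ) u η T θc
              (fun ω => SGDCoupling.noise ℓ η b θ₀ (fun s => B s ω)) →
            SGDCoupling.eps (SGDCoupling.empLoss ℓ) η T θc ≤ ε₀ →
            ‖θ₀ - θc 0‖ ^ 2 ≤ c₀ * SGDCoupling.delta (SGDCoupling.empLoss ℓ) u T θc ^ 2 →
            ENNReal.ofReal (1 - p) ≤
              P {ω | ∀ t ≤ T,
                SGDCoupling.CoupledAt C
                  (SGDCoupling.eps (SGDCoupling.empLoss ℓ) η T θc)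
                  (SGDCoupling.delta (SGDCoupling.empLoss ℓ) u T θc)
                  (SGDCoupling.empLoss ℓ) u η
                  (SGDCoupling.sgd ℓ η b θ₀ (fun s => B s ω) t)
                  (θc t)
                  (SGDCoupling.predicted (SGDCoupling.empLoss ℓ) u η θc (θ₀ - θc 0)
                    (SGDCoupling.noise ℓ η b θ₀ (fun s => B s ω)) t)} := by
  obtain ⟨hC, hnw, hξ, hρ, hCβ, hCαβ, hCgap⟩ :=
    SGDCoupling.le_dominatingConst Cnw Cξ Cρ hcgap hcα hcβ
  generalize SGDCoupling.dominatingConst cgap cα cβ Cnw Cξ Cρ = C at *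
  have hC0 : 0 < C := by linarith
  refine ⟨1, one_pos, 1, one_pos, fun p hp _ => ?_⟩
  obtain ⟨A, hA⟩ : ∃ A, A = 2 * Real.exp (12000 * C ^ 4) * (3 + 12000 * C ^ 4 + 14 * C) := ⟨_, rfl⟩
  have hA0 : 0 ≤ A := by rw [hA]; positivity
  -- The exit probability is at most `A / K²`, and `A` depends on `C` alone; this `K` brings it
  -- below `p`.
  obtain ⟨K, hKdef⟩ : ∃ K, K = 1 + A / p := ⟨_, rfl⟩
  have hK : 1 ≤ K := by
    have : 0 ≤ A / p := by positivity
    linarith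
  have hKp : A ≤ p * K ^ 2 := by
    have h1 : p * K = p + A := by rw [hKdef]; field_simp
    have h2 : p * K ≤ p * K ^ 2 := by
      gcongr
      nlinarith
    linarith
  have hJ0 : 0 ≤ SGDCoupling.couplingConst C K := by
    unfold SGDCoupling.couplingConst
    positivity
  -- All smallness conditions have the form `q * ε ≤ 1` with `q` one of these summands, so `ε₀ = 1 /
  -- D` meets them together.
  obtain ⟨D, hD⟩ : ∃ D, D = 1 + 1000 * C ^ 3 + 3200 * K ^ 4 * C ^ 2 +
    SGDCoupling.couplingConst C K := ⟨_, rfl⟩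
  have hq1 : 0 ≤ 1000 * C ^ 3 := by positivity
  have hq2 : 0 ≤ 3200 * K ^ 4 * C ^ 2 := by positivity
  have hD0 : 0 < D := by linarith
  refine ⟨1 / D, by positivity, SGDCoupling.finalConst C K, ?_, ?_⟩
  · unfold SGDCoupling.finalConst
    positivity
  intro d n b T ℓ η ρ₃ ρ₄ u θ₀ θc Ω _ P _ B hb0 hb hη hρ₃ hB hu hθc hedge hsign _ hreg hsharp hnwc _
    hscal hε0 hv0
  obtain ⟨N, hN, hball, hℓ, hthird, hlip⟩ := hreg
  obtain ⟨hT, hnoise, hρ₄⟩ := hscal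
  have hε := SGDCoupling.eps_nonneg hη.le (SGDCoupling.empLoss ℓ) T θc
  have hεD : ∀ q, q ≤ D → q * SGDCoupling.eps (SGDCoupling.empLoss ℓ) η T θc ≤ 1 := by
    intro q hq
    calc _ ≤ D * (1 / D) := by gcongr
      _ = 1 := by field_simp
  have h := SGDCoupling.EdgeTrajectory.of_assumptions hcgap hcα hcβ hC hnw hρ hCβ hCαβ hCgap hη hρ₃
    hu hθc hedge hsign hN hball hℓ hthird hlip hsharp hnwc hT hρ₄ (hεD _ (by linarith))
  have hσδ := h.mul_delta_le
  have hεδ := h.eps_le_mul_delta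
  have hδ0 : 0 ≤ SGDCoupling.delta (SGDCoupling.empLoss ℓ) u T θc :=
    (Real.sqrt_nonneg _).trans
      (SGDCoupling.deltaAt_le_delta (SGDCoupling.empLoss ℓ) u θc (Nat.zero_le T))
  refine h.prob_coupledAt_ge
    (fun t ht => SGDCoupling.deltaAt_le_delta (SGDCoupling.empLoss ℓ) u θc ht) hσδ hεδ hK
    (hεD _ (by linarith)) (hεD _ (by linarith)) hℓ hB hb0 hb ?_ (fun t ht => ?_) (fun hz => ?_)
    hp.le (hA ▸ hKp)
  · rw [one_mul] at hv0
    exact le_of_sq_le_sq hv0 hδ0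
  · refine (hnoise t ht).trans ?_
    gcongr
  -- If `δ = 0` then `ε = 0`, and with the convention `1 / 0 = 0` the scaling assumption forces `T =
  -- 0`.
  · rw [hz, mul_zero] at hεδ
    rw [le_antisymm hεδ hε, div_zero] at hT
    exact_mod_cast le_antisymm hT (Nat.cast_nonneg T)
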